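/- Let $0<\gamma\le\infty$ and let $\psi:[0,\gamma)\to[0,\infty)$ be a non-zero, increasing (i.e. non-decreasing), concave function that is continuous on $(0,\gamma)$ and satisfies $\psi(0)=0$. Let $L_0(0,\gamma)$ be the space of (a.e.-equivalence classes of) Lebesgue measurable functions $f:(0,\gamma)\to\mathbb{R}$; for $f\in L_0(0,\gamma)$ let $f^*(t)=\inf\{s\ge 0: m(\{x\in(0,\gamma):|f(x)|>s\})\le t\}$, $t\geq 0$, be its decreasing rearrangement, where $m$ is Lebesgue measure and $\inf\emptyset=\infty$. Let $M_\psi(0,\gamma)$ be the real Marcinkiewicz space of all $f\in L_0(0,\gamma)$ with $$\|f\|_{M_\psi}=\sup_{0<t<\gamma}\frac{1}{\psi(t)}\int_0^t f^*(s)\,ds<\infty,$$ equipped with the norm $\|\cdot\|_{M_\psi}$. Then $M_\psi(0,\gamma)$ is a Grothendieck space (that is, a Banach space such that every weak-$*$ convergent sequence in its dual is weakly convergent) if and only if one of the following two conditions holds: (A) $\gamma=\infty$, $\displaystyle\liminf_{t\downarrow 0}\frac{\psi(2t)}{\psi(t)}>1$ and $\displaystyle\liminf_{t\to\infty}\frac{\psi(2t)}{\psi(t)}>1$;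 (B) $\gamma<\infty$ and $\displaystyle\liminf_{t\downarrow 0}\frac{\psi(2t)}{\psi(t)}>1$. -/

import Mathlib

open MeasureTheory Set Filter Topology
open scoped ENNReal

noncomputable section

/-! ### Distribution function and decreasing rearrangement -/

/-- The distribution function `d_{|f|}(s) = μ {x : |f x| > s}` of `|f|`. -/
def distribFun {α : Type*} [MeasurableSpace α] (μ : Measure α) (f : α → ℝ) (s : ℝ) : ℝ≥0∞ :=
  μ {x | s < |f x|}

/-- The decreasing rearrangement `f* (t) = inf {s ≥ 0 : d_{|f|}(s) ≤ t}`, with values in `[0, ∞]`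
(the infimum of the empty set is `∞`). -/
def rearrangement {α : Type*} [MeasurableSpace α] (μ : Measure α) (f : α → ℝ) (t : ℝ) : ℝ≥0∞ :=
  ⨅ (s : ℝ) (_ : 0 ≤ s ∧ distribFun μ f s ≤ ENNReal.ofReal t), ENNReal.ofReal s

section Rearrangement

variable {α : Type*} [MeasurableSpace α] {μ : Measure α}

theorem distribFun_congr {f g : α → ℝ} (h : f =ᵐ[μ] g) : distribFun μ f = distribFun μ g := by
  funext s
  refine measure_congr ?_
  filter_upwards [h] with x hx
  have : (s < |f x|) = (s < |g x|) := by rw [hx]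
  exact this

theorem rearrangement_congr {f g : α → ℝ} (h : f =ᵐ[μ] g) :
    rearrangement μ f = rearrangement μ g := by
  funext t
  simp only [rearrangement, distribFun_congr h]

theorem distribFun_antitone (f : α → ℝ) : Antitone (distribFun μ f) := fun _ _ hab =>
  measure_mono fun _ hx => lt_of_le_of_lt hab hx

theorem rearrangement_antitone (f : α → ℝ) : Antitone (rearrangement μ f) := fun _ _ hab =>
  le_iInf₂ fun s hs => iInf₂_le s ⟨hs.1, hs.2.trans (ENNReal.ofReal_le_ofReal hab)⟩

theorem exists_gt_lt_distribFun {f : α → ℝ} {s : ℝ} {c : ℝ≥0∞} (h : c < distribFun μ f s) :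
    ∃ s' > s, c < distribFun μ f s' := by
  have hU : {x | s < |f x|} = ⋃ n : ℕ, {x | s + 1 / ((n : ℝ) + 1) < |f x|} := by
    ext x
    simp only [mem_ofPred_eq, mem_iUnion]
    constructor
    · intro hx
      obtain ⟨n, hn⟩ := exists_nat_one_div_lt (sub_pos.2 hx)
      exact ⟨n, by linarith⟩
    · rintro ⟨n, hn⟩
      have : (0 : ℝ) < 1 / ((n : ℝ) + 1) := Nat.one_div_pos_of_nat
      linarith
  have hm : Monotone fun n : ℕ => {x | s + 1 / ((n : ℝ) + 1) < |f x|} := by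
    intro a b hab x hx
    have : 1 / ((b : ℝ) + 1) ≤ 1 / ((a : ℝ) + 1) := Nat.one_div_le_one_div hab
    simp only [mem_ofPred_eq] at hx ⊢
    linarith
  rw [distribFun, hU, hm.measure_iUnion, lt_iSup_iff] at h
  obtain ⟨n, hn⟩ := h
  exact ⟨_, lt_add_of_pos_right s Nat.one_div_pos_of_nat, hn⟩

theorem lt_rearrangement_iff {f : α → ℝ} {s t : ℝ} (hs : 0 ≤ s) :
    ENNReal.ofReal s < rearrangement μ f t ↔ ENNReal.ofReal t < distribFun μ f s := by
  constructor
  · intro h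
    by_contra! hc
    exact absurd h (not_lt.2 (iInf₂_le s ⟨hs, hc⟩))
  · intro h
    obtain ⟨s', hs', h'⟩ := exists_gt_lt_distribFun h
    refine lt_of_lt_of_le ((ENNReal.ofReal_lt_ofReal_iff (hs.trans_lt hs')).2 hs') ?_
    refine le_iInf₂ fun r hr => ENNReal.ofReal_le_ofReal ?_
    by_contra! hrs
    exact absurd (h'.trans_le (distribFun_antitone f hrs.le)) (not_lt.2 hr.2)

theorem volume_ofReal_lt (a : ℝ≥0∞) :
    volume ({s : ℝ | ENNReal.ofReal s < a} ∩ Ioi 0) = a := by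
  induction a with
  | top =>
    have : {s : ℝ | ENNReal.ofReal s < ∞} ∩ Ioi 0 = Ioi 0 := by
      ext s; simp
    rw [this, Real.volume_Ioi]
  | coe a =>
    have : {s : ℝ | ENNReal.ofReal s < a} ∩ Ioi 0 = Ioo 0 (a : ℝ) := by
      ext s
      simp only [mem_inter_iff, mem_ofPred_eq, mem_Ioi, mem_Ioo]
      rw [← ENNReal.ofReal_coe_nnreal]
      constructor
      · rintro ⟨h, h0⟩
        exact ⟨h0, (ENNReal.ofReal_lt_ofReal_iff_of_nonneg h0.le).1 h⟩
      · rintro ⟨h0, h⟩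
        exact ⟨(ENNReal.ofReal_lt_ofReal_iff_of_nonneg h0.le).2 h, h0⟩
    rw [this, Real.volume_Ioo, sub_zero, ENNReal.ofReal_coe_nnreal]

theorem volume_ofReal_lt_min (a : ℝ≥0∞) (t : ℝ) :
    volume ({u : ℝ | ENNReal.ofReal u < a} ∩ Ioo 0 t) = min (ENNReal.ofReal t) a := by
  rw [← volume_ofReal_lt (min (ENNReal.ofReal t) a)]
  congr 1
  ext u
  simp only [mem_inter_iff, mem_ofPred_eq, mem_Ioo, mem_Ioi, lt_min_iff]
  constructor
  · rintro ⟨h1, h2, h3⟩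
    exact ⟨⟨(ENNReal.ofReal_lt_ofReal_iff_of_nonneg h2.le).2 h3, h1⟩, h2⟩
  · rintro ⟨⟨h1, h2⟩, h3⟩
    exact ⟨h2, h3, (ENNReal.ofReal_lt_ofReal_iff_of_nonneg (le_of_lt h3)).1 h1⟩

theorem lintegral_rearrangement (f : α → ℝ) (t : ℝ) :
    ∫⁻ u in Ioo 0 t, rearrangement μ f u
      = ∫⁻ s in Ioi 0, min (ENNReal.ofReal t) (distribFun μ f s) := by
  have hmeas : Measurable (rearrangement μ f) := (rearrangement_antitone f).measurable
  have hset : MeasurableSet {p : ℝ × ℝ | ENNReal.ofReal p.2 < rearrangement μ f p.1} :=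
    measurableSet_lt (ENNReal.measurable_ofReal.comp measurable_snd) (hmeas.comp measurable_fst)
  have h1 : ∀ u, rearrangement μ f u = ∫⁻ s in Ioi (0 : ℝ),
      ({p : ℝ × ℝ | ENNReal.ofReal p.2 < rearrangement μ f p.1}.indicator 1 (u, s) : ℝ≥0∞) := by
    intro u
    have hm : MeasurableSet {s : ℝ | ENNReal.ofReal s < rearrangement μ f u} :=
      measurableSet_lt ENNReal.measurable_ofReal measurable_const
    have : (fun s => ({p : ℝ × ℝ | ENNReal.ofReal p.2 < rearrangement μ f p.1}.indicator 1 (u, s)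
        : ℝ≥0∞)) = {s : ℝ | ENNReal.ofReal s < rearrangement μ f u}.indicator 1 := by
      funext s; simp [indicator]
    rw [this, lintegral_indicator_one hm, Measure.restrict_apply hm, volume_ofReal_lt]
  calc ∫⁻ u in Ioo 0 t, rearrangement μ f u
      = ∫⁻ u in Ioo 0 t, ∫⁻ s in Ioi (0 : ℝ),
        ({p : ℝ × ℝ | ENNReal.ofReal p.2 < rearrangement μ f p.1}.indicator 1 (u, s) : ℝ≥0∞) :=
        lintegral_congr h1
    _ = ∫⁻ s in Ioi (0 : ℝ), ∫⁻ u in Ioo 0 t,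
        ({p : ℝ × ℝ | ENNReal.ofReal p.2 < rearrangement μ f p.1}.indicator 1 (u, s) : ℝ≥0∞) :=
        lintegral_lintegral_swap (measurable_one.indicator hset).aemeasurable
    _ = _ := by
        refine setLIntegral_congr_fun measurableSet_Ioi fun s hs => ?_
        have hm : MeasurableSet {u : ℝ | ENNReal.ofReal u < distribFun μ f s} :=
          measurableSet_lt ENNReal.measurable_ofReal measurable_const
        have : (fun u => ({p : ℝ × ℝ | ENNReal.ofReal p.2 < rearrangement μ f p.1}.indicator 1 (u, s)
            : ℝ≥0∞)) = {u : ℝ | ENNReal.ofReal u < distribFun μ f s}.indicator 1 := by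
          funext u; simp [indicator, lt_rearrangement_iff (le_of_lt hs)]
        simp only [this]
        rw [lintegral_indicator_one hm, Measure.restrict_apply hm, volume_ofReal_lt_min]

theorem lintegral_sub_eq {f : α → ℝ} (hf : AEMeasurable f μ) (s : ℝ) :
    ∫⁻ x, ENNReal.ofReal (|f x| - s) ∂μ = ∫⁻ u in Ioi s, distribFun μ f u := by
  have h1 : ∫⁻ x, ENNReal.ofReal (|f x| - s) ∂μ
      = ∫⁻ x, ENNReal.ofReal (max (|f x| - s) 0) ∂μ :=
    lintegral_congr fun x => by rw [ENNReal.ofReal_max]; simp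
  rw [h1, lintegral_eq_lintegral_meas_lt (f := fun x => max (|f x| - s) 0) μ
    (Eventually.of_forall fun x => le_max_right _ _)
    ((hf.abs.sub_const s).max aemeasurable_const)]
  have h2 : ∫⁻ u in Ioi 0, μ {a | u < max (|f a| - s) 0}
      = ∫⁻ u in Ioi 0, distribFun μ f (s + u) := by
    refine setLIntegral_congr_fun measurableSet_Ioi fun u hu => ?_
    have hu' : (0 : ℝ) < u := hu
    simp only [distribFun]
    congr 1
    ext a
    simp only [mem_ofPred_eq, lt_max_iff, not_lt.2 hu'.le, or_false]
    constructor <;> intro h <;> linarith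
  rw [h2, ← lintegral_indicator measurableSet_Ioi, ← lintegral_indicator measurableSet_Ioi,
    ← lintegral_add_left_eq_self ((Ioi s).indicator (distribFun μ f)) s]
  refine lintegral_congr fun u => ?_
  simp [indicator]

theorem lintegral_rearrangement_le {f : α → ℝ} (hf : AEMeasurable f μ) (t : ℝ) {s : ℝ}
    (hs : 0 ≤ s) :
    ∫⁻ u in Ioo 0 t, rearrangement μ f u
      ≤ ENNReal.ofReal t * ENNReal.ofReal s + ∫⁻ x, ENNReal.ofReal (|f x| - s) ∂μ := by
  rw [lintegral_rearrangement, lintegral_sub_eq hf s, ← Ioc_union_Ioi_eq_Ioi hs,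
    lintegral_union measurableSet_Ioi (Ioc_disjoint_Ioi le_rfl)]
  gcongr
  · refine (lintegral_mono fun u => min_le_left _ _).trans ?_
    simp
  · exact min_le_right _ _

theorem lintegral_rearrangement_eq {f : α → ℝ} (hf : AEMeasurable f μ) (t : ℝ)
    (ht : rearrangement μ f t ≠ ∞) :
    ∫⁻ u in Ioo 0 t, rearrangement μ f u
      = ENNReal.ofReal t * rearrangement μ f t
        + ∫⁻ x, ENNReal.ofReal (|f x| - (rearrangement μ f t).toReal) ∂μ := by
  set s := (rearrangement μ f t).toReal with hsdef
  have hs : 0 ≤ s := ENNReal.toReal_nonneg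
  have hs' : ENNReal.ofReal s = rearrangement μ f t := ENNReal.ofReal_toReal ht
  rw [lintegral_rearrangement, lintegral_sub_eq hf s, ← Ioc_union_Ioi_eq_Ioi hs,
    lintegral_union measurableSet_Ioi (Ioc_disjoint_Ioi le_rfl)]
  congr 1
  · rw [setLIntegral_congr Ioo_ae_eq_Ioc.symm,
      setLIntegral_congr_fun (g := fun _ => ENNReal.ofReal t) measurableSet_Ioo]
    · simp [hs']
    · intro u hu
      refine min_eq_left (le_of_lt ((lt_rearrangement_iff hu.1.le).1 ?_))
      rw [← hs']
      exact (ENNReal.ofReal_lt_ofReal_iff_of_nonneg hu.1.le).2 hu.2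
  · refine setLIntegral_congr_fun measurableSet_Ioi fun u hu => min_eq_right ?_
    have hu' : s < u := hu
    by_contra! hc
    have := (lt_rearrangement_iff (hs.trans hu'.le)).2 hc
    rw [← hs', ENNReal.ofReal_lt_ofReal_iff_of_nonneg (hs.trans hu'.le)] at this
    linarith

theorem lintegral_rearrangement_eq_top {f : α → ℝ} {t : ℝ} (ht : 0 < t)
    (h : rearrangement μ f t = ∞) : ∫⁻ u in Ioo 0 t, rearrangement μ f u = ∞ := by
  refine top_le_iff.1 (le_trans ?_ (setLIntegral_mono' (f := fun _ => ∞) measurableSet_Ioo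
    fun u hu => h ▸ rearrangement_antitone f hu.2.le))
  simp [ht]

/-- Subadditivity of `f ↦ ∫₀ᵗ f*(s) ds`. -/
theorem lintegral_rearrangement_add_le {f g : α → ℝ} (hf : AEMeasurable f μ)
    (hg : AEMeasurable g μ) {t : ℝ} (ht : 0 < t) :
    ∫⁻ u in Ioo 0 t, rearrangement μ (f + g) u
      ≤ (∫⁻ u in Ioo 0 t, rearrangement μ f u) + ∫⁻ u in Ioo 0 t, rearrangement μ g u := by
  by_cases h1 : rearrangement μ f t = ∞
  · simp [lintegral_rearrangement_eq_top ht h1]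
  by_cases h2 : rearrangement μ g t = ∞
  · simp [lintegral_rearrangement_eq_top ht h2]
  rw [lintegral_rearrangement_eq hf t h1, lintegral_rearrangement_eq hg t h2]
  set a := (rearrangement μ f t).toReal
  set b := (rearrangement μ g t).toReal
  have ha : 0 ≤ a := ENNReal.toReal_nonneg
  have hb : 0 ≤ b := ENNReal.toReal_nonneg
  refine (lintegral_rearrangement_le (hf.add hg) t (add_nonneg ha hb)).trans ?_
  rw [← ENNReal.ofReal_toReal h1, ← ENNReal.ofReal_toReal h2, add_add_add_comm, ← mul_add,
    ← ENNReal.ofReal_add ha hb,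
    ← lintegral_add_left' (hf.abs.sub_const a).ennreal_ofReal]
  gcongr with x
  refine le_trans (ENNReal.ofReal_le_ofReal ?_) ENNReal.ofReal_add_le
  have := abs_add_le (f x) (g x)
  simp only [Pi.add_apply]
  linarith

theorem rearrangement_zero (t : ℝ) : rearrangement μ (0 : α → ℝ) t = 0 := by
  refine nonpos_iff_eq_zero.1 ((iInf₂_le 0 ⟨le_rfl, ?_⟩).trans (by simp))
  simp [distribFun]

theorem rearrangement_smul_le (c : ℝ) (f : α → ℝ) (t : ℝ) :
    rearrangement μ (c • f) t ≤ ENNReal.ofReal |c| * rearrangement μ f t := by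
  rcases eq_or_ne c 0 with rfl | hc
  · simp [rearrangement_zero]
  have hc' : 0 < |c| := abs_pos.2 hc
  have h0 : ENNReal.ofReal |c| ≠ 0 := by simpa using hc
  rw [rearrangement, rearrangement, ENNReal.mul_iInf_of_ne h0 ENNReal.ofReal_ne_top]
  refine le_iInf fun s => ?_
  rw [ENNReal.mul_iInf_of_ne h0 ENNReal.ofReal_ne_top]
  refine le_iInf fun hs => ?_
  rw [← ENNReal.ofReal_mul hc'.le]
  refine iInf₂_le _ ⟨mul_nonneg hc'.le hs.1, ?_⟩
  refine le_trans (le_of_eq ?_) hs.2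
  simp only [distribFun]
  congr 1
  ext x
  simp [abs_mul, mul_lt_mul_iff_right₀ hc']

theorem rearrangement_smul (c : ℝ) (f : α → ℝ) (t : ℝ) :
    rearrangement μ (c • f) t = ENNReal.ofReal |c| * rearrangement μ f t := by
  refine le_antisymm (rearrangement_smul_le c f t) ?_
  rcases eq_or_ne c 0 with rfl | hc
  · simp
  have h := rearrangement_smul_le (μ := μ) c⁻¹ (c • f) t
  rw [smul_smul, inv_mul_cancel₀ hc, one_smul] at h
  calc ENNReal.ofReal |c| * rearrangement μ f t
      ≤ ENNReal.ofReal |c| * (ENNReal.ofReal |c⁻¹| * rearrangement μ (c • f) t) := by gcongr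
    _ = rearrangement μ (c • f) t := by
      rw [← mul_assoc, ← ENNReal.ofReal_mul (abs_nonneg c), ← abs_mul, mul_inv_cancel₀ hc]
      simp

theorem ae_eq_zero_of_lintegral_rearrangement {f : α → ℝ} {t : ℝ} (ht : 0 < t)
    (h : ∫⁻ u in Ioo 0 t, rearrangement μ f u = 0) : f =ᵐ[μ] 0 := by
  have h0 : distribFun μ f 0 = 0 := by
    by_contra hc
    obtain ⟨s, hs, hs'⟩ := exists_gt_lt_distribFun (pos_iff_ne_zero.2 hc)
    rw [lintegral_rearrangement] at h
    have hpos : 0 < min (ENNReal.ofReal t) (distribFun μ f s) :=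
      lt_min (ENNReal.ofReal_pos.2 ht) hs'
    have hle : min (ENNReal.ofReal t) (distribFun μ f s) * ENNReal.ofReal s ≤ 0 := by
      rw [← h]
      calc min (ENNReal.ofReal t) (distribFun μ f s) * ENNReal.ofReal s
          = ∫⁻ _ in Ioo 0 s, min (ENNReal.ofReal t) (distribFun μ f s) := by simp
        _ ≤ ∫⁻ u in Ioo 0 s, min (ENNReal.ofReal t) (distribFun μ f u) :=
          setLIntegral_mono' measurableSet_Ioo fun u hu =>
            min_le_min le_rfl (distribFun_antitone f hu.2.le)
        _ ≤ _ := lintegral_mono_set Ioo_subset_Ioi_self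
    exact absurd (ENNReal.mul_pos hpos.ne' (ENNReal.ofReal_pos.2 hs).ne') (not_lt.2 hle)
  rw [Filter.EventuallyEq, ae_iff]
  simpa [distribFun] using h0

end Rearrangement

/-! ### Marcinkiewicz spaces on `(0, γ)` -/

/-- The interval `[0, γ)` of the real line, for `γ ∈ [0, ∞]`. -/
def intervalIco (γ : ℝ≥0∞) : Set ℝ := {t | 0 ≤ t ∧ ENNReal.ofReal t < γ}

/-- The interval `(0, γ)` of the real line, for `γ ∈ [0, ∞]`. -/
def intervalIoo (γ : ℝ≥0∞) : Set ℝ := {t | 0 < t ∧ ENNReal.ofReal t < γ}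

/-- `L₀(0, γ)`: classes modulo a.e. equality of measurable real functions on `(0, γ)`, with
respect to Lebesgue measure. -/
abbrev LZero (γ : ℝ≥0∞) : Type := ℝ →ₘ[volume.restrict (intervalIoo γ)] ℝ

/-- `‖f‖ = sup_{0 < t < γ} (1 / ψ t) ∫₀ᵗ f*(s) ds`, as an element of `[0, ∞]`. -/
def marcinkiewiczENorm (ψ : ℝ → ℝ) (γ : ℝ≥0∞) (f : LZero γ) : ℝ≥0∞ :=
  ⨆ t ∈ intervalIoo γ,
    (∫⁻ s in Ioo 0 t, rearrangement (volume.restrict (intervalIoo γ)) f s) / ENNReal.ofReal (ψ t)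

theorem marcinkiewiczENorm_add_le (ψ : ℝ → ℝ) (γ : ℝ≥0∞) (f g : LZero γ) :
    marcinkiewiczENorm ψ γ (f + g) ≤ marcinkiewiczENorm ψ γ f + marcinkiewiczENorm ψ γ g := by
  refine iSup₂_le fun t ht => ?_
  rw [rearrangement_congr (AEEqFun.coeFn_add f g)]
  refine (ENNReal.div_le_div_right (lintegral_rearrangement_add_le f.aemeasurable g.aemeasurable
    ht.1) _).trans ?_
  rw [ENNReal.add_div]
  exact add_le_add
    (le_iSup₂ (f := fun t (_ : t ∈ intervalIoo γ) => (∫⁻ s in Ioo 0 t,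
      rearrangement (volume.restrict (intervalIoo γ)) f s) / ENNReal.ofReal (ψ t)) t ht)
    (le_iSup₂ (f := fun t (_ : t ∈ intervalIoo γ) => (∫⁻ s in Ioo 0 t,
      rearrangement (volume.restrict (intervalIoo γ)) g s) / ENNReal.ofReal (ψ t)) t ht)

theorem marcinkiewiczENorm_smul (ψ : ℝ → ℝ) (γ : ℝ≥0∞) (c : ℝ) (f : LZero γ) :
    marcinkiewiczENorm ψ γ (c • f) = ENNReal.ofReal |c| * marcinkiewiczENorm ψ γ f := by
  simp only [marcinkiewiczENorm, ENNReal.mul_iSup]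
  refine iSup_congr fun t => iSup_congr fun _ => ?_
  rw [rearrangement_congr (AEEqFun.coeFn_smul c f)]
  simp_rw [rearrangement_smul]
  rw [lintegral_const_mul' _ _ ENNReal.ofReal_ne_top, mul_div_assoc]

theorem marcinkiewiczENorm_eq_zero {ψ : ℝ → ℝ} {γ : ℝ≥0∞} {f : LZero γ}
    (h : marcinkiewiczENorm ψ γ f = 0) : f = 0 := by
  refine AEEqFun.ext (EventuallyEq.trans ?_ AEEqFun.coeFn_zero.symm)
  rcases (intervalIoo γ).eq_empty_or_nonempty with he | ⟨t, ht⟩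
  · rw [Filter.EventuallyEq, ae_iff]
    exact nonpos_iff_eq_zero.1 ((measure_mono (subset_univ _)).trans (by simp [he]))
  · refine ae_eq_zero_of_lintegral_rearrangement ht.1 ?_
    have := iSup₂_le_iff.1 h.le t ht
    rw [nonpos_iff_eq_zero, ENNReal.div_eq_zero_iff] at this
    exact this.resolve_right ENNReal.ofReal_ne_top

/-- The Marcinkiewicz space `M_ψ(0, γ) = {f ∈ L₀(0, γ) : ‖f‖ < ∞}`. -/
def marcinkiewiczSpace (ψ : ℝ → ℝ) (γ : ℝ≥0∞) : Submodule ℝ (LZero γ) where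
  carrier := {f | marcinkiewiczENorm ψ γ f < ∞}
  add_mem' hf hg := (marcinkiewiczENorm_add_le ψ γ _ _).trans_lt (ENNReal.add_lt_top.2 ⟨hf, hg⟩)
  zero_mem' := by
    have h := marcinkiewiczENorm_smul ψ γ 0 0
    rw [zero_smul, abs_zero, ENNReal.ofReal_zero, zero_mul] at h
    simp only [mem_ofPred_eq, h, ENNReal.zero_lt_top]
  smul_mem' c f hf := by
    simp only [mem_ofPred_eq, marcinkiewiczENorm_smul]
    exact ENNReal.mul_lt_top ENNReal.ofReal_lt_top hf

instance marcinkiewiczSpace.instNorm (ψ : ℝ → ℝ) (γ : ℝ≥0∞) : Norm (marcinkiewiczSpace ψ γ) :=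
  ⟨fun f => (marcinkiewiczENorm ψ γ f.1).toReal⟩

theorem marcinkiewiczSpace.core (ψ : ℝ → ℝ) (γ : ℝ≥0∞) :
    NormedSpace.Core ℝ (marcinkiewiczSpace ψ γ) where
  norm_nonneg _ := ENNReal.toReal_nonneg
  norm_smul c f := by
    change (marcinkiewiczENorm ψ γ (c • f.1)).toReal = _
    rw [marcinkiewiczENorm_smul, ENNReal.toReal_mul, ENNReal.toReal_ofReal (abs_nonneg c)]
    rfl
  norm_triangle f g := by
    change (marcinkiewiczENorm ψ γ (f.1 + g.1)).toReal ≤ _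
    refine (ENNReal.toReal_mono (ENNReal.add_lt_top.2 ⟨f.2, g.2⟩).ne
      (marcinkiewiczENorm_add_le ψ γ _ _)).trans_eq ?_
    rw [ENNReal.toReal_add (ne_of_lt f.2) (ne_of_lt g.2)]
    rfl
  norm_eq_zero_iff f := by
    constructor
    · intro h
      have h' : (marcinkiewiczENorm ψ γ f.1).toReal = 0 := h
      rw [ENNReal.toReal_eq_zero_iff] at h'
      exact Subtype.ext (marcinkiewiczENorm_eq_zero (h'.resolve_right (ne_of_lt f.2)))
    · rintro rfl
      change (marcinkiewiczENorm ψ γ 0).toReal = 0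
      have h := marcinkiewiczENorm_smul ψ γ 0 0
      rw [zero_smul, abs_zero, ENNReal.ofReal_zero, zero_mul] at h
      rw [h, ENNReal.toReal_zero]

instance marcinkiewiczSpace.instNormedAddCommGroup (ψ : ℝ → ℝ) (γ : ℝ≥0∞) :
    NormedAddCommGroup (marcinkiewiczSpace ψ γ) :=
  NormedAddCommGroup.ofCore (marcinkiewiczSpace.core ψ γ)

instance marcinkiewiczSpace.instNormedSpace (ψ : ℝ → ℝ) (γ : ℝ≥0∞) :
    NormedSpace ℝ (marcinkiewiczSpace ψ γ) :=
  NormedSpace.ofCore (marcinkiewiczSpace.core ψ γ)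

/-! ### Grothendieck spaces and the two conditions -/

/-- A Grothendieck space: a Banach space `X` such that every weak-* convergent sequence in the
dual `X*` converges weakly, i.e. for `σ(X*, X**)` (necessarily to the same limit). -/
structure IsGrothendieckSpace (X : Type*) [NormedAddCommGroup X] [NormedSpace ℝ X] : Prop where
  complete : CompleteSpace X
  weak_of_weakStar : ∀ (φ : ℕ → StrongDual ℝ X) (φ₀ : StrongDual ℝ X),
    Tendsto (fun n => StrongDual.toWeakDual (φ n)) atTop (𝓝 (StrongDual.toWeakDual φ₀)) →
    Tendsto (fun n => toWeakSpace ℝ (StrongDual ℝ X) (φ n)) atTop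
      (𝓝 (toWeakSpace ℝ (StrongDual ℝ X) φ₀))

/-- `γ = ∞` and `liminf ψ(2t)/ψ(t) > 1` both as `t ↓ 0` and as `t → ∞`; the lower limits are taken
in the extended reals. -/
def ConditionA (ψ : ℝ → ℝ) (γ : ℝ≥0∞) : Prop :=
  γ = ∞ ∧ 1 < liminf (fun t => ((ψ (2 * t) / ψ t : ℝ) : EReal)) (𝓝[>] 0) ∧
    1 < liminf (fun t => ((ψ (2 * t) / ψ t : ℝ) : EReal)) atTop

/-- `γ < ∞` and `liminf ψ(2t)/ψ(t) > 1` as `t ↓ 0`. -/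
def ConditionB (ψ : ℝ → ℝ) (γ : ℝ≥0∞) : Prop :=
  γ < ∞ ∧ 1 < liminf (fun t => ((ψ (2 * t) / ψ t : ℝ) : EReal)) (𝓝[>] 0)

end

/-!
*Sufficiency.* The conditions on `ψ` amount to power growth, and then every `f` in the
Marcinkiewicz space is a sum over `k : ℤ` of layers of height about `2 ^ k`. For suitable
`1 < q ≤ 2` and multiples `μ k` of Lebesgue measure, this makes the space a quotient of the space
of families `g k` of functions that are bounded uniformly, in absolute value and in `L^q(μ k)`.
Consider a pointwise null sequence of functionals on the latter. If it remains large on convex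
combinations of families whose mean `q`-th powers, of values and of `L^q` norms, are arbitrarily
small, then a gliding hump that removes the sets where single powers are large leads to
functionals on `ℓ^∞` that contradict Phillips' lemma. Otherwise the functionals are dominated by a
gauge `ν(|g|^q)^(1/q)` up to a small multiple of the norm. Such a gauge is uniformly smooth, which
forces some convex combination of the functionals to be small in norm. Hence the sequence is
weakly null.

*Necessity.* If `f j` and `T j` are bounded and biorthogonal and `∑ j, |T j x| ≤ C ‖x‖`, then the
tails `∑ j ≥ k, T j` form a weak-* null sequence that is not weakly null. If `ψ` is bounded, or
bounded below by a positive constant, then multiples of indicators of disjoint sets and averages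
over these sets provide such a system. Otherwise a weight that fails to double grows by a factor
of at most two on disjoint intervals `[t n, c n * t n]` with `c n → ∞`. Then `f j` is a
combination of the indicators of the `j`-th subintervals of length `t n`, and `T j` is a limit as
`n → ∞` of multiples of the averages over them.
-/

section SmoothGauge

variable {Y : Type*} [AddCommGroup Y] [Module ℝ Y]

/-- A gauge obeying the `q`-Clarkson inequality of the `L^q` seminorms with `1 ≤ q ≤ 2`; for
`1 < q` this is a form of uniform smoothness. -/
structure IsSmoothGauge (q : ℝ) (p : Y → ℝ) : Prop where
  nonneg : ∀ g, 0 ≤ p g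
  smul : ∀ (c : ℝ) g, p (c • g) = |c| * p g
  clarkson : ∀ f g, p (f + g) ^ q + p (f - g) ^ q ≤ 2 * (p f ^ q + p g ^ q)

namespace IsSmoothGauge

variable {q : ℝ} {p : Y → ℝ}

theorem add_add_sub_le (hp : IsSmoothGauge q p) (hq : 1 ≤ q) {u v : Y} {τ : ℝ} (hu : p u = 1)
    (hv : p v ≤ τ) : p (u + v) + p (u - v) ≤ 2 + 2 * τ ^ q := by
  have bernoulli (x : Y) : q * (p x - 1) ≤ p x ^ q - 1 := by
    have := one_add_mul_self_le_rpow_one_add (s := p x - 1) (by linarith [hp.nonneg x]) hq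
    rw [add_sub_cancel] at this
    linarith
  have clarkson := hp.clarkson u v
  rw [hu, Real.one_rpow] at clarkson
  have hvτ : p v ^ q ≤ τ ^ q := Real.rpow_le_rpow (hp.nonneg v) hv (by linarith)
  have hτ : 0 ≤ τ ^ q := (Real.rpow_nonneg (hp.nonneg v) q).trans hvτ
  nlinarith [bernoulli (u + v), bernoulli (u - v)]

variable {N : Seminorm ℝ Y} {a b ε τ : ℝ} {θ θ' : Y →ₗ[ℝ] ℝ}

theorem sub_apply_le_of_eq_one (hp : IsSmoothGauge q p) (hq : 1 ≤ q) (ha : 0 ≤ a) (hε : 0 ≤ ε)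
    (hθ : ∀ g, θ g ≤ a * p g + ε * N g) (hθ' : ∀ g, θ' g ≤ a * p g + ε * N g) {u v : Y}
    (hu : p u = 1) (hmid : 2 * (b + ε * N u) ≤ θ u + θ' u) (hv : p v ≤ τ) :
    θ v - θ' v ≤ 2 * (a - b) + 2 * a * τ ^ q + 2 * ε * N v := by
  have h₁ := hθ (u + v)
  have h₂ := hθ' (u - v)
  have hN₁ : ε * N (u + v) ≤ ε * (N u + N v) := by gcongr; exact map_add_le_add N u v
  have hN₂ : ε * N (u - v) ≤ ε * (N u + N v) := by gcongr; exact map_sub_le_add N u v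
  have hp' : a * (p (u + v) + p (u - v)) ≤ a * (2 + 2 * τ ^ q) :=
    mul_le_mul_of_nonneg_left (hp.add_add_sub_le hq hu hv) ha
  rw [map_add] at h₁
  rw [map_sub] at h₂
  linarith

/-- If two functionals are dominated by `a * p + ε * N` but their mean is not dominated by
`b * p + ε * N`, with `b` close to `a`, then they are close to each other up to `2 * ε * N`. -/
theorem sub_apply_le (hp : IsSmoothGauge q p) (hq : 1 ≤ q) (ha : 0 ≤ a) (hε : 0 ≤ ε) (hτ : 0 < τ)
    (hθ : ∀ g, θ g ≤ a * p g + ε * N g) (hθ' : ∀ g, θ' g ≤ a * p g + ε * N g) {f : Y}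
    (hmid : 2 * (b * p f + ε * N f) < θ f + θ' f) (g : Y) :
    θ g - θ' g ≤ p g * ((2 * (a - b) + 2 * a * τ ^ q) / τ) + 2 * ε * N g := by
  have hf : 0 < p f := (hp.nonneg f).lt_of_ne fun h => by
    have h₁ := hθ f
    have h₂ := hθ' f
    rw [← h, mul_zero] at h₁ h₂ hmid
    linarith
  have hu : p ((p f)⁻¹ • f) = 1 := by
    rw [hp.smul, abs_of_pos (inv_pos.2 hf), inv_mul_cancel₀ hf.ne']
  have hmid_u : 2 * (b + ε * N ((p f)⁻¹ • f)) ≤ θ ((p f)⁻¹ • f) + θ' ((p f)⁻¹ • f) := by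
    rw [map_smul θ, map_smul θ', map_smul_eq_mul N, Real.norm_of_nonneg (inv_pos.2 hf).le,
      smul_eq_mul, smul_eq_mul, ← mul_add, le_inv_mul_iff₀ hf]
    refine le_of_eq_of_le ?_ hmid.le
    field_simp
  have bound (σ : ℝ) (hσ : p g < σ) :
      θ g - θ' g ≤ σ * ((2 * (a - b) + 2 * a * τ ^ q) / τ) + 2 * ε * N g := by
    have hσ₀ : 0 < σ := (hp.nonneg g).trans_lt hσ
    have hv : p ((τ / σ) • g) ≤ τ := by
      rw [hp.smul, abs_of_pos (by positivity), div_mul_eq_mul_div, div_le_iff₀ hσ₀]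
      gcongr
    have := hp.sub_apply_le_of_eq_one hq ha hε hθ hθ' hu hmid_u hv
    rw [map_smul θ, map_smul θ', map_smul_eq_mul N, Real.norm_of_nonneg (by positivity),
      smul_eq_mul, smul_eq_mul, ← mul_sub] at this
    calc θ g - θ' g = σ / τ * (τ / σ * (θ g - θ' g)) := by field_simp
      _ ≤ σ / τ * (2 * (a - b) + 2 * a * τ ^ q + 2 * ε * (τ / σ * N g)) := by gcongr
      _ = _ := by field_simp
  have hlim : Tendsto (fun σ => σ * ((2 * (a - b) + 2 * a * τ ^ q) / τ) + 2 * ε * N g) (𝓝[>] p g)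
      (𝓝 (p g * ((2 * (a - b) + 2 * a * τ ^ q) / τ) + 2 * ε * N g)) :=
    ((continuous_id.mul continuous_const).add continuous_const).continuousWithinAt
  exact ge_of_tendsto hlim (eventually_mem_nhdsWithin.mono bound)

theorem sub_apply_le_of_mem_convex (hp : IsSmoothGauge q p) (hq : 1 ≤ q) (ha : 0 ≤ a)
    (hε : 0 ≤ ε) (hτ : 0 < τ) {K : Set (Y →ₗ[ℝ] ℝ)} (hK : Convex ℝ K)
    (hb : ∀ θ ∈ K, ¬ ∀ g, θ g ≤ b * p g + ε * N g) (hθK : θ ∈ K) (hθK' : θ' ∈ K)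
    (hθ : ∀ g, θ g ≤ a * p g + ε * N g) (hθ' : ∀ g, θ' g ≤ a * p g + ε * N g) (g : Y) :
    θ g - θ' g ≤ p g * ((2 * (a - b) + 2 * a * τ ^ q) / τ) + 2 * ε * N g := by
  have hmid : (2⁻¹ : ℝ) • θ + (2⁻¹ : ℝ) • θ' ∈ K :=
    hK hθK hθK' (by norm_num) (by norm_num) (by norm_num)
  obtain ⟨f, hf⟩ := not_forall.1 (hb _ hmid)
  simp only [LinearMap.add_apply, LinearMap.smul_apply, smul_eq_mul, not_le] at hf
  exact hp.sub_apply_le hq ha hε hτ hθ hθ' (f := f) (by linarith) g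

end IsSmoothGauge

theorem apply_le_of_mem_convexHull_image {ι : Type*} {φ : ι → Y →ₗ[ℝ] ℝ} {s : Set ι} {g : Y}
    {ξ : ℝ} (h : ∀ i ∈ s, φ i g ≤ ξ) {θ : Y →ₗ[ℝ] ℝ} (hθ : θ ∈ convexHull ℝ (φ '' s)) :
    θ g ≤ ξ := by
  obtain ⟨_, ⟨i, hi, rfl⟩, hle⟩ :=
    ((LinearMap.applyₗ g).convexOn convex_univ).exists_ge_of_mem_convexHull (subset_univ _) hθ
  exact hle.trans (h i hi)

theorem forall_exists_or_exists_threshold {E : Type*} (H : ℕ → Set E) (P : ℝ → E → Prop)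
    (hP : ∀ c ≥ 1, ∀ n, ∃ θ ∈ H n, P c θ) {s : ℝ} (hs : 0 < s) :
    (∀ n, ∃ θ ∈ H n, P s θ) ∨ ∃ a b, 0 ≤ a ∧ a ≤ 1 + s ∧ a - b ≤ 2 * s ∧
      (∀ n, ∃ θ ∈ H n, P a θ) ∧ ∃ n, ∀ θ ∈ H n, ¬ P b θ := by
  set T : Set ℝ := {c | 0 ≤ c ∧ ∃ n, ∀ θ ∈ H n, ¬ P c θ}
  have exists_of_notMem {c : ℝ} (hc : 0 ≤ c) (hcT : c ∉ T) (n : ℕ) : ∃ θ ∈ H n, P c θ := by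
    by_contra! h
    exact hcT ⟨hc, n, h⟩
  have hT₁ : ∀ c ∈ T, c ≤ 1 := by
    rintro c ⟨-, n, h⟩
    by_contra! hc
    obtain ⟨θ, hθ, hPθ⟩ := hP c hc.le n
    exact h θ hθ hPθ
  rcases T.eq_empty_or_nonempty with h_empty | h_nonempty
  · exact .inl (exists_of_notMem hs.le (h_empty ▸ notMem_empty s))
  have hsup : 0 ≤ sSup T := Real.sSup_nonneg fun c hc => hc.1
  obtain ⟨b, hb, hb_lt⟩ := exists_lt_of_lt_csSup h_nonempty (sub_lt_self (sSup T) hs)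
  refine .inr ⟨sSup T + s, b, by positivity, by gcongr; exact csSup_le h_nonempty hT₁,
    by linarith, exists_of_notMem (by positivity) fun h => ?_, hb.2⟩
  linarith [le_csSup ⟨1, hT₁⟩ h]

theorem exists_smoothing_parameters {q A ε : ℝ} (hq : 1 < q) (hA : 0 ≤ A) (hε : 0 < ε) :
    ∃ s τ : ℝ, 0 < s ∧ 0 < τ ∧ A * s ≤ ε ∧
      A * ((2 * (2 * s) + 2 * (1 + s) * τ ^ q) / τ) ≤ ε := by
  have hτ_lim : Tendsto (fun τ : ℝ => A * (4 * τ ^ (q - 1))) (𝓝[>] 0) (𝓝 0) := by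
    have : ContinuousAt (fun τ : ℝ => A * (4 * τ ^ (q - 1))) 0 :=
      ((Real.continuousAt_rpow_const _ _ (.inr (by linarith))).const_mul 4).const_mul A
    simpa [Real.zero_rpow (sub_pos.2 hq).ne'] using this.tendsto.mono_left nhdsWithin_le_nhds
  obtain ⟨τ, hτε, hτ : 0 < τ⟩ :=
    ((hτ_lim.eventually_lt_const (half_pos hε)).and self_mem_nhdsWithin).exists
  have hs_lim (c : ℝ) : Tendsto (fun s : ℝ => c * s) (𝓝[>] 0) (𝓝 0) := by
    simpa using ((continuous_const_mul c).tendsto 0).mono_left nhdsWithin_le_nhds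
  obtain ⟨s, ⟨(hs₁ : 1 * s < 1), hsA⟩, hsτ, (hs : 0 < s)⟩ :=
    ((((hs_lim 1).eventually_lt_const one_pos).and ((hs_lim A).eventually_lt_const hε)).and
      (((hs_lim (A * 4 / τ)).eventually_lt_const (half_pos hε)).and self_mem_nhdsWithin)).exists
  refine ⟨s, τ, hs, hτ, hsA.le, ?_⟩
  calc A * ((2 * (2 * s) + 2 * (1 + s) * τ ^ q) / τ)
      ≤ A * ((2 * (2 * s) + 2 * (1 + 1) * τ ^ q) / τ) := by gcongr; linarith
    _ = A * 4 / τ * s + A * (4 * τ ^ (q - 1)) := by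
      rw [Real.rpow_sub_one hτ.ne']; field_simp; ring
    _ ≤ ε := by linarith

/-- Among the convex combinations of the tails, take one whose bound `a * p + ε * N` is nearly
optimal. Its mean with any later nearly optimal one is no better, so by smoothness both nearly
agree; but the later ones tend to `0` pointwise. -/
theorem IsSmoothGauge.exists_mem_convexHull_le {p : Y → ℝ} {q A ε : ℝ} (hp : IsSmoothGauge q p)
    (N : Seminorm ℝ Y) (hq : 1 < q) (hA : 0 ≤ A) (hε : 0 < ε) (hpA : ∀ g, p g ≤ A * N g)
    (φ : ℕ → Y →ₗ[ℝ] ℝ) (hφ : ∀ g, Tendsto (fun n => φ n g) atTop (𝓝 0))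
    (hdom : ∀ n g, φ n g ≤ p g + ε * N g) :
    ∃ θ ∈ convexHull ℝ (range φ), ∀ g, θ g ≤ 3 * ε * N g := by
  set H : ℕ → Set (Y →ₗ[ℝ] ℝ) := fun n => convexHull ℝ (φ '' Ici n)
  have hH_anti : Antitone H := fun m n h => convexHull_mono (image_mono (Ici_subset_Ici.2 h))
  have hH_range (n : ℕ) : H n ⊆ convexHull ℝ (range φ) := convexHull_mono (image_subset_range _ _)
  obtain ⟨s, τ, hs, hτ, hsA, hsτ⟩ := exists_smoothing_parameters hq hA hε
  rcases forall_exists_or_exists_threshold H (fun c θ => ∀ g, θ g ≤ c * p g + ε * N g)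
    (fun c hc n => ⟨φ n, subset_convexHull ℝ _ ⟨n, self_mem_Ici, rfl⟩, fun g =>
      (hdom n g).trans (by gcongr; exact le_mul_of_one_le_left (hp.nonneg g) hc)⟩) hs with
    hsmall | ⟨a, b, ha₀, ha₁, hab, ha, n₀, hb⟩
  · obtain ⟨θ, hθ, hθs⟩ := hsmall 0
    refine ⟨θ, hH_range 0 hθ, fun g => ?_⟩
    calc θ g ≤ s * (A * N g) + ε * N g := (hθs g).trans (by gcongr; exact hpA g)
      _ = A * s * N g + ε * N g := by ring
      _ ≤ ε * N g + ε * N g := by gcongr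
      _ ≤ 3 * ε * N g := by nlinarith [apply_nonneg N g]
  · obtain ⟨θ, hθ, hθa⟩ := ha n₀
    refine ⟨θ, hH_range n₀ hθ, fun g => le_of_forall_pos_le_add fun ξ hξ => ?_⟩
    obtain ⟨m, hm⟩ := eventually_atTop.1 ((hφ g).eventually_le_const hξ)
    obtain ⟨θ', hθ', hθa'⟩ := ha (max m n₀)
    have hθ'g : θ' g ≤ ξ :=
      apply_le_of_mem_convexHull_image (fun j hj => hm j ((le_max_left _ _).trans hj)) hθ'
    have hpg : p g * ((2 * (a - b) + 2 * a * τ ^ q) / τ) ≤ ε * N g :=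
      calc p g * ((2 * (a - b) + 2 * a * τ ^ q) / τ)
          ≤ p g * ((2 * (2 * s) + 2 * (1 + s) * τ ^ q) / τ) := by
            have := hp.nonneg g
            gcongr
        _ ≤ A * N g * ((2 * (2 * s) + 2 * (1 + s) * τ ^ q) / τ) := by gcongr; exact hpA g
        _ = A * ((2 * (2 * s) + 2 * (1 + s) * τ ^ q) / τ) * N g := by ring
        _ ≤ ε * N g := by gcongr
    linarith [hp.sub_apply_le_of_mem_convex hq.le ha₀ hε.le hτ (convex_convexHull ℝ _) hb hθ
      (hH_anti (le_max_right m n₀) hθ') hθa hθa' g]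

end SmoothGauge

/-! ### Rosenthal's disjointification and Phillips' lemma -/

section Rosenthal

variable {α : Type*}

theorem exists_pairwise_disjoint_infinite_subset {M : Set α} (hM : M.Infinite) :
    ∃ P : ℕ → Set α, (∀ p, (P p).Infinite) ∧ (∀ p, P p ⊆ M) ∧
      Pairwise (Function.onFun Disjoint P) := by
  let e (p j : ℕ) : α := hM.natEmbedding M (Nat.pair p j)
  have he {p j r i : ℕ} (h : e p j = e r i) : p = r ∧ j = i :=
    Nat.pair_eq_pair.1 ((hM.natEmbedding M).injective (Subtype.coe_injective h))
  refine ⟨fun p => range (e p), fun p => infinite_range_of_injective fun _ _ h => (he h).2,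
    fun p => range_subset_iff.2 fun _ => Subtype.coe_prop _, fun p r hpr => ?_⟩
  rw [Function.onFun, disjoint_left]
  rintro _ ⟨j, rfl⟩ ⟨i, hi⟩
  exact hpr (he hi).1.symm

/-- Split `M` into infinitely many infinite pieces. If every piece contains a point seeing mass
more than `ε` in its own piece, the set of these points works. -/
theorem exists_infinite_subset_superadditive_drop {v : α → Set α → ℝ} (hv₀ : ∀ n A, 0 ≤ v n A)
    (hv : ∀ n A B, Disjoint A B → v n A + v n B ≤ v n (A ∪ B)) {M : Set α} (hM : M.Infinite)
    (ε : ℝ) : ∃ M' ⊆ M, M'.Infinite ∧ ((∀ n ∈ M', v n (M' \ {n}) ≤ ε) ∨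
      ∀ n ∈ M', v n (M' \ {n}) + ε ≤ v n (M \ {n})) := by
  have hmono (n : α) {A B : Set α} (h : A ⊆ B) : v n A ≤ v n B := by
    have := hv n A (B \ A) disjoint_sdiff_right
    rw [union_sdiff_cancel h] at this
    linarith [hv₀ n (B \ A)]
  obtain ⟨P, hP_inf, hPM, hP_disj⟩ := exists_pairwise_disjoint_infinite_subset hM
  by_cases! hp : ∃ p, ∀ n ∈ P p, v n (P p \ {n}) ≤ ε
  · obtain ⟨p, hp⟩ := hp
    exact ⟨P p, hPM p, hP_inf p, .inl hp⟩
  choose m hm hmε using hp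
  have hm_notMem {p r : ℕ} (h : m r ≠ m p) : m r ∉ P p := fun hr =>
    h (by rw [hP_disj.eq (not_disjoint_iff.2 ⟨_, hm r, hr⟩)])
  have hm_inj : Function.Injective m := fun p r h =>
    hP_disj.eq (not_disjoint_iff.2 ⟨_, hm p, h ▸ hm r⟩)
  refine ⟨range m, range_subset_iff.2 fun p => hPM p (hm p),
    infinite_range_of_injective hm_inj, .inr ?_⟩
  rintro _ ⟨p, rfl⟩
  have hdisj : Disjoint (range m \ {m p}) (P p \ {m p}) := by
    rw [disjoint_left]
    rintro _ ⟨⟨r, rfl⟩, hr⟩ ⟨hr', -⟩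
    exact hm_notMem hr hr'
  calc v (m p) (range m \ {m p}) + ε
      ≤ v (m p) (range m \ {m p}) + v (m p) (P p \ {m p}) := by gcongr; exact (hmε p).le
    _ ≤ v (m p) (range m \ {m p} ∪ P p \ {m p}) := hv _ _ _ hdisj
    _ ≤ v (m p) (M \ {m p}) := hmono _ <| union_subset
      (sdiff_subset_sdiff_left (range_subset_iff.2 fun r => hPM r (hm r)))
      (sdiff_subset_sdiff_left (hPM p))

/-- Rosenthal's lemma for uniformly bounded superadditive set functions. -/
theorem exists_infinite_superadditive_le [Infinite α] {v : α → Set α → ℝ}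
    (hv₀ : ∀ n A, 0 ≤ v n A) (hv : ∀ n A B, Disjoint A B → v n A + v n B ≤ v n (A ∪ B))
    {C ε : ℝ} (hC : ∀ n A, v n A ≤ C) (hε : 0 < ε) :
    ∃ M : Set α, M.Infinite ∧ ∀ n ∈ M, v n (M \ {n}) ≤ ε := by
  have exists_of_le_nat_mul (k : ℕ) : ∀ M : Set α, M.Infinite →
      (∀ n ∈ M, v n (M \ {n}) ≤ k * ε) → ∃ M : Set α, M.Infinite ∧ ∀ n ∈ M, v n (M \ {n}) ≤ ε := by
    induction k with
    | zero => exact fun M hM h => ⟨M, hM, fun n hn => (h n hn).trans (by simpa using hε.le)⟩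
    | succ k ih =>
      intro M hM h
      obtain ⟨M', hM'M, hM', hsmall | hdrop⟩ :=
        exists_infinite_subset_superadditive_drop hv₀ hv hM ε
      · exact ⟨M', hM', hsmall⟩
      · refine ih M' hM' fun n hn => ?_
        have := h n (hM'M hn)
        push_cast at this
        linarith [hdrop n hn]
  obtain ⟨k, hk⟩ := exists_nat_ge (C / ε)
  exact exists_of_le_nat_mul k univ infinite_univ fun n _ =>
    (hC n _).trans ((div_le_iff₀ hε).1 hk)

end Rosenthal

section Phillips

open scoped BoundedContinuousFunction

/-- The indicator of `A`, as a bounded sequence. -/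
noncomputable def boundedIndicator (A : Set ℕ) : ℕ →ᵇ ℝ :=
  BoundedContinuousFunction.ofNormedAddCommGroupDiscrete (A.indicator 1) 1 fun n => by
    by_cases h : n ∈ A <;> simp [h]

theorem boundedIndicator_apply (A : Set ℕ) (n : ℕ) :
    boundedIndicator A n = A.indicator (1 : ℕ → ℝ) n := rfl

theorem norm_boundedIndicator_le (A : Set ℕ) : ‖boundedIndicator A‖ ≤ 1 :=
  (BoundedContinuousFunction.norm_le zero_le_one).2 fun n => by
    rw [boundedIndicator_apply]
    by_cases h : n ∈ A <;> simp [h]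

theorem boundedIndicator_singleton_add_sdiff {A : Set ℕ} {n : ℕ} (hn : n ∈ A) :
    boundedIndicator {n} + boundedIndicator (A \ {n}) = boundedIndicator A := by
  ext i
  simp only [BoundedContinuousFunction.add_apply, boundedIndicator_apply]
  rw [← congrFun (indicator_union_of_disjoint (disjoint_sdiff_right (s := {n}) (t := A)) 1) i,
    union_sdiff_cancel (singleton_subset_iff.2 hn)]

/-- The total variation on `A` of a functional on `ℓ^∞`, viewed as a finitely additive measure. -/
noncomputable def variationOn (θ : (ℕ →ᵇ ℝ) →ₗ[ℝ] ℝ) (A : Set ℕ) : ℝ :=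
  sSup (θ '' {a | ‖a‖ ≤ 1 ∧ ∀ i ∉ A, a i = 0})

variable {θ : (ℕ →ᵇ ℝ) →ₗ[ℝ] ℝ} {C : ℝ}

theorem nonempty_image_supported (θ : (ℕ →ᵇ ℝ) →ₗ[ℝ] ℝ) (A : Set ℕ) :
    (θ '' {a | ‖a‖ ≤ 1 ∧ ∀ i ∉ A, a i = 0}).Nonempty :=
  ⟨θ 0, 0, by simp, rfl⟩

theorem mem_upperBounds_image_supported (hC : 0 ≤ C) (hθ : ∀ a, θ a ≤ C * ‖a‖) (A : Set ℕ) :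
    C ∈ upperBounds (θ '' {a | ‖a‖ ≤ 1 ∧ ∀ i ∉ A, a i = 0}) := by
  rintro _ ⟨a, ⟨ha, -⟩, rfl⟩
  exact (hθ a).trans (mul_le_of_le_one_right hC ha)

theorem variationOn_le (hC : 0 ≤ C) (hθ : ∀ a, θ a ≤ C * ‖a‖) (A : Set ℕ) :
    variationOn θ A ≤ C :=
  csSup_le (nonempty_image_supported θ A) (mem_upperBounds_image_supported hC hθ A)

theorem apply_le_variationOn (hC : 0 ≤ C) (hθ : ∀ a, θ a ≤ C * ‖a‖) {A : Set ℕ} {a : ℕ →ᵇ ℝ}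
    (ha : ‖a‖ ≤ 1) (haA : ∀ i ∉ A, a i = 0) : θ a ≤ variationOn θ A :=
  le_csSup ⟨C, mem_upperBounds_image_supported hC hθ A⟩ ⟨a, ⟨ha, haA⟩, rfl⟩

theorem variationOn_nonneg (hC : 0 ≤ C) (hθ : ∀ a, θ a ≤ C * ‖a‖) (A : Set ℕ) :
    0 ≤ variationOn θ A := by
  simpa using apply_le_variationOn hC hθ (a := 0) (A := A) (by simp) (by simp)

theorem variationOn_add_le_union (hC : 0 ≤ C) (hθ : ∀ a, θ a ≤ C * ‖a‖) {A B : Set ℕ}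
    (hAB : Disjoint A B) : variationOn θ A + variationOn θ B ≤ variationOn θ (A ∪ B) := by
  rw [variationOn, variationOn,
    ← csSup_add (nonempty_image_supported θ A) ⟨C, mem_upperBounds_image_supported hC hθ A⟩
      (nonempty_image_supported θ B) ⟨C, mem_upperBounds_image_supported hC hθ B⟩]
  refine csSup_le ((nonempty_image_supported θ A).add (nonempty_image_supported θ B)) ?_
  rintro _ ⟨_, ⟨a, ⟨ha, haA⟩, rfl⟩, _, ⟨b, ⟨hb, hbB⟩, rfl⟩, rfl⟩
  change θ a + θ b ≤ _
  rw [← map_add]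
  refine apply_le_variationOn hC hθ
    ((BoundedContinuousFunction.norm_le zero_le_one).2 fun i => ?_) fun i hi => ?_
  · rw [BoundedContinuousFunction.add_apply]
    by_cases hi : i ∈ A
    · rw [hbB i (disjoint_left.1 hAB hi), add_zero]
      exact (a.norm_coe_le_norm i).trans ha
    · rw [haA i hi, zero_add]
      exact (b.norm_coe_le_norm i).trans hb
  · rw [mem_union, not_or] at hi
    rw [BoundedContinuousFunction.add_apply, haA i hi.1, hbB i hi.2, add_zero]

/-- Phillips' lemma. -/
theorem not_forall_le_apply_boundedIndicator {ε : ℝ} (hε : 0 < ε)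
    (θ : ℕ → (ℕ →ᵇ ℝ) →ₗ[ℝ] ℝ) (hθ : ∀ n a, θ n a ≤ C * ‖a‖)
    (hlim : ∀ a, Tendsto (fun n => θ n a) atTop (𝓝 0)) :
    ¬ ∀ n, ε ≤ θ n (boundedIndicator {n}) := by
  intro hn
  have hC : 0 ≤ C := by
    by_contra! hC
    nlinarith [hn 0, hθ 0 (boundedIndicator {0}), norm_nonneg (boundedIndicator {0})]
  obtain ⟨M, hM, hMε⟩ := exists_infinite_superadditive_le (v := fun n => variationOn (θ n))
    (fun n => variationOn_nonneg hC (hθ n)) (fun n _ _ => variationOn_add_le_union hC (hθ n))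
    (fun n => variationOn_le hC (hθ n)) (half_pos hε)
  have hlow : ∀ n ∈ M, ε / 2 ≤ θ n (boundedIndicator M) := by
    intro n hnM
    have htail : θ n (-boundedIndicator (M \ {n})) ≤ ε / 2 := by
      refine (apply_le_variationOn hC (hθ n) ?_ fun i hi => ?_).trans (hMε n hnM)
      · rw [norm_neg]
        exact norm_boundedIndicator_le _
      · rw [BoundedContinuousFunction.neg_apply, boundedIndicator_apply, indicator_of_notMem hi,
          neg_zero]
    rw [map_neg] at htail
    rw [← boundedIndicator_singleton_add_sdiff hnM, map_add]
    linarith [hn n]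
  obtain ⟨m, hm⟩ := eventually_atTop.1 ((hlim (boundedIndicator M)).eventually_lt_const
    (half_pos hε))
  obtain ⟨n, hnM, hmn⟩ := hM.exists_gt m
  exact (hm n hmn.le).not_ge (hlow n hnM)

end Phillips

/-! ### Weak and weak-* convergence of functionals -/

section WeakConvergence

variable {X : Type*} [NormedAddCommGroup X] [NormedSpace ℝ X]

theorem tendsto_toWeakSpace_iff {α : Type*} {l : Filter α} {u : α → X} {x : X} :
    Tendsto (fun a => toWeakSpace ℝ X (u a)) l (𝓝 (toWeakSpace ℝ X x)) ↔
      ∀ Λ : StrongDual ℝ X, Tendsto (fun a => Λ (u a)) l (𝓝 (Λ x)) :=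
  WeakBilin.tendsto_iff_forall_eval_tendsto _
    (separatingDual_iff_injective.1 (inferInstance : SeparatingDual ℝ X))

/-- Pointwise null sequences of functionals with arbitrarily small convex combinations are weakly
null, since a subsequence on which `δ ≤ Λ` has all its convex combinations in `{δ ≤ Λ}`. -/
theorem eventually_apply_lt_of_forall_exists_mem_convexHull
    (h : ∀ φ : ℕ → StrongDual ℝ X, (∀ x, Tendsto (fun n => φ n x) atTop (𝓝 0)) →
      ∀ ε > 0, ∃ θ ∈ convexHull ℝ (range φ), ‖θ‖ ≤ ε)
    {φ : ℕ → StrongDual ℝ X} (hφ : ∀ x, Tendsto (fun n => φ n x) atTop (𝓝 0))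
    (Λ : StrongDual ℝ (StrongDual ℝ X)) {δ : ℝ} (hδ : 0 < δ) : ∀ᶠ n in atTop, Λ (φ n) < δ := by
  by_contra hnot
  obtain ⟨σ, hσ, hσδ⟩ := extraction_of_frequently_atTop (not_eventually.1 hnot)
  obtain ⟨θ, hθ, hθ_small⟩ := h (φ ∘ σ) (fun x => (hφ x).comp hσ.tendsto_atTop)
    (δ / (2 * (‖Λ‖ + 1))) (by positivity)
  have hge : δ ≤ Λ θ := by
    obtain ⟨_, ⟨n, rfl⟩, hle⟩ := (Λ.toLinearMap.concaveOn convex_univ).exists_le_of_mem_convexHull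
      (subset_univ _) hθ
    exact (not_lt.1 (hσδ n)).trans hle
  have hlt : Λ θ < δ :=
    calc Λ θ ≤ ‖Λ‖ * ‖θ‖ := (le_abs_self _).trans (Λ.le_opNorm θ)
      _ ≤ ‖Λ‖ * (δ / (2 * (‖Λ‖ + 1))) := by gcongr
      _ < δ := by
        rw [mul_div_assoc', div_lt_iff₀ (by positivity)]
        nlinarith [norm_nonneg Λ]
  exact hlt.not_ge hge

theorem tendsto_toWeakSpace_of_forall_exists_mem_convexHull
    (h : ∀ φ : ℕ → StrongDual ℝ X, (∀ x, Tendsto (fun n => φ n x) atTop (𝓝 0)) →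
      ∀ ε > 0, ∃ θ ∈ convexHull ℝ (range φ), ‖θ‖ ≤ ε)
    {φ : ℕ → StrongDual ℝ X} {φ₀ : StrongDual ℝ X}
    (hφ : Tendsto (fun n => StrongDual.toWeakDual (φ n)) atTop (𝓝 (StrongDual.toWeakDual φ₀))) :
    Tendsto (fun n => toWeakSpace ℝ (StrongDual ℝ X) (φ n)) atTop
      (𝓝 (toWeakSpace ℝ (StrongDual ℝ X) φ₀)) := by
  rw [tendsto_iff_forall_eval_tendsto_topDualPairing] at hφ
  have hnull (x : X) : Tendsto (fun n => (φ n - φ₀) x) atTop (𝓝 0) :=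
    tendsto_sub_nhds_zero_iff.2 (hφ x)
  refine tendsto_toWeakSpace_iff.2 fun Λ => tendsto_sub_nhds_zero_iff.1 ?_
  refine tendsto_order.2 ⟨fun δ hδ => ?_, fun δ hδ => ?_⟩
  · filter_upwards [eventually_apply_lt_of_forall_exists_mem_convexHull h hnull (-Λ)
      (neg_pos.2 hδ)] with n hn
    rw [← map_sub]
    exact neg_lt_neg_iff.1 hn
  · filter_upwards [eventually_apply_lt_of_forall_exists_mem_convexHull h hnull Λ hδ] with n hn
    rwa [← map_sub]

theorem exists_hyperfilter_limit {C : ℝ} (u : ℕ → StrongDual ℝ X) (hu : ∀ n, ‖u n‖ ≤ C) :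
    ∃ T : StrongDual ℝ X, ∀ x, Tendsto (fun n => u n x) (hyperfilter ℕ) (𝓝 (T x)) := by
  obtain ⟨T, -, hT⟩ :=
    (WeakDual.isCompact_closedBall (𝕜 := ℝ) (0 : StrongDual ℝ X) C).ultrafilter_le_nhds'
      ((hyperfilter ℕ).map fun n => StrongDual.toWeakDual (u n))
      (Ultrafilter.mem_map.2 (univ_mem' fun n => by
        change u n ∈ Metric.closedBall 0 C
        simpa using hu n))
  exact ⟨WeakDual.toStrongDual T, tendsto_iff_forall_eval_tendsto_topDualPairing.1 hT⟩

theorem exists_tail_functionals {C : ℝ} (T : ℕ → StrongDual ℝ X)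
    (hT : ∀ x n, ∑ j ∈ Finset.range n, |T j x| ≤ C * ‖x‖) :
    ∃ φ : ℕ → StrongDual ℝ X, ∀ k x, HasSum (fun j => T (j + k) x) (φ k x) := by
  have hsum (x : X) : Summable fun j => |T j x| :=
    summable_of_sum_range_le (fun _ => abs_nonneg _) (hT x)
  have hsum_tail (k : ℕ) (x : X) : Summable fun j => T (j + k) x :=
    (summable_nat_add_iff (f := fun j => T j x) k).2 (hsum x).of_abs
  have hbound (k : ℕ) (x : X) : ‖∑' j, T (j + k) x‖ ≤ C * ‖x‖ :=
    calc ‖∑' j, T (j + k) x‖ ≤ ∑' j, |T (j + k) x| :=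
        norm_tsum_le_tsum_norm ((summable_nat_add_iff (f := fun j => |T j x|) k).2 (hsum x))
      _ ≤ ∑' j, |T j x| :=
        tsum_comp_le_tsum_of_inj (hsum x) (fun _ => abs_nonneg _) (add_left_injective k)
      _ ≤ C * ‖x‖ := Real.tsum_le_of_sum_range_le (fun _ => abs_nonneg _) (hT x)
  refine ⟨fun k => LinearMap.mkContinuous
    { toFun := fun x => ∑' j, T (j + k) x
      map_add' := fun x y => by
        simp only [map_add]
        exact (hsum_tail k x).tsum_add (hsum_tail k y)
      map_smul' := fun c x => by
        simp only [map_smul, smul_eq_mul, RingHom.id_apply]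
        exact tsum_mul_left } C (hbound k), fun k x => (hsum_tail k x).hasSum⟩

/-- The tails `∑ j, T (j + k)` are weak-* null, but a limit of the `f j` along an ultrafilter is
an element of the bidual at which all of them take the value `1`. -/
theorem not_isGrothendieckSpace_of_biorthogonal {C : ℝ} (T : ℕ → StrongDual ℝ X) (f : ℕ → X)
    (hf : ∀ j, ‖f j‖ ≤ C) (hT : ∀ x n, ∑ j ∈ Finset.range n, |T j x| ≤ C * ‖x‖)
    (hTf : ∀ i j, T i (f j) = if i = j then 1 else 0) : ¬ IsGrothendieckSpace X := by
  intro hX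
  obtain ⟨φ, hφ⟩ := exists_tail_functionals T hT
  have hweak := tendsto_toWeakSpace_iff.1 <| hX.weak_of_weakStar φ 0 <|
    tendsto_iff_forall_eval_tendsto_topDualPairing.2 fun x =>
      (tendsto_sum_nat_add fun j => T j x).congr fun k => (hφ k x).tsum_eq
  obtain ⟨Λ, hΛ⟩ := exists_hyperfilter_limit (C := C)
    (fun J => NormedSpace.inclusionInDoubleDual ℝ X (f J))
    (fun J => (NormedSpace.double_dual_bound ℝ X (f J)).trans (hf J))
  have hΛφ (k : ℕ) : Λ (φ k) = 1 := by
    refine tendsto_nhds_unique (hΛ (φ k)) (tendsto_const_nhds.congr' ?_)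
    filter_upwards [Nat.hyperfilter_le_atTop (eventually_ge_atTop k)] with J hJ
    rw [NormedSpace.dual_def]
    refine HasSum.unique ?_ (hφ k (f J))
    convert hasSum_ite_eq (J - k) (1 : ℝ) using 2 with j
    rw [hTf]
    congr 1
    exact propext (by omega)
  have hnull := hweak Λ
  simp only [hΛφ, map_zero] at hnull
  exact one_ne_zero (tendsto_nhds_unique tendsto_const_nhds hnull)

theorem not_isGrothendieckSpace_of_eventually_biorthogonal {C : ℝ} (u : ℕ → ℕ → StrongDual ℝ X)
    (f : ℕ → X) (hf : ∀ j, ‖f j‖ ≤ C) (hu : ∀ n j, ‖u n j‖ ≤ C)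
    (h_sum : ∀ r, ∀ᶠ n in atTop, ∀ x, ∑ j ∈ Finset.range r, |u n j x| ≤ C * ‖x‖)
    (huf : ∀ i j, ∀ᶠ n in atTop, u n i (f j) = if i = j then 1 else 0) :
    ¬ IsGrothendieckSpace X := by
  choose T hT using fun j => exists_hyperfilter_limit (fun n => u n j) fun n => hu n j
  refine not_isGrothendieckSpace_of_biorthogonal T f hf (fun x r => ?_) fun i j => ?_
  · refine le_of_tendsto (tendsto_finsetSum _ fun j _ => (hT j x).abs) ?_
    filter_upwards [Nat.hyperfilter_le_atTop (h_sum r)] with n hn using hn x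
  · refine tendsto_nhds_unique (hT i (f j)) (tendsto_const_nhds.congr' ?_)
    filter_upwards [Nat.hyperfilter_le_atTop (huf i j)] with n hn using hn.symm

end WeakConvergence

/-! ### Families of functions bounded uniformly and in `L^q` -/

section Families

variable {ι α : Type*} [MeasurableSpace α]

/-- The larger of the supremum norm of a family of functions and of its `L^q` norms. -/
noncomputable def familyENorm (μ : ι → Measure α) (q : ℝ) (g : ι → α → ℝ) : ℝ≥0∞ :=
  (⨆ k, ⨆ x, ‖g k x‖ₑ) ⊔ ⨆ k, eLpNorm (g k) (ENNReal.ofReal q) (μ k)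

theorem familyENorm_le_iff {μ : ι → Measure α} {q : ℝ} {g : ι → α → ℝ} {c : ℝ≥0∞} :
    familyENorm μ q g ≤ c ↔
      (∀ k x, ‖g k x‖ₑ ≤ c) ∧ ∀ k, eLpNorm (g k) (ENNReal.ofReal q) (μ k) ≤ c := by
  simp [familyENorm]

theorem eLpNorm_ofReal_le_iff {μ : Measure α} {q : ℝ} (hq : 0 < q) {g : α → ℝ} {c : ℝ≥0∞} :
    eLpNorm g (ENNReal.ofReal q) μ ≤ c ↔ ∫⁻ x, ‖g x‖ₑ ^ q ∂μ ≤ c ^ q := by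
  rw [eLpNorm_eq_lintegral_rpow_enorm_toReal (by simpa using hq) ENNReal.ofReal_ne_top,
    ENNReal.toReal_ofReal hq.le, one_div, ENNReal.rpow_inv_le_iff hq]

theorem familyENorm_add_le (μ : ι → Measure α) {q : ℝ} (hq : 1 ≤ q) {f g : ι → α → ℝ}
    (hf : ∀ k, Measurable (f k)) (hg : ∀ k, Measurable (g k)) :
    familyENorm μ q (f + g) ≤ familyENorm μ q f + familyENorm μ q g := by
  obtain ⟨hf_sup, hf_lq⟩ := familyENorm_le_iff.1 (le_refl (familyENorm μ q f))
  obtain ⟨hg_sup, hg_lq⟩ := familyENorm_le_iff.1 (le_refl (familyENorm μ q g))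
  refine familyENorm_le_iff.2
    ⟨fun k x => (enorm_add_le _ _).trans (add_le_add (hf_sup k x) (hg_sup k x)), fun k => ?_⟩
  exact (eLpNorm_add_le (hf k).aestronglyMeasurable (hg k).aestronglyMeasurable
    (by simpa using hq)).trans (add_le_add (hf_lq k) (hg_lq k))

theorem familyENorm_smul (μ : ι → Measure α) (q c : ℝ) (g : ι → α → ℝ) :
    familyENorm μ q (c • g) = ‖c‖ₑ * familyENorm μ q g := by
  have h_sup (k : ι) (x : α) : ‖(c • g) k x‖ₑ = ‖c‖ₑ * ‖g k x‖ₑ := enorm_smul c (g k x)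
  have h_lq (k : ι) : eLpNorm ((c • g) k) (ENNReal.ofReal q) (μ k)
      = ‖c‖ₑ * eLpNorm (g k) (ENNReal.ofReal q) (μ k) :=
    eLpNorm_const_smul c (g k) (ENNReal.ofReal q) (μ k)
  simp only [familyENorm, h_sup, h_lq, mul_max, ENNReal.mul_iSup]

/-- The families of measurable functions with finite `familyENorm`. Functions are not identified
almost everywhere, as the supremum norm is over all points. -/
noncomputable def familySpace (μ : ι → Measure α) {q : ℝ} (hq : 1 ≤ q) :
    Submodule ℝ (ι → α → ℝ) where
  carrier := {g | (∀ k, Measurable (g k)) ∧ familyENorm μ q g < ∞}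
  add_mem' := fun {f g} hf hg => ⟨fun k => (hf.1 k).add (hg.1 k),
    (familyENorm_add_le μ hq hf.1 hg.1).trans_lt (ENNReal.add_lt_top.2 ⟨hf.2, hg.2⟩)⟩
  zero_mem' := ⟨fun _ => measurable_const, by
    have h := familyENorm_smul μ q 0 0
    rw [zero_smul, enorm_zero, zero_mul] at h
    rw [h]
    exact ENNReal.zero_lt_top⟩
  smul_mem' := fun c f hf => ⟨fun k => (hf.1 k).const_smul c, by
    rw [familyENorm_smul]
    exact ENNReal.mul_lt_top enorm_lt_top hf.2⟩

variable {μ : ι → Measure α} {q : ℝ} {hq : 1 ≤ q}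

theorem measurable_of_familySpace (g : familySpace μ hq) (k : ι) : Measurable (g.1 k) := g.2.1 k

/-- The norm of `familySpace`, as a seminorm on the bare vector space. -/
noncomputable def familyNorm (μ : ι → Measure α) {q : ℝ} (hq : 1 ≤ q) :
    Seminorm ℝ (familySpace μ hq) :=
  Seminorm.of (fun g => (familyENorm μ q g.1).toReal)
    (fun f g => by
      rw [← ENNReal.toReal_add f.2.2.ne g.2.2.ne]
      exact ENNReal.toReal_mono (ENNReal.add_lt_top.2 ⟨f.2.2, g.2.2⟩).ne
        (familyENorm_add_le μ hq f.2.1 g.2.1))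
    (fun c g => by
      rw [← toReal_enorm, ← ENNReal.toReal_mul, ← familyENorm_smul]
      rfl)

theorem familyENorm_le_ofReal_iff (hq : 1 ≤ q) {g : ι → α → ℝ} {c : ℝ} (hc : 0 ≤ c) :
    familyENorm μ q g ≤ ENNReal.ofReal c ↔ (∀ k x, |g k x| ≤ c) ∧
      ∀ k, ∫⁻ x, ‖g k x‖ₑ ^ q ∂μ k ≤ ENNReal.ofReal (c ^ q) := by
  rw [familyENorm_le_iff, ← ENNReal.ofReal_rpow_of_nonneg hc (by linarith)]
  simp only [eLpNorm_ofReal_le_iff (one_pos.trans_le hq), Real.enorm_eq_ofReal_abs,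
    ENNReal.ofReal_le_ofReal_iff hc]

theorem familyNorm_le_iff_lintegral {g : familySpace μ hq} {c : ℝ} (hc : 0 ≤ c) :
    familyNorm μ hq g ≤ c ↔ (∀ k x, |g.1 k x| ≤ c) ∧
      ∀ k, ∫⁻ x, ‖g.1 k x‖ₑ ^ q ∂μ k ≤ ENNReal.ofReal (c ^ q) :=
  (ENNReal.le_ofReal_iff_toReal_le g.2.2.ne hc).symm.trans (familyENorm_le_ofReal_iff hq hc)

theorem mem_familySpace {g : ι → α → ℝ} {c : ℝ} (hc : 0 ≤ c) (hg : ∀ k, Measurable (g k))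
    (h_sup : ∀ k x, |g k x| ≤ c)
    (h_lq : ∀ k, ∫⁻ x, ‖g k x‖ₑ ^ q ∂μ k ≤ ENNReal.ofReal (c ^ q)) : g ∈ familySpace μ hq :=
  ⟨hg, ((familyENorm_le_ofReal_iff hq hc).2 ⟨h_sup, h_lq⟩).trans_lt ENNReal.ofReal_lt_top⟩

theorem abs_le_familyNorm (g : familySpace μ hq) (k : ι) (x : α) :
    |g.1 k x| ≤ familyNorm μ hq g :=
  ((familyNorm_le_iff_lintegral (apply_nonneg _ g)).1 le_rfl).1 k x

theorem lintegral_le_familyNorm (g : familySpace μ hq) (k : ι) :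
    ∫⁻ x, ‖g.1 k x‖ₑ ^ q ∂μ k ≤ ENNReal.ofReal (familyNorm μ hq g ^ q) :=
  ((familyNorm_le_iff_lintegral (apply_nonneg _ g)).1 le_rfl).2 k

/-- The `q`-th power of the `L^q` norm of the `k`-th function of a family. -/
noncomputable def familyEnergy (g : familySpace μ hq) (k : ι) : ℝ :=
  (∫⁻ x, ‖g.1 k x‖ₑ ^ q ∂μ k).toReal

theorem ofReal_familyEnergy (g : familySpace μ hq) (k : ι) :
    ENNReal.ofReal (familyEnergy g k) = ∫⁻ x, ‖g.1 k x‖ₑ ^ q ∂μ k :=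
  ENNReal.ofReal_toReal ((lintegral_le_familyNorm g k).trans_lt ENNReal.ofReal_lt_top).ne

theorem familyEnergy_nonneg (g : familySpace μ hq) (k : ι) : 0 ≤ familyEnergy g k :=
  ENNReal.toReal_nonneg

theorem familyEnergy_le (g : familySpace μ hq) (k : ι) :
    familyEnergy g k ≤ familyNorm μ hq g ^ q :=
  ENNReal.toReal_le_of_le_ofReal (by have := apply_nonneg (familyNorm μ hq) g; positivity)
    (lintegral_le_familyNorm g k)

theorem familyNorm_le_iff {g : familySpace μ hq} {c : ℝ} (hc : 0 ≤ c) :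
    familyNorm μ hq g ≤ c ↔ (∀ k x, |g.1 k x| ≤ c) ∧ ∀ k, familyEnergy g k ≤ c ^ q := by
  rw [familyNorm_le_iff_lintegral hc]
  simp only [← ofReal_familyEnergy, ENNReal.ofReal_le_ofReal_iff (show 0 ≤ c ^ q by positivity)]

theorem familyEnergy_le_of_abs_le {f g : familySpace μ hq} {c : ℝ} (hc : 0 ≤ c) {k : ι}
    (h : ∀ x, |f.1 k x| ≤ c * |g.1 k x|) : familyEnergy f k ≤ c ^ q * familyEnergy g k := by
  have hq₀ : 0 ≤ q := by linarith
  refine ENNReal.toReal_le_of_le_ofReal (mul_nonneg (by positivity) (familyEnergy_nonneg g k)) ?_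
  rw [ENNReal.ofReal_mul (by positivity), ofReal_familyEnergy,
    ← lintegral_const_mul' _ _ ENNReal.ofReal_ne_top]
  refine lintegral_mono fun x => ?_
  rw [← ENNReal.ofReal_rpow_of_nonneg hc hq₀, ← ENNReal.mul_rpow_of_nonneg _ _ hq₀,
    Real.enorm_eq_ofReal_abs, Real.enorm_eq_ofReal_abs, ← ENNReal.ofReal_mul hc]
  exact ENNReal.rpow_le_rpow (ENNReal.ofReal_le_ofReal (h x)) hq₀

theorem familyNorm_le_of_abs_le {f g : familySpace μ hq} {c : ℝ} (hc : 0 ≤ c)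
    (h : ∀ k x, |f.1 k x| ≤ c * |g.1 k x|) : familyNorm μ hq f ≤ c * familyNorm μ hq g := by
  have hg : 0 ≤ familyNorm μ hq g := apply_nonneg _ g
  refine (familyNorm_le_iff (by positivity)).2 ⟨fun k x => (h k x).trans ?_, fun k => ?_⟩
  · have := abs_le_familyNorm g k x
    gcongr
  · refine (familyEnergy_le_of_abs_le hc (h k)).trans ?_
    rw [Real.mul_rpow hc hg]
    have := familyEnergy_le g k
    gcongr

/-- Restriction of each function of a family to a measurable set. -/
noncomputable def familyRestrict (B : ι → Set α) (hB : ∀ k, MeasurableSet (B k)) :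
    familySpace μ hq →ₗ[ℝ] familySpace μ hq where
  toFun g := ⟨fun k => (B k).indicator (g.1 k), mem_familySpace (apply_nonneg (familyNorm μ hq) g)
    (fun k => (measurable_of_familySpace g k).indicator (hB k))
    (fun k x => le_trans (by by_cases h : x ∈ B k <;> simp [h]) (abs_le_familyNorm g k x))
    (fun k => le_trans (lintegral_mono fun x =>
      ENNReal.rpow_le_rpow (by by_cases h : x ∈ B k <;> simp [h]) (by linarith))
      (lintegral_le_familyNorm g k))⟩
  map_add' f g := Subtype.ext (funext fun k => indicator_add (B k) (f.1 k) (g.1 k))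
  map_smul' c g := Subtype.ext (funext fun k => indicator_const_smul (B k) c (g.1 k))

theorem familyRestrict_apply {B : ι → Set α} (hB : ∀ k, MeasurableSet (B k))
    (g : familySpace μ hq) (k : ι) (x : α) :
    (familyRestrict B hB g).1 k x = (B k).indicator (g.1 k) x := rfl

theorem abs_familyRestrict_le {B : ι → Set α} (hB : ∀ k, MeasurableSet (B k))
    (g : familySpace μ hq) (k : ι) (x : α) : |(familyRestrict B hB g).1 k x| ≤ |g.1 k x| := by
  rw [familyRestrict_apply]
  by_cases h : x ∈ B k <;> simp [h]

theorem familyRestrict_add_compl {B : ι → Set α} (hB : ∀ k, MeasurableSet (B k))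
    (g : familySpace μ hq) :
    familyRestrict B hB g + familyRestrict (fun k => (B k)ᶜ) (fun k => (hB k).compl) g = g :=
  Subtype.ext (funext fun k => indicator_self_add_compl (B k) (g.1 k))

theorem familyNorm_restrict_le {B : ι → Set α} (hB : ∀ k, MeasurableSet (B k))
    (g : familySpace μ hq) : familyNorm μ hq (familyRestrict B hB g) ≤ familyNorm μ hq g := by
  simpa using familyNorm_le_of_abs_le zero_le_one
    (by simpa using abs_familyRestrict_le hB g)

/-! ### The Clarkson inequality for the powers of a family -/

theorem abs_add_rpow_add_abs_sub_rpow_le (hq : 0 ≤ q) (hq₂ : q ≤ 2) (a b : ℝ) :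
    |a + b| ^ q + |a - b| ^ q ≤ 2 * (|a| ^ q + |b| ^ q) := by
  have hsq (x : ℝ) : |x| ^ q = (x ^ 2) ^ (q / 2) := by
    rw [← sq_abs, ← Real.rpow_natCast, ← Real.rpow_mul (abs_nonneg x)]
    congr 1; push_cast; ring
  have hconcave := (Real.concaveOn_rpow (p := q / 2) (by linarith) (by linarith)).2
    (mem_Ici.2 (sq_nonneg (a + b))) (mem_Ici.2 (sq_nonneg (a - b)))
    (show (0 : ℝ) ≤ 2⁻¹ by norm_num) (show (0 : ℝ) ≤ 2⁻¹ by norm_num) (by norm_num)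
  simp only [smul_eq_mul] at hconcave
  rw [show 2⁻¹ * (a + b) ^ 2 + 2⁻¹ * (a - b) ^ 2 = a ^ 2 + b ^ 2 by ring] at hconcave
  have hsub : (a ^ 2 + b ^ 2) ^ (q / 2) ≤ (a ^ 2) ^ (q / 2) + (b ^ 2) ^ (q / 2) :=
    Real.rpow_add_le_add_rpow (sq_nonneg a) (sq_nonneg b) (by linarith) (by linarith)
  rw [hsq, hsq, hsq, hsq]
  linarith

theorem lintegral_enorm_add_rpow_add_le {ν : Measure α} (hq : 0 ≤ q) (hq₂ : q ≤ 2) {f g : α → ℝ}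
    (hf : Measurable f) (hg : Measurable g) :
    ∫⁻ x, ‖f x + g x‖ₑ ^ q ∂ν + ∫⁻ x, ‖f x - g x‖ₑ ^ q ∂ν
      ≤ 2 * (∫⁻ x, ‖f x‖ₑ ^ q ∂ν + ∫⁻ x, ‖g x‖ₑ ^ q ∂ν) := by
  have h_add : Measurable fun x => ‖f x + g x‖ₑ ^ q := (hf.add hg).enorm.pow_const q
  rw [← lintegral_add_left h_add,
    ← lintegral_add_left (hf.enorm.pow_const q), ← lintegral_const_mul' _ _ ENNReal.ofNat_ne_top]
  refine lintegral_mono fun x => ?_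
  simp only [Real.enorm_eq_ofReal_abs, ENNReal.ofReal_rpow_of_nonneg (abs_nonneg _) hq]
  rw [← ENNReal.ofReal_add (by positivity) (by positivity),
    ← ENNReal.ofReal_add (by positivity) (by positivity), ← ENNReal.ofReal_ofNat 2,
    ← ENNReal.ofReal_mul zero_le_two]
  exact ENNReal.ofReal_le_ofReal (abs_add_rpow_add_abs_sub_rpow_le hq hq₂ _ _)

theorem familyEnergy_add_add_sub_le (hq₂ : q ≤ 2) (f g : familySpace μ hq) (k : ι) :
    familyEnergy (f + g) k + familyEnergy (f - g) k
      ≤ 2 * (familyEnergy f k + familyEnergy g k) := by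
  have hf := familyEnergy_nonneg f k
  have hg := familyEnergy_nonneg g k
  rw [← ENNReal.ofReal_le_ofReal_iff (by positivity),
    ENNReal.ofReal_add (familyEnergy_nonneg _ k) (familyEnergy_nonneg _ k),
    ENNReal.ofReal_mul zero_le_two, ENNReal.ofReal_add hf hg, ENNReal.ofReal_ofNat]
  simp only [ofReal_familyEnergy]
  exact lintegral_enorm_add_rpow_add_le (by linarith) hq₂ (measurable_of_familySpace f k)
    (measurable_of_familySpace g k)

/-- The `q`-th powers of the values of a family and of its `L^q` norms, as a bounded function. -/
noncomputable def familyPower (g : familySpace μ hq) : lp (fun _ : (ι × α) ⊕ ι => ℝ) ∞ :=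
  ⟨Sum.elim (fun z => |g.1 z.1 z.2| ^ q) (familyEnergy g), memℓp_infty ⟨familyNorm μ hq g ^ q, by
    rintro _ ⟨z | k, rfl⟩
    · simp only [Sum.elim_inl]
      rw [Real.norm_of_nonneg (by positivity)]
      exact Real.rpow_le_rpow (abs_nonneg _) (abs_le_familyNorm g _ _) (by linarith)
    · simp only [Sum.elim_inr]
      rw [Real.norm_of_nonneg (familyEnergy_nonneg g k)]
      exact familyEnergy_le g k⟩⟩

theorem familyPower_inl (g : familySpace μ hq) (z : ι × α) :
    familyPower g (Sum.inl z) = |g.1 z.1 z.2| ^ q := rfl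

theorem familyPower_nonneg (g : familySpace μ hq) (j) : 0 ≤ familyPower g j := by
  rcases j with z | k
  · rw [familyPower_inl]; positivity
  · exact familyEnergy_nonneg g k

theorem familyPower_restrict_le {B : ι → Set α} (hB : ∀ k, MeasurableSet (B k))
    (g : familySpace μ hq) (j) : familyPower (familyRestrict B hB g) j ≤ familyPower g j := by
  have h_abs := abs_familyRestrict_le hB g
  rcases j with z | k
  · exact Real.rpow_le_rpow (abs_nonneg _) (h_abs z.1 z.2) (by linarith)
  · simpa using! familyEnergy_le_of_abs_le zero_le_one (by simpa using h_abs k)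

theorem norm_familyPower_le (g : familySpace μ hq) :
    ‖familyPower g‖ ≤ familyNorm μ hq g ^ q := by
  have : 0 ≤ familyNorm μ hq g := apply_nonneg _ g
  refine lp.norm_le_of_forall_le (by positivity) fun j => ?_
  rw [Real.norm_of_nonneg (familyPower_nonneg g j)]
  rcases j with z | k
  · exact Real.rpow_le_rpow (abs_nonneg _) (abs_le_familyNorm g _ _) (by linarith)
  · exact familyEnergy_le g k

theorem familyEnergy_smul (c : ℝ) (g : familySpace μ hq) (k : ι) :
    familyEnergy (c • g) k = |c| ^ q * familyEnergy g k := by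
  have h (x : α) : ‖(c • g).1 k x‖ₑ ^ q = ENNReal.ofReal (|c| ^ q) * ‖g.1 k x‖ₑ ^ q := by
    change ‖c • g.1 k x‖ₑ ^ q = _
    rw [enorm_smul, ENNReal.mul_rpow_of_nonneg _ _ (by linarith), Real.enorm_eq_ofReal_abs c,
      ENNReal.ofReal_rpow_of_nonneg (abs_nonneg c) (by linarith)]
  simp only [familyEnergy, h]
  rw [lintegral_const_mul' _ _ ENNReal.ofReal_ne_top, ENNReal.toReal_mul,
    ENNReal.toReal_ofReal (by positivity)]

theorem familyPower_smul (c : ℝ) (g : familySpace μ hq) :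
    familyPower (c • g) = (|c| ^ q) • familyPower g := by
  ext j
  rw [lp.coeFn_smul, Pi.smul_apply, smul_eq_mul]
  rcases j with z | k
  · rw [familyPower_inl, familyPower_inl]
    change |c * g.1 z.1 z.2| ^ q = _
    rw [abs_mul, Real.mul_rpow (abs_nonneg _) (abs_nonneg _)]
  · exact familyEnergy_smul c g k

theorem familyPower_add_add_sub_le (hq₂ : q ≤ 2) (f g : familySpace μ hq) (j) :
    familyPower (f + g) j + familyPower (f - g) j ≤ 2 * (familyPower f j + familyPower g j) := by
  rcases j with z | k
  · exact abs_add_rpow_add_abs_sub_rpow_le (by linarith) hq₂ _ _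
  · exact familyEnergy_add_add_sub_le hq₂ f g k

end Families

/-! ### Small families and the removal of large parts -/

section PositiveFunctional

variable {J : Type*}

theorem convex_setOf_exists_lt_forall_le (η : ℝ) :
    Convex ℝ {b : lp (fun _ : J => ℝ) ∞ | ∃ c < η, ∀ j, b j ≤ c} := by
  rintro a ⟨c, hc, ha⟩ b ⟨d, hd, hb⟩ s t hs ht hst
  refine ⟨max c d, max_lt hc hd, fun j => ?_⟩
  have ha_max := (ha j).trans (le_max_left c d)
  have hb_max := (hb j).trans (le_max_right c d)
  calc s * a j + t * b j ≤ s * max c d + t * max c d := by gcongr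
    _ = max c d := by rw [← add_mul, hst, one_mul]

theorem isOpen_setOf_exists_lt_forall_le (η : ℝ) :
    IsOpen {b : lp (fun _ : J => ℝ) ∞ | ∃ c < η, ∀ j, b j ≤ c} := by
  refine Metric.isOpen_iff.2 ?_
  rintro a ⟨c, hc, ha⟩
  refine ⟨(η - c) / 2, by linarith, fun b hb => ⟨(η + c) / 2, by linarith, fun j => ?_⟩⟩
  have h_apply : |b j - a j| ≤ ‖b - a‖ := lp.norm_apply_le_norm ENNReal.top_ne_zero (b - a) j
  have h_diff := (abs_le.1 (h_apply.trans (mem_ball_iff_norm.1 hb).le)).2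
  linarith [ha j]

theorem exists_positive_functional (G : Set (lp (fun _ : J => ℝ) ∞)) {η : ℝ} (hη : 0 < η)
    (h : ∀ b ∈ convexHull ℝ G, ∃ j, η ≤ b j) :
    ∃ ν : StrongDual ℝ (lp (fun _ : J => ℝ) ∞),
      (∀ b : lp (fun _ : J => ℝ) ∞, (∀ j, 0 ≤ b j) → 0 ≤ ν b) ∧ ∀ b ∈ G, 1 ≤ ν b := by
  obtain ⟨f, u, hf_lt, hf_ge⟩ := geometric_hahn_banach_open
    (convex_setOf_exists_lt_forall_le η) (isOpen_setOf_exists_lt_forall_le η)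
    (convex_convexHull ℝ G) <| disjoint_left.2 <| by
      rintro b ⟨c, hc, hb⟩ hbG
      obtain ⟨j, hj⟩ := h b hbG
      linarith [hb j]
  have hu : 0 < u := by simpa using hf_lt 0 ⟨0, hη, fun _ => le_rfl⟩
  refine ⟨u⁻¹ • f, fun b hb => mul_nonneg (by positivity) ?_, fun b hb => ?_⟩
  · by_contra! h_neg
    have h_pos : 0 < -f b := neg_pos.2 h_neg
    have h_lt := hf_lt (-((u / -f b) • b))
      ⟨0, hη, fun j => neg_nonpos.2 (mul_nonneg (by positivity) (hb j))⟩
    rw [map_neg, map_smul, smul_eq_mul, ← mul_neg, div_mul_cancel₀ u h_pos.ne'] at h_lt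
    exact lt_irrefl u h_lt
  · rw [smul_apply, smul_eq_mul, inv_mul_eq_div, one_le_div hu]
    exact hf_ge b (subset_convexHull ℝ G hb)

end PositiveFunctional

section LargePart

variable {ι α : Type*} [MeasurableSpace α] {μ : ι → Measure α} {q : ℝ} {hq : 1 ≤ q}

open Classical in
/-- The part of the domain of the `k`-th function of a family where that function is large: the
whole domain if its energy exceeds `r`, and otherwise the set where the `q`-th power of its modulus
exceeds `r`. -/
noncomputable def largePart (g : familySpace μ hq) (r : ℝ) (k : ι) : Set α :=
  if r < familyEnergy g k then univ else {x | r < |g.1 k x| ^ q}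

theorem measurableSet_largePart (g : familySpace μ hq) (r : ℝ) (k : ι) :
    MeasurableSet (largePart g r k) := by
  unfold largePart
  split_ifs
  · exact MeasurableSet.univ
  · exact measurableSet_lt measurable_const
      ((measurable_norm.comp (measurable_of_familySpace g k)).pow_const q)

theorem le_of_mem_largePart {g : familySpace μ hq} {r : ℝ} {k : ι} {x : α}
    (h : x ∈ largePart g r k) :
    r ≤ familyPower g (Sum.inl (k, x)) + familyPower g (Sum.inr k) := by
  have h_inl := familyPower_nonneg g (Sum.inl (k, x))
  have h_inr := familyPower_nonneg g (Sum.inr k)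
  unfold largePart at h
  split_ifs at h with h_energy
  · exact le_add_of_nonneg_of_le h_inl h_energy.le
  · exact le_add_of_le_of_nonneg (le_of_lt h) h_inr

theorem largePart_eq_univ_or (g : familySpace μ hq) (r : ℝ) (k : ι) :
    largePart g r k = univ ∨ familyEnergy g k ≤ r := by
  unfold largePart
  split_ifs with h
  · exact Or.inl rfl
  · exact Or.inr (not_lt.1 h)

theorem familyNorm_restrict_largePart_compl_le (g : familySpace μ hq) {r : ℝ} (hr : 0 ≤ r) :
    familyNorm μ hq (familyRestrict (fun k => (largePart g r k)ᶜ)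
      (fun k => (measurableSet_largePart g r k).compl) g) ≤ r ^ q⁻¹ := by
  have hq₀ : 0 < q := by linarith
  refine (familyNorm_le_iff (by positivity)).2 ⟨fun k x => ?_, fun k => ?_⟩
  · rw [familyRestrict_apply]
    by_cases h : x ∈ largePart g r k
    · rw [indicator_of_notMem (not_not_intro h), abs_zero]
      positivity
    · rw [indicator_of_mem h]
      unfold largePart at h
      split_ifs at h
      · exact absurd (mem_univ x) h
      · exact (Real.le_rpow_inv_iff_of_pos (abs_nonneg _) hr hq₀).2 (not_lt.1 h)
  · rw [Real.rpow_inv_rpow hr hq₀.ne']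
    rcases largePart_eq_univ_or g r k with h | h
    · refine (familyEnergy_le_of_abs_le (g := g) le_rfl fun x => ?_).trans ?_
      · rw [familyRestrict_apply, indicator_of_notMem (by simp [h])]
        simp
      · rwa [Real.zero_rpow hq₀.ne', zero_mul]
    · exact (familyPower_restrict_le _ g (Sum.inr k)).trans h

theorem familyNorm_sum_smul_restrict_le {I : Type*} [Fintype I] {a : I → ℝ} {B : I → ι → Set α}
    (hB : ∀ i k, MeasurableSet (B i k)) {c : ℝ} (hc : 0 ≤ c)
    (h : ∀ k x, ∑ i, |a i| * (B i k).indicator 1 x ≤ c) (g : familySpace μ hq) :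
    familyNorm μ hq ((∑ i, a i • familyRestrict (B i) (hB i)) g) ≤ c * familyNorm μ hq g := by
  refine familyNorm_le_of_abs_le hc fun k x => ?_
  have h_apply : ((∑ i, a i • familyRestrict (B i) (hB i)) g).1 k x
      = ∑ i, a i * (B i k).indicator (g.1 k) x := by
    rw [LinearMap.sum_apply, Submodule.coe_sum, Finset.sum_apply, Finset.sum_apply]
    rfl
  rw [h_apply]
  calc |∑ i, a i * (B i k).indicator (g.1 k) x|
      ≤ ∑ i, |a i * (B i k).indicator (g.1 k) x| := Finset.abs_sum_le_sum_abs _ _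
    _ = ∑ i, |a i| * (B i k).indicator 1 x * |g.1 k x| := by
        refine Finset.sum_congr rfl fun i _ => ?_
        by_cases hx : x ∈ B i k <;> simp [hx, abs_mul]
    _ = (∑ i, |a i| * (B i k).indicator 1 x) * |g.1 k x| := (Finset.sum_mul ..).symm
    _ ≤ c * |g.1 k x| := mul_le_mul_of_nonneg_right (h k x) (abs_nonneg _)

end LargePart

section SmallFamily

variable {ι α : Type*} [MeasurableSpace α] {μ : ι → Measure α} {q : ℝ} {hq : 1 ≤ q}

/-- A finite convex combination of pairs `(n, g)` of an index `n ≥ n₀` and an element `g` of the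
unit ball vanishing on `D`, for which the mean of the powers `familyPower g` is at most `η` and the
mean of the values `φ n g` is at least `e`. -/
structure SmallFamily (φ : ℕ → familySpace μ hq →ₗ[ℝ] ℝ) (D : ι → Set α) (e η : ℝ) (n₀ : ℕ) where
  idx : Type
  fintype : Fintype idx
  w : idx → ℝ
  n : idx → ℕ
  g : idx → familySpace μ hq
  w_nonneg : ∀ i, 0 ≤ w i
  sum_w : ∑ i, w i = 1
  le_n : ∀ i, n₀ ≤ n i
  norm_le : ∀ i, familyNorm μ hq (g i) ≤ 1
  eq_zero : ∀ i k, ∀ x ∈ D k, (g i).1 k x = 0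
  sum_power_le : ∀ j, ∑ i, w i * familyPower (g i) j ≤ η
  le_sum : e ≤ ∑ i, w i * φ (n i) (g i)

attribute [instance] SmallFamily.fintype

namespace SmallFamily

variable {φ : ℕ → familySpace μ hq →ₗ[ℝ] ℝ} {D : ι → Set α} {e η : ℝ} {n₀ : ℕ}

/-- The mean of `φ n (T g)` over a small family, as a function of the operator `T`. -/
noncomputable def mean (F : SmallFamily φ D e η n₀) :
    Module.End ℝ (familySpace μ hq) →ₗ[ℝ] ℝ :=
  ∑ i, F.w i • (φ (F.n i) ∘ₗ LinearMap.applyₗ (F.g i))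

theorem mean_apply (F : SmallFamily φ D e η n₀) (T : Module.End ℝ (familySpace μ hq)) :
    F.mean T = ∑ i, F.w i * φ (F.n i) (T (F.g i)) := by
  simp [mean, LinearMap.sum_apply]

theorem mean_le (F : SmallFamily φ D e η n₀) (hφ : ∀ n g, φ n g ≤ familyNorm μ hq g) {c : ℝ}
    (hc : 0 ≤ c) {T : Module.End ℝ (familySpace μ hq)}
    (hT : ∀ g, familyNorm μ hq (T g) ≤ c * familyNorm μ hq g) : F.mean T ≤ c := by
  rw [mean_apply]
  calc ∑ i, F.w i * φ (F.n i) (T (F.g i)) ≤ ∑ i, F.w i * c := by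
        refine Finset.sum_le_sum fun i _ => mul_le_mul_of_nonneg_left ?_ (F.w_nonneg i)
        exact (hφ _ _).trans ((hT _).trans (mul_le_of_le_one_right hc (F.norm_le i)))
    _ = c := by rw [← Finset.sum_mul, F.sum_w, one_mul]

theorem sum_mul_abs_mean_restrict_le (F : SmallFamily φ D e η n₀)
    (hφ : ∀ n g, φ n g ≤ familyNorm μ hq g) {I : Type*} [Fintype I] {w : I → ℝ}
    (hw : ∀ i, 0 ≤ w i) {B : I → ι → Set α} (hB : ∀ i k, MeasurableSet (B i k)) {c : ℝ}
    (hc : 0 ≤ c) (h : ∀ k x, ∑ i, w i * (B i k).indicator 1 x ≤ c) :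
    ∑ i, w i * |F.mean (familyRestrict (B i) (hB i))| ≤ c := by
  set σ : I → ℝ := fun i => w i * SignType.sign (F.mean (familyRestrict (B i) (hB i)))
  have hσ (i : I) : |σ i| ≤ w i := by
    rw [abs_mul, abs_of_nonneg (hw i)]
    refine mul_le_of_le_one_right (hw i) ?_
    rcases lt_trichotomy (F.mean (familyRestrict (B i) (hB i))) 0 with h | h | h <;> simp [h]
  have h_sum : ∑ i, w i * |F.mean (familyRestrict (B i) (hB i))|
      = F.mean (∑ i, σ i • familyRestrict (B i) (hB i)) := by
    simp only [map_sum, map_smul, smul_eq_mul, σ, mul_assoc, sign_mul_self]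
  rw [h_sum]
  refine F.mean_le hφ hc (familyNorm_sum_smul_restrict_le hB hc fun k x => le_trans ?_ (h k x))
  exact Finset.sum_le_sum fun i _ =>
    mul_le_mul_of_nonneg_right (hσ i) (indicator_nonneg (fun _ _ => zero_le_one) x)

theorem mul_sum_mul_indicator_largePart_le (F : SmallFamily φ D e η n₀) (r : ℝ) (k : ι) (x : α) :
    r * ∑ i, F.w i * (largePart (F.g i) r k).indicator 1 x ≤ 2 * η := by
  calc r * ∑ i, F.w i * (largePart (F.g i) r k).indicator 1 x
      ≤ ∑ i, F.w i * (familyPower (F.g i) (Sum.inl (k, x)) + familyPower (F.g i) (Sum.inr k)) := by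
        rw [Finset.mul_sum]
        refine Finset.sum_le_sum fun i _ => ?_
        rw [mul_left_comm]
        refine mul_le_mul_of_nonneg_left ?_ (F.w_nonneg i)
        by_cases h : x ∈ largePart (F.g i) r k
        · rw [indicator_of_mem h, Pi.one_apply, mul_one]
          exact le_of_mem_largePart h
        · rw [indicator_of_notMem h, mul_zero]
          exact add_nonneg (familyPower_nonneg _ _) (familyPower_nonneg _ _)
    _ ≤ 2 * η := by
        simp only [mul_add, Finset.sum_add_distrib]
        linarith [F.sum_power_le (Sum.inl (k, x)), F.sum_power_le (Sum.inr k)]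

/-- The restriction of a small family to the complement of `B`. -/
noncomputable def restrictCompl (F : SmallFamily φ D e η n₀) {B : ι → Set α}
    (hB : ∀ k, MeasurableSet (B k)) {e' η' : ℝ} {n₁ : ℕ}
    (he : e' ≤ e - F.mean (familyRestrict B hB)) (hη : η ≤ η') (hn : n₁ ≤ n₀) :
    SmallFamily φ (fun k => D k ∪ B k) e' η' n₁ where
  idx := F.idx
  fintype := F.fintype
  w := F.w
  n := F.n
  g i := familyRestrict (fun k => (B k)ᶜ) (fun k => (hB k).compl) (F.g i)
  w_nonneg := F.w_nonneg
  sum_w := F.sum_w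
  le_n i := hn.trans (F.le_n i)
  norm_le i := (familyNorm_restrict_le _ _).trans (F.norm_le i)
  eq_zero i k x hx := by
    rw [familyRestrict_apply, indicator_apply_eq_zero]
    exact fun hxB => F.eq_zero i k x (hx.resolve_right hxB)
  sum_power_le j := by
    refine le_trans (Finset.sum_le_sum fun i _ => ?_) ((F.sum_power_le j).trans hη)
    exact mul_le_mul_of_nonneg_left (familyPower_restrict_le _ _ j) (F.w_nonneg i)
  le_sum := by
    have h_compl (i : F.idx) : φ (F.n i) (familyRestrict (fun k => (B k)ᶜ)
        (fun k => (hB k).compl) (F.g i))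
          = φ (F.n i) (F.g i) - φ (F.n i) (familyRestrict B hB (F.g i)) :=
      eq_sub_of_add_eq' (by rw [← map_add, familyRestrict_add_compl])
    simp only [h_compl, mul_sub, Finset.sum_sub_distrib, ← mean_apply]
    linarith [F.le_sum]

theorem exists_le_apply_restrict_largePart_sub (F : SmallFamily φ D e η n₀)
    (hφ : ∀ n g, φ n g ≤ familyNorm μ hq g) {r : ℝ} (hr : 0 ≤ r) (b : F.idx → ℝ) :
    ∃ i, e - r ^ q⁻¹ - ∑ l, F.w l * b l
      ≤ φ (F.n i) (familyRestrict _ (measurableSet_largePart (F.g i) r) (F.g i)) - b i := by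
  set f : F.idx → familySpace μ hq :=
    fun i => familyRestrict _ (measurableSet_largePart (F.g i) r) (F.g i)
  have h_apply (i : F.idx) : φ (F.n i) (F.g i) - r ^ q⁻¹ ≤ φ (F.n i) (f i) := by
    have h_add := congrArg (φ (F.n i))
      (familyRestrict_add_compl (measurableSet_largePart (F.g i) r) (F.g i))
    rw [map_add] at h_add
    linarith [(hφ (F.n i) _).trans (familyNorm_restrict_largePart_compl_le (F.g i) hr)]
  obtain ⟨i, -, hi⟩ := (convexOn_id (𝕜 := ℝ) (convex_univ (E := ℝ))).exists_ge_of_centerMass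
    (t := Finset.univ) (w := F.w) (p := fun i => φ (F.n i) (f i) - b i)
    (fun i _ => F.w_nonneg i) (by simp [F.sum_w]) (fun _ _ => mem_univ _)
  refine ⟨i, le_trans ?_ hi⟩
  have h_sum : ∑ i, F.w i * (φ (F.n i) (F.g i) - r ^ q⁻¹) ≤ ∑ i, F.w i * φ (F.n i) (f i) :=
    Finset.sum_le_sum fun i _ => mul_le_mul_of_nonneg_left (h_apply i) (F.w_nonneg i)
  simp only [id, Finset.centerMass_eq_of_sum_1 _ _ F.sum_w, smul_eq_mul, mul_sub,
    Finset.sum_sub_distrib, ← Finset.sum_mul, F.sum_w, one_mul] at h_sum ⊢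
  linarith [F.le_sum]

theorem exists_le_apply_restrict_largePart_sub_mean {r : ℝ} (F : SmallFamily φ D e (r ^ 2) n₀)
    (hφ : ∀ n g, φ n g ≤ familyNorm μ hq g) (hr : 0 < r) {D' : ι → Set α} {e' η' : ℝ} {n' : ℕ}
    (E : SmallFamily φ D' e' η' n') {L : ℝ} (hL : 0 ≤ L) :
    ∃ i, e - r ^ q⁻¹ - L * (2 * r) ≤
      φ (F.n i) (familyRestrict _ (measurableSet_largePart (F.g i) r) (F.g i))
        - L * |E.mean (familyRestrict _ (measurableSet_largePart (F.g i) r))| := by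
  have h_mult (k : ι) (x : α) :
      ∑ i, F.w i * (largePart (F.g i) r k).indicator 1 x ≤ 2 * r :=
    le_of_mul_le_mul_left ((F.mul_sum_mul_indicator_largePart_le r k x).trans_eq (by ring)) hr
  obtain ⟨i, hi⟩ := F.exists_le_apply_restrict_largePart_sub hφ hr.le fun i =>
    L * |E.mean (familyRestrict _ (measurableSet_largePart (F.g i) r))|
  refine ⟨i, le_trans ?_ hi⟩
  simp only [mul_left_comm (F.w _), ← Finset.mul_sum]
  gcongr
  exact E.sum_mul_abs_mean_restrict_le hφ F.w_nonneg
    (fun i => measurableSet_largePart (F.g i) r) (by positivity) h_mult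

theorem exists_infinite_setOf_le_apply_sub_mean {r : ℝ} (F : SmallFamily φ D e (r ^ 2) n₀)
    (hφ : ∀ n g, φ n g ≤ familyNorm μ hq g) (hr : 0 < r) {D' : ι → Set α} {e' : ℝ} {η' : ℕ → ℝ}
    {n' : ℕ → ℕ} (E : ∀ s, SmallFamily φ D' e' (η' s) (n' s)) {L : ℝ} (hL : 0 ≤ L) :
    ∃ i, {s | e - r ^ q⁻¹ - L * (2 * r) ≤
      φ (F.n i) (familyRestrict _ (measurableSet_largePart (F.g i) r) (F.g i))
        - L * |(E s).mean (familyRestrict _ (measurableSet_largePart (F.g i) r))|}.Infinite := by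
  choose pick h_pick using fun s =>
    F.exists_le_apply_restrict_largePart_sub_mean hφ hr (E s) hL
  obtain ⟨i, hi⟩ := Finite.exists_infinite_fiber pick
  refine ⟨i, (infinite_coe_iff.1 hi).mono ?_⟩
  rintro s rfl
  exact h_pick s

end SmallFamily

theorem exists_removal_threshold (hq : 0 < q) {δ : ℝ} (hδ : 0 < δ) (hδ₁ : δ ≤ 1) :
    ∃ r : ℝ, 0 < r ∧ r ≤ δ ∧ r ^ q⁻¹ ≤ δ / 4 ∧ 4 / δ * (2 * r) ≤ δ / 4 := by
  refine ⟨min ((δ / 4) ^ q) (δ ^ 2 / 32), by positivity, ?_, ?_, ?_⟩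
  · exact (min_le_right _ _).trans (by nlinarith)
  · calc (min ((δ / 4) ^ q) (δ ^ 2 / 32)) ^ q⁻¹ ≤ ((δ / 4) ^ q) ^ q⁻¹ :=
          Real.rpow_le_rpow (by positivity) (min_le_left _ _) (by positivity)
      _ = δ / 4 := Real.rpow_rpow_inv (by positivity) hq.ne'
  · calc 4 / δ * (2 * min ((δ / 4) ^ q) (δ ^ 2 / 32)) ≤ 4 / δ * (2 * (δ ^ 2 / 32)) := by
          gcongr; exact min_le_right _ _
      _ = δ / 4 := by field_simp; ring

/-- One step of the gliding hump: a single almost extremal `f`, supported on a set `B` off `D`,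
after whose removal arbitrarily small families persist. -/
structure IsRemoval (φ : ℕ → familySpace μ hq →ₗ[ℝ] ℝ) (D : ι → Set α) (e δ : ℝ) (n : ℕ)
    (f : familySpace μ hq) (B : ι → Set α) : Prop where
  norm_le : familyNorm μ hq f ≤ 1
  eq_zero_of_notMem : ∀ k, ∀ x ∉ B k, f.1 k x = 0
  eq_zero_of_mem : ∀ k, ∀ x ∈ D k, f.1 k x = 0
  le_apply : e - δ ≤ φ n f
  eq_univ_or : ∀ k, B k = univ ∨ familyEnergy f k ≤ δ
  nonempty : ∀ η > 0, ∀ n₁, Nonempty (SmallFamily φ (fun k => D k ∪ B k) (e - δ) η n₁)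

theorem exists_isRemoval {φ : ℕ → familySpace μ hq →ₗ[ℝ] ℝ}
    (hφ : ∀ n g, φ n g ≤ familyNorm μ hq g) {D : ι → Set α} {e δ : ℝ} (he : 0 ≤ e) (hδ : 0 < δ)
    (hδ₁ : δ ≤ 1) (hD : ∀ η > 0, ∀ n₀, Nonempty (SmallFamily φ D e η n₀)) (n₀ : ℕ) :
    ∃ n f B, n₀ ≤ n ∧ IsRemoval φ D e δ n f B := by
  obtain ⟨r, hr, hrδ, hr_root, hr_mul⟩ := exists_removal_threshold (q := q) (by linarith) hδ hδ₁
  obtain ⟨F⟩ := hD (r ^ 2) (by positivity) n₀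
  have E (s : ℕ) : SmallFamily φ D e (1 / ((s : ℝ) + 1)) s := (hD _ (by positivity) s).some
  obtain ⟨i, hi⟩ :=
    F.exists_infinite_setOf_le_apply_sub_mean hφ hr E (show 0 ≤ 4 / δ by positivity)
  have hB := measurableSet_largePart (F.g i) r
  set f := familyRestrict _ hB (F.g i)
  set err : ℕ → ℝ := fun s => (E s).mean (familyRestrict _ hB)
  replace hi : {s | e - δ / 2 ≤ φ (F.n i) f - 4 / δ * |err s|}.Infinite :=
    hi.mono fun s hs => (by linarith : e - δ / 2 ≤ _).trans hs.out
  have hf_norm : familyNorm μ hq f ≤ 1 := (familyNorm_restrict_le _ _).trans (F.norm_le i)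
  refine ⟨F.n i, f, largePart (F.g i) r, F.le_n i, hf_norm, fun k x hx => indicator_of_notMem hx _,
    fun k x hx => indicator_apply_eq_zero.2 fun _ => F.eq_zero i k x hx, ?_, fun k => ?_,
    fun η hη n₁ => ?_⟩
  · obtain ⟨s, hs⟩ := hi.nonempty
    have : 0 ≤ 4 / δ * |err s| := by positivity
    linarith [hs.out]
  · exact (largePart_eq_univ_or (F.g i) r k).imp_right fun h =>
      (familyPower_restrict_le _ _ (Sum.inr k)).trans (h.trans hrδ)
  · obtain ⟨m, hm⟩ := exists_nat_one_div_lt hη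
    obtain ⟨s, hs, hs_gt⟩ := hi.exists_gt (max m n₁)
    have hs_err : 4 / δ * |err s| ≤ 4 / δ * δ := by
      rw [div_mul_cancel₀ _ hδ.ne']
      linarith [hs.out, hφ (F.n i) f]
    have h_err : err s ≤ δ := (le_abs_self _).trans (le_of_mul_le_mul_left hs_err (by positivity))
    have hsη : 1 / ((s : ℝ) + 1) ≤ η :=
      (Nat.one_div_le_one_div ((le_max_left _ _).trans hs_gt.le)).trans hm.le
    exact ⟨(E s).restrictCompl hB (by linarith) hsη ((le_max_right _ _).trans hs_gt.le)⟩

end SmallFamily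

/-! ### Null sequences of functionals on quotients of spaces of families -/

section DisjointSequence

open scoped BoundedContinuousFunction

variable {ι α : Type*} [MeasurableSpace α] {μ : ι → Measure α} {q : ℝ} {hq : 1 ≤ q}

/-- A disjointly supported sequence in the unit ball of `familySpace` with total energies at most
`2`, so that it can be summed against any bounded sequence of coefficients. -/
structure IsDisjointSequence (f : ℕ → familySpace μ hq) : Prop where
  norm_le : ∀ j, familyNorm μ hq (f j) ≤ 1
  disjoint : ∀ i j, i ≠ j → ∀ k x, (f i).1 k x = 0 ∨ (f j).1 k x = 0
  sum_energy_le : ∀ k m, ∑ j ∈ Finset.range m, familyEnergy (f j) k ≤ 2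

namespace IsDisjointSequence

variable {f : ℕ → familySpace μ hq}

theorem exists_hasSum (hf : IsDisjointSequence f) (a : ℕ → ℝ) (k : ι) (x : α) :
    ∃ i, HasSum (fun j => a j * (f j).1 k x) (a i * (f i).1 k x) := by
  by_cases h : ∃ i, (f i).1 k x ≠ 0
  · obtain ⟨i, hi⟩ := h
    exact ⟨i, hasSum_single i fun j hj => by
      rw [(hf.disjoint i j hj.symm k x).resolve_left hi, mul_zero]⟩
  · push Not at h
    exact ⟨0, hasSum_single 0 fun j _ => by rw [h j, mul_zero]⟩

theorem summable (hf : IsDisjointSequence f) (a : ℕ → ℝ) (k : ι) (x : α) :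
    Summable fun j => a j * (f j).1 k x :=
  (hf.exists_hasSum a k x).choose_spec.summable

theorem measurable_tsum (hf : IsDisjointSequence f) (a : ℕ → ℝ) (k : ι) :
    Measurable fun x => ∑' j, a j * (f j).1 k x := by
  refine measurable_of_tendsto_metrizable (f := fun n x => ∑ j ∈ Finset.range n, a j * (f j).1 k x)
    (fun n => Finset.measurable_fun_sum _ fun j _ =>
      (measurable_of_familySpace (f j) k).const_mul _) (tendsto_pi_nhds.2 fun x => ?_)
  exact (hf.summable a k x).hasSum.tendsto_sum_nat

variable {a : ℕ → ℝ} {c : ℝ}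

theorem abs_tsum_le (hf : IsDisjointSequence f) (ha : ∀ j, |a j| ≤ c) (k : ι) (x : α) :
    |∑' j, a j * (f j).1 k x| ≤ c := by
  obtain ⟨i, hi⟩ := hf.exists_hasSum a k x
  rw [hi.tsum_eq, abs_mul]
  exact (mul_le_of_le_one_right (abs_nonneg _)
    ((abs_le_familyNorm (f i) k x).trans (hf.norm_le i))).trans (ha i)

theorem lintegral_tsum_le (hf : IsDisjointSequence f) (ha : ∀ j, |a j| ≤ c) (k : ι) :
    ∫⁻ x, ‖∑' j, a j * (f j).1 k x‖ₑ ^ q ∂μ k ≤ ENNReal.ofReal (2 * c ^ q) := by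
  have hq₀ : 0 ≤ q := by linarith
  have hc : 0 ≤ c := (abs_nonneg _).trans (ha 0)
  calc ∫⁻ x, ‖∑' j, a j * (f j).1 k x‖ₑ ^ q ∂μ k
      ≤ ∫⁻ x, ∑' j, ENNReal.ofReal (c ^ q) * ‖(f j).1 k x‖ₑ ^ q ∂μ k := by
        refine lintegral_mono fun x => ?_
        obtain ⟨i, hi⟩ := hf.exists_hasSum a k x
        rw [hi.tsum_eq, enorm_mul, ENNReal.mul_rpow_of_nonneg _ _ hq₀]
        refine le_trans ?_ (ENNReal.le_tsum i)
        rw [← ENNReal.ofReal_rpow_of_nonneg hc hq₀, Real.enorm_eq_ofReal_abs]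
        gcongr
        exact ha i
    _ = ENNReal.ofReal (c ^ q) * ∑' j, ENNReal.ofReal (familyEnergy (f j) k) := by
        rw [lintegral_tsum fun j => (((measurable_of_familySpace (f j) k).enorm.pow_const
          q).const_mul _).aemeasurable, ← ENNReal.tsum_mul_left]
        simp only [ofReal_familyEnergy, lintegral_const_mul' _ _ ENNReal.ofReal_ne_top]
    _ ≤ ENNReal.ofReal (c ^ q) * ENNReal.ofReal 2 := by
        gcongr
        refine ENNReal.tsum_le_of_sum_range_le fun m => ?_
        rw [← ENNReal.ofReal_sum_of_nonneg fun j _ => familyEnergy_nonneg (f j) k]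
        exact ENNReal.ofReal_le_ofReal (hf.sum_energy_le k m)
    _ = ENNReal.ofReal (2 * c ^ q) := by rw [← ENNReal.ofReal_mul (by positivity), mul_comm]

theorem exists_linearMap (hf : IsDisjointSequence f) :
    ∃ S : (ℕ →ᵇ ℝ) →ₗ[ℝ] familySpace μ hq,
      (∀ a, familyNorm μ hq (S a) ≤ 2 * ‖a‖) ∧ ∀ j, S (boundedIndicator {j}) = f j := by
  have h_abs (a : ℕ →ᵇ ℝ) (k : ι) (x : α) : |∑' j, a j * (f j).1 k x| ≤ 2 * ‖a‖ :=
    (hf.abs_tsum_le a.norm_coe_le_norm k x).trans (by linarith [norm_nonneg a])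
  have h_lq (a : ℕ →ᵇ ℝ) (k : ι) :
      ∫⁻ x, ‖∑' j, a j * (f j).1 k x‖ₑ ^ q ∂μ k ≤ ENNReal.ofReal ((2 * ‖a‖) ^ q) := by
    refine (hf.lintegral_tsum_le a.norm_coe_le_norm k).trans (ENNReal.ofReal_le_ofReal ?_)
    rw [Real.mul_rpow zero_le_two (norm_nonneg a)]
    gcongr
    exact Real.self_le_rpow_of_one_le one_le_two hq
  refine ⟨{ toFun := fun a => ⟨fun k x => ∑' j, a j * (f j).1 k x,
              mem_familySpace (by positivity) (hf.measurable_tsum a) (h_abs a) (h_lq a)⟩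
            map_add' := fun a b => ?_
            map_smul' := fun c a => ?_ }, fun a => ?_, fun j => ?_⟩
  · ext k x
    change ∑' j, (a j + b j) * (f j).1 k x = ∑' j, a j * (f j).1 k x + ∑' j, b j * (f j).1 k x
    simp only [add_mul]
    exact (hf.summable a k x).tsum_add (hf.summable b k x)
  · ext k x
    change ∑' j, (c * a j) * (f j).1 k x = c * ∑' j, a j * (f j).1 k x
    simp only [mul_assoc]
    exact tsum_mul_left
  · exact (familyNorm_le_iff_lintegral (by positivity)).2 ⟨h_abs a, h_lq a⟩
  · ext k x
    change ∑' i, boundedIndicator {j} i * (f i).1 k x = (f j).1 k x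
    rw [tsum_eq_single j fun i hi => by simp [boundedIndicator_apply, hi]]
    simp [boundedIndicator_apply]

end IsDisjointSequence

end DisjointSequence

section GlidingHump

variable {ι α : Type*} [MeasurableSpace α] {μ : ι → Measure α} {q : ℝ} {hq : 1 ≤ q}
  {φ : ℕ → familySpace μ hq →ₗ[ℝ] ℝ}

theorem exists_seq_isRemoval (hφ : ∀ n g, φ n g ≤ familyNorm μ hq g) {e δ : ℕ → ℝ}
    (he : ∀ j, 0 ≤ e j) (hδ : ∀ j, 0 < δ j) (hδ₁ : ∀ j, δ j ≤ 1)
    (he_succ : ∀ j, e j - δ j = e (j + 1))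
    (h : ∀ η > 0, ∀ n₀, Nonempty (SmallFamily φ (fun _ => ∅) (e 0) η n₀)) :
    ∃ (n : ℕ → ℕ) (f : ℕ → familySpace μ hq) (B D : ℕ → ι → Set α), (∀ j, j ≤ n j) ∧
      (∀ j k, D (j + 1) k = D j k ∪ B j k) ∧
      ∀ j, IsRemoval φ (D j) (e j) (δ j) (n j) (f j) (B j) := by
  choose n f B hn hf using fun (j : ℕ) (D : {D : ι → Set α //
      ∀ η > 0, ∀ n₀, Nonempty (SmallFamily φ D (e j) η n₀)}) =>
    exists_isRemoval hφ (he j) (hδ j) (hδ₁ j) D.2 j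
  let D (j : ℕ) : {D : ι → Set α // ∀ η > 0, ∀ n₀, Nonempty (SmallFamily φ D (e j) η n₀)} :=
    Nat.rec ⟨fun _ => ∅, h⟩
      (fun j D => ⟨fun k => D.1 k ∪ B j D k, he_succ j ▸ (hf j D).nonempty⟩) j
  exact ⟨fun j => n j (D j), fun j => f j (D j), fun j => B j (D j), fun j => (D j).1,
    fun j => hn j (D j), fun _ _ => rfl, fun j => hf j (D j)⟩

theorem sum_range_le_two {a δ : ℕ → ℝ} {P : ℕ → Prop} (ha : ∀ j, a j ≤ 1)
    (haδ : ∀ j, P j ∨ a j ≤ δ j) (ha_zero : ∀ i j, i < j → P i → a j ≤ 0) (hδ : ∀ j, 0 ≤ δ j)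
    {m : ℕ} (hδ_sum : ∑ j ∈ Finset.range m, δ j ≤ 1) : ∑ j ∈ Finset.range m, a j ≤ 2 := by
  classical
  by_cases hP : ∃ i, P i
  · have h_term (j : ℕ) : a j ≤ δ j + if j = Nat.find hP then 1 else 0 := by
      rcases lt_trichotomy j (Nat.find hP) with h | h | h
      · rw [if_neg h.ne, add_zero]
        exact (haδ j).resolve_left (Nat.find_min hP h)
      · rw [if_pos h]
        linarith [ha j, hδ j]
      · rw [if_neg h.ne', add_zero]
        exact (ha_zero _ j h (Nat.find_spec hP)).trans (hδ j)
    refine (Finset.sum_le_sum fun j _ => h_term j).trans ?_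
    rw [Finset.sum_add_distrib, Finset.sum_ite_eq']
    split_ifs <;> linarith
  · push Not at hP
    exact (Finset.sum_le_sum fun j _ => (haδ j).resolve_left (hP j)).trans (by linarith)

theorem isDisjointSequence_of_isRemoval {e δ : ℕ → ℝ} {n : ℕ → ℕ} {f : ℕ → familySpace μ hq}
    {B D : ℕ → ι → Set α} (hD : ∀ j k, D (j + 1) k = D j k ∪ B j k)
    (hf : ∀ j, IsRemoval φ (D j) (e j) (δ j) (n j) (f j) (B j)) (hδ : ∀ j, 0 ≤ δ j)
    (hδ_sum : ∀ m, ∑ j ∈ Finset.range m, δ j ≤ 1) : IsDisjointSequence f := by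
  have hD_mono (k : ι) : Monotone fun j => D j k :=
    monotone_nat_of_le_succ fun j => (hD j k).symm ▸ subset_union_left
  have hBD {i j : ℕ} (k : ι) (hij : i < j) : B i k ⊆ D j k :=
    (subset_union_right.trans (hD i k).ge).trans (hD_mono k hij)
  have h_lt {i j : ℕ} (hij : i < j) (k : ι) (x : α) : (f i).1 k x = 0 ∨ (f j).1 k x = 0 := by
    by_cases hx : x ∈ B i k
    · exact Or.inr ((hf j).eq_zero_of_mem k x (hBD k hij hx))
    · exact Or.inl ((hf i).eq_zero_of_notMem k x hx)
  refine ⟨fun j => (hf j).norm_le, fun i j hij k x => ?_, fun k m => ?_⟩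
  · rcases hij.lt_or_gt with h | h
    · exact h_lt h k x
    · exact (h_lt h k x).symm
  · refine sum_range_le_two (fun j => ?_) (fun j => (hf j).eq_univ_or k) (fun i j hij hB => ?_) hδ
      (hδ_sum m)
    · exact (familyEnergy_le (f j) k).trans
        (Real.rpow_le_one (apply_nonneg _ _) (hf j).norm_le (by linarith))
    · refine (familyEnergy_le_of_abs_le (g := f j) le_rfl fun x => ?_).trans ?_
      · rw [(hf j).eq_zero_of_mem k x (hBD k hij (hB ▸ mem_univ x))]
        simp
      · rw [Real.zero_rpow (by linarith), zero_mul]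

theorem not_forall_nonempty_smallFamily (hφ : ∀ n g, φ n g ≤ familyNorm μ hq g)
    (hφ₀ : ∀ g, Tendsto (fun n => φ n g) atTop (𝓝 0)) {ε : ℝ} (hε : 0 < ε) (hε₁ : ε ≤ 1) :
    ¬ ∀ η > 0, ∀ n₀, Nonempty (SmallFamily φ (fun _ => ∅) ε η n₀) := by
  intro h
  set e : ℕ → ℝ := fun j => ε / 2 + ε / 2 * (1 / 2) ^ j with he
  set δ : ℕ → ℝ := fun j => ε / 4 * (1 / 2) ^ j with hδ
  have hδ_pos (j : ℕ) : 0 < δ j := by positivity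
  have hδ_sum (m : ℕ) : ∑ j ∈ Finset.range m, δ j ≤ 1 := by
    rw [← Finset.mul_sum]
    nlinarith [sum_geometric_two_le m]
  have hδ_le (j : ℕ) : δ j ≤ 1 :=
    (Finset.single_le_sum (fun i _ => (hδ_pos i).le) (Finset.self_mem_range_succ j)).trans
      (hδ_sum (j + 1))
  have he_succ (j : ℕ) : e j - δ j = e (j + 1) := by
    simp only [he, hδ, pow_succ]
    ring
  have he_zero : e 0 = ε := by
    simp only [he, pow_zero]
    ring
  obtain ⟨n, f, B, D, hn, hD, hf⟩ := exists_seq_isRemoval hφ (fun j => by positivity) hδ_pos hδ_le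
    he_succ (he_zero.symm ▸ h)
  obtain ⟨S, hS, hSf⟩ :=
    (isDisjointSequence_of_isRemoval hD hf (fun j => (hδ_pos j).le) hδ_sum).exists_linearMap
  refine not_forall_le_apply_boundedIndicator (C := 2) (half_pos hε) (fun j => φ (n j) ∘ₗ S)
    (fun j a => (hφ _ _).trans (hS a))
    (fun a => (hφ₀ (S a)).comp (tendsto_atTop_mono hn tendsto_id)) fun j => ?_
  have h_le := (hf j).le_apply
  have : 0 ≤ ε / 2 * (1 / 2) ^ (j + 1) := by positivity
  rw [he_succ] at h_le
  simp only [he] at h_le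
  rw [LinearMap.comp_apply, hSf]
  linarith

end GlidingHump

section Gauge

variable {ι α : Type*} [MeasurableSpace α] {μ : ι → Measure α} {q : ℝ} {hq : 1 ≤ q}

theorem exists_positive_functional_of_isEmpty_smallFamily {φ : ℕ → familySpace μ hq →ₗ[ℝ] ℝ}
    {ε η : ℝ} {n₀ : ℕ} (hη : 0 < η) (h : IsEmpty (SmallFamily φ (fun _ => ∅) ε η n₀)) :
    ∃ ν : StrongDual ℝ (lp (fun _ : (ι × α) ⊕ ι => ℝ) ∞), (∀ b, (∀ j, 0 ≤ b j) → 0 ≤ ν b) ∧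
      ∀ n ≥ n₀, ∀ g, familyNorm μ hq g ≤ 1 → ε ≤ φ n g → 1 ≤ ν (familyPower g) := by
  obtain ⟨ν, hν, hν_one⟩ := exists_positive_functional
    {b | ∃ n ≥ n₀, ∃ g : familySpace μ hq, familyNorm μ hq g ≤ 1 ∧ ε ≤ φ n g ∧ familyPower g = b}
    hη fun b hb => by
      by_contra! h_lt
      obtain ⟨I, hI, w, z, hw, hw_sum, hz, rfl⟩ := mem_convexHull_iff_exists_fintype.1 hb
      choose n hn g hg hφg hgz using hz
      refine h.false ⟨I, hI, w, n, g, hw, hw_sum, hn, hg, fun _ _ _ h => absurd h (notMem_empty _),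
        fun j => ?_, ?_⟩
      · refine le_trans (le_of_eq ?_) (h_lt j).le
        rw [lp.coeFn_sum, Finset.sum_apply]
        exact Finset.sum_congr rfl fun i _ => by rw [← hgz]; rfl
      · calc ε = ∑ i, w i * ε := by rw [← Finset.sum_mul, hw_sum, one_mul]
          _ ≤ _ := Finset.sum_le_sum fun i _ => mul_le_mul_of_nonneg_left (hφg i) (hw i)
  exact ⟨ν, hν, fun n hn g hg hφg => hν_one _ ⟨n, hn, g, hg, hφg, rfl⟩⟩

/-- The gauge `g ↦ ν(|g|^q)^(1/q)` attached to a positive functional `ν` on the space containing the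
powers of families. -/
noncomputable def familyGauge (ν : StrongDual ℝ (lp (fun _ : (ι × α) ⊕ ι => ℝ) ∞))
    (g : familySpace μ hq) : ℝ :=
  ν (familyPower g) ^ q⁻¹

variable {ν : StrongDual ℝ (lp (fun _ : (ι × α) ⊕ ι => ℝ) ∞)}

theorem isSmoothGauge_familyGauge (hq₂ : q ≤ 2) (hν : ∀ b, (∀ j, 0 ≤ b j) → 0 ≤ ν b) :
    IsSmoothGauge q (familyGauge ν : familySpace μ hq → ℝ) := by
  have hq₀ : q ≠ 0 := by linarith
  have hν_power (g : familySpace μ hq) : 0 ≤ ν (familyPower g) := hν _ (familyPower_nonneg g)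
  refine ⟨fun g => Real.rpow_nonneg (hν_power g) _, fun c g => ?_, fun f g => ?_⟩
  · rw [familyGauge, familyPower_smul, map_smul, smul_eq_mul,
      Real.mul_rpow (by positivity) (hν_power g), Real.rpow_rpow_inv (abs_nonneg c) hq₀,
      familyGauge]
  · simp only [familyGauge, Real.rpow_inv_rpow (hν_power _) hq₀]
    have h_diff := hν ((2 : ℝ) • (familyPower f + familyPower g)
      - (familyPower (f + g) + familyPower (f - g)))
      fun j => sub_nonneg.2 (familyPower_add_add_sub_le hq₂ f g j)
    rw [map_sub, map_smul, map_add, map_add, smul_eq_mul] at h_diff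
    linarith

theorem familyGauge_le (hν : ∀ b, (∀ j, 0 ≤ b j) → 0 ≤ ν b) (g : familySpace μ hq) :
    familyGauge ν g ≤ ‖ν‖ ^ q⁻¹ * familyNorm μ hq g := by
  have hg : 0 ≤ familyNorm μ hq g := apply_nonneg _ g
  have h_power : ν (familyPower g) ≤ ‖ν‖ * familyNorm μ hq g ^ q :=
    (le_abs_self _).trans ((ν.le_opNorm _).trans (by gcongr; exact norm_familyPower_le g))
  calc familyGauge ν g ≤ (‖ν‖ * familyNorm μ hq g ^ q) ^ q⁻¹ :=
        Real.rpow_le_rpow (hν _ (familyPower_nonneg g)) h_power (by positivity)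
    _ = ‖ν‖ ^ q⁻¹ * familyNorm μ hq g := by
        rw [Real.mul_rpow (norm_nonneg _) (by positivity), Real.rpow_rpow_inv hg (by linarith)]

theorem IsSmoothGauge.apply_le_add {Y : Type*} [AddCommGroup Y] [Module ℝ Y] {p : Y → ℝ}
    (hp : IsSmoothGauge q p) {N : Seminorm ℝ Y} {φ : Y →ₗ[ℝ] ℝ} (hφ : ∀ g, φ g ≤ N g) {ε : ℝ}
    (hε : 0 ≤ ε) (h : ∀ g, N g ≤ 1 → ε ≤ φ g → 1 ≤ p g) (g : Y) : φ g ≤ p g + ε * N g := by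
  have hN : 0 ≤ N g := apply_nonneg N g
  have hpg := hp.nonneg g
  rcases hN.eq_or_lt with h₀ | h₀
  · linarith [hφ g, mul_nonneg hε hN]
  rcases le_or_gt (φ g) (ε * N g) with h_le | h_gt
  · linarith
  have h_unit : 1 ≤ p ((N g)⁻¹ • g) := by
    refine h _ ?_ ?_
    · rw [map_smul_eq_mul, Real.norm_of_nonneg (by positivity), inv_mul_cancel₀ h₀.ne']
    · rw [map_smul, smul_eq_mul, inv_mul_eq_div, le_div_iff₀ h₀]
      exact h_gt.le
  rw [hp.smul, abs_of_pos (by positivity), inv_mul_eq_div, one_le_div h₀] at h_unit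
  linarith [hφ g, mul_nonneg hε hN]

theorem exists_mem_convexHull_le_familyNorm (hq₁ : 1 < q) (hq₂ : q ≤ 2)
    {φ : ℕ → familySpace μ hq →ₗ[ℝ] ℝ} (hφ : ∀ n g, φ n g ≤ familyNorm μ hq g)
    (hφ₀ : ∀ g, Tendsto (fun n => φ n g) atTop (𝓝 0)) {ε : ℝ} (hε : 0 < ε) :
    ∃ θ ∈ convexHull ℝ (range φ), ∀ g, θ g ≤ ε * familyNorm μ hq g := by
  set ε' := min (ε / 3) 1
  have hε' : 0 < ε' := by positivity
  have h_not := not_forall_nonempty_smallFamily hφ hφ₀ hε' (min_le_right _ _)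
  push Not at h_not
  obtain ⟨η, hη, n₀, h_empty⟩ := h_not
  obtain ⟨ν, hν, hν_one⟩ := exists_positive_functional_of_isEmpty_smallFamily hη h_empty
  have h_gauge := isSmoothGauge_familyGauge (μ := μ) (hq := hq) hq₂ hν
  obtain ⟨θ, hθ, hθ_le⟩ := h_gauge.exists_mem_convexHull_le (familyNorm μ hq) hq₁
    (by positivity) hε' (familyGauge_le hν) (fun n => φ (n + n₀))
    (fun g => (hφ₀ g).comp (tendsto_add_atTop_nat n₀))
    fun n => h_gauge.apply_le_add (hφ _) hε'.le fun g hg hφg =>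
      Real.one_le_rpow (hν_one _ (Nat.le_add_left n₀ n) g hg hφg) (by positivity)
  refine ⟨θ, convexHull_mono (range_comp_subset_range (· + n₀) φ) hθ, fun g => (hθ_le g).trans ?_⟩
  have hεε' : 3 * ε' ≤ ε := by linarith [min_le_left (ε / 3) 1]
  exact mul_le_mul_of_nonneg_right hεε' (apply_nonneg _ g)

theorem exists_mem_convexHull_apply_le_of_family_quotient (hq₁ : 1 < q) (hq₂ : q ≤ 2)
    {X : Type*} [SeminormedAddCommGroup X] [NormedSpace ℝ X] (Q : familySpace μ hq →ₗ[ℝ] X) {C : ℝ}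
    (hC : 0 ≤ C) (hQ : ∀ g, ‖Q g‖ ≤ C * familyNorm μ hq g)
    (hQ_lift : ∀ x : X, ‖x‖ ≤ 1 → ∃ g, familyNorm μ hq g ≤ 1 ∧ Q g = x)
    {φ : ℕ → StrongDual ℝ X} {K₀ : ℝ} (hK₀ : ∀ n, ‖φ n‖ ≤ K₀)
    (hφ : ∀ x, Tendsto (fun n => φ n x) atTop (𝓝 0)) {ε : ℝ} (hε : 0 < ε) :
    ∃ θ ∈ convexHull ℝ (range φ), ∀ x, ‖x‖ ≤ 1 → θ x ≤ ε := by
  have hK₀_nonneg : 0 ≤ K₀ := (norm_nonneg _).trans (hK₀ 0)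
  set K := K₀ * C + 1
  have hK : 0 < K := by positivity
  set T : StrongDual ℝ X →ₗ[ℝ] (familySpace μ hq →ₗ[ℝ] ℝ) :=
    K⁻¹ • (LinearMap.lcomp ℝ ℝ Q ∘ₗ ContinuousLinearMap.coeLM ℝ)
  have hT_apply (φ : StrongDual ℝ X) (g : familySpace μ hq) : T φ g = φ (Q g) / K :=
    (div_eq_inv_mul _ _).symm
  have hT_le (n : ℕ) (g : familySpace μ hq) : T (φ n) g ≤ familyNorm μ hq g := by
    have hg : 0 ≤ familyNorm μ hq g := apply_nonneg _ g
    rw [hT_apply, div_le_iff₀ hK]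
    calc φ n (Q g) ≤ ‖φ n‖ * ‖Q g‖ := (le_abs_self _).trans ((φ n).le_opNorm _)
      _ ≤ K₀ * (C * familyNorm μ hq g) :=
        mul_le_mul (hK₀ n) (hQ g) (norm_nonneg _) hK₀_nonneg
      _ ≤ familyNorm μ hq g * K := by linear_combination hg
  obtain ⟨_, hθ, hθ_le⟩ := exists_mem_convexHull_le_familyNorm hq₁ hq₂ hT_le
    (fun g => by simpa [hT_apply] using (hφ (Q g)).div_const K) (show 0 < ε / K by positivity)
  rw [show (range fun n => T (φ n)) = T '' range φ from range_comp T φ,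
    ← LinearMap.image_convexHull] at hθ
  obtain ⟨θ, hθ, rfl⟩ := hθ
  refine ⟨θ, hθ, fun x hx => ?_⟩
  obtain ⟨g, hg, rfl⟩ := hQ_lift x hx
  have hθg := hθ_le g
  rw [hT_apply, div_le_iff₀ hK, mul_right_comm, div_mul_cancel₀ _ hK.ne'] at hθg
  exact hθg.trans (mul_le_of_le_one_right hε.le hg)

theorem tendsto_toWeakSpace_of_family_quotient (hq₁ : 1 < q) (hq₂ : q ≤ 2) {X : Type*}
    [NormedAddCommGroup X] [NormedSpace ℝ X] [CompleteSpace X] (Q : familySpace μ hq →ₗ[ℝ] X)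
    {C : ℝ} (hC : 0 ≤ C) (hQ : ∀ g, ‖Q g‖ ≤ C * familyNorm μ hq g)
    (hQ_lift : ∀ x : X, ‖x‖ ≤ 1 → ∃ g, familyNorm μ hq g ≤ 1 ∧ Q g = x)
    {φ : ℕ → StrongDual ℝ X} {φ₀ : StrongDual ℝ X}
    (hφ : Tendsto (fun n => StrongDual.toWeakDual (φ n)) atTop (𝓝 (StrongDual.toWeakDual φ₀))) :
    Tendsto (fun n => toWeakSpace ℝ (StrongDual ℝ X) (φ n)) atTop
      (𝓝 (toWeakSpace ℝ (StrongDual ℝ X) φ₀)) := by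
  refine tendsto_toWeakSpace_of_forall_exists_mem_convexHull (fun φ hφ ε hε => ?_) hφ
  obtain ⟨K₀, hK₀⟩ := banach_steinhaus (g := φ) fun x => by
    obtain ⟨c, hc⟩ := (hφ x).norm.bddAbove_range
    exact ⟨c, fun n => hc ⟨n, rfl⟩⟩
  obtain ⟨θ, hθ, hθ_le⟩ :=
    exists_mem_convexHull_apply_le_of_family_quotient hq₁ hq₂ Q hC hQ hQ_lift hK₀ hφ hε
  refine ⟨θ, hθ, ContinuousLinearMap.opNorm_le_of_unit_norm hε.le fun x hx => abs_le'.2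
    ⟨hθ_le x hx.le, ?_⟩⟩
  rw [← map_neg]
  exact hθ_le (-x) (by rw [norm_neg, hx])

end Gauge

/-! ### Marcinkiewicz spaces are complete -/

section Rearrangement

variable {α κ : Type*} [MeasurableSpace α] {μ : Measure α}

theorem ofReal_abs_sub (a : ℝ) {s : ℝ} (hs : 0 ≤ s) :
    ENNReal.ofReal (|a| - s) = ‖a‖ₑ - ENNReal.ofReal s := by
  rw [Real.enorm_eq_ofReal_abs, ENNReal.ofReal_sub _ hs]

theorem lintegral_rearrangement_eq_mul_add {f : α → ℝ} (hf : AEMeasurable f μ) {t : ℝ}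
    (h : rearrangement μ f t ≠ ∞) :
    ∫⁻ u in Ioo 0 t, rearrangement μ f u = ENNReal.ofReal t * rearrangement μ f t
      + ∫⁻ x, (‖f x‖ₑ - rearrangement μ f t) ∂μ := by
  rw [lintegral_rearrangement_eq hf t h]
  simp only [ofReal_abs_sub _ ENNReal.toReal_nonneg, ENNReal.ofReal_toReal h]

theorem lintegral_rearrangement_le_mul_add {f : α → ℝ} (hf : AEMeasurable f μ) {s : ℝ≥0∞}
    (hs : s ≠ ∞) (t : ℝ) :
    ∫⁻ u in Ioo 0 t, rearrangement μ f u ≤ ENNReal.ofReal t * s + ∫⁻ x, (‖f x‖ₑ - s) ∂μ := by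
  have h := lintegral_rearrangement_le hf t (ENNReal.toReal_nonneg (a := s))
  simpa only [ofReal_abs_sub _ ENNReal.toReal_nonneg, ENNReal.ofReal_toReal hs] using h

theorem setLIntegral_enorm_le_lintegral_rearrangement {f : α → ℝ} (hf : AEMeasurable f μ)
    {S : Set α} {t : ℝ} (ht : 0 < t) (hS : μ S ≤ ENNReal.ofReal t) :
    ∫⁻ x in S, ‖f x‖ₑ ∂μ ≤ ∫⁻ u in Ioo 0 t, rearrangement μ f u := by
  by_cases h : rearrangement μ f t = ∞
  · exact (lintegral_rearrangement_eq_top ht h).symm ▸ le_top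
  rw [lintegral_rearrangement_eq_mul_add hf h]
  set s := rearrangement μ f t
  calc ∫⁻ x in S, ‖f x‖ₑ ∂μ ≤ ∫⁻ x in S, (s + (‖f x‖ₑ - s)) ∂μ :=
        lintegral_mono fun x => le_add_tsub
    _ = μ S * s + ∫⁻ x in S, (‖f x‖ₑ - s) ∂μ := by
        rw [lintegral_add_left measurable_const, setLIntegral_const, mul_comm]
    _ ≤ _ := add_le_add (mul_le_mul_left hS _) (setLIntegral_le_lintegral _ _)

theorem tsum_le_tsum_add_tsum_sub (a b : κ → ℝ≥0∞) :
    ∑' k, a k ≤ ∑' k, b k + ∑' k, (a k - b k) := by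
  rw [← ENNReal.tsum_add]
  exact ENNReal.tsum_le_tsum fun _ => le_add_tsub

variable [Countable κ]

theorem tsum_lintegral_rearrangement_eq {f : κ → α → ℝ} (hf : ∀ k, AEMeasurable (f k) μ) {t : ℝ}
    (h : ∀ k, rearrangement μ (f k) t ≠ ∞) :
    ∑' k, ∫⁻ u in Ioo 0 t, rearrangement μ (f k) u
      = ENNReal.ofReal t * ∑' k, rearrangement μ (f k) t
        + ∫⁻ x, ∑' k, (‖f k x‖ₑ - rearrangement μ (f k) t) ∂μ := by
  rw [lintegral_tsum fun k => (hf k).enorm.sub_const _, ← ENNReal.tsum_mul_left, ← ENNReal.tsum_add]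
  exact tsum_congr fun k => lintegral_rearrangement_eq_mul_add (hf k) (h k)

theorem tsum_rearrangement_ne_top {f : κ → α → ℝ} (hf : ∀ k, AEMeasurable (f k) μ) {t : ℝ}
    (ht : 0 < t) (h : ∑' k, ∫⁻ u in Ioo 0 t, rearrangement μ (f k) u ≠ ∞) :
    ∑' k, rearrangement μ (f k) t ≠ ∞ ∧
      ∫⁻ x, ∑' k, (‖f k x‖ₑ - rearrangement μ (f k) t) ∂μ ≠ ∞ := by
  rw [tsum_lintegral_rearrangement_eq hf fun k hk =>
    ENNReal.ne_top_of_tsum_ne_top h k (lintegral_rearrangement_eq_top ht hk)] at h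
  obtain ⟨h_mul, h_int⟩ := ENNReal.add_ne_top.1 h
  exact ⟨fun h_top => h_mul (by rw [h_top, ENNReal.mul_top (by simpa using ht)]), h_int⟩

theorem lintegral_rearrangement_le_tsum {f : κ → α → ℝ} {h : α → ℝ}
    (hf : ∀ k, AEMeasurable (f k) μ) (hh : AEMeasurable h μ) {t : ℝ} (ht : 0 < t)
    (hle : ∀ᵐ x ∂μ, ‖h x‖ₑ ≤ ∑' k, ‖f k x‖ₑ) :
    ∫⁻ u in Ioo 0 t, rearrangement μ h u ≤ ∑' k, ∫⁻ u in Ioo 0 t, rearrangement μ (f k) u := by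
  by_cases h_top : ∑' k, ∫⁻ u in Ioo 0 t, rearrangement μ (f k) u = ∞
  · exact h_top.symm ▸ le_top
  have h_sum := (tsum_rearrangement_ne_top hf ht h_top).1
  rw [tsum_lintegral_rearrangement_eq hf (ENNReal.ne_top_of_tsum_ne_top h_sum)]
  refine (lintegral_rearrangement_le_mul_add hh h_sum t).trans
    (add_le_add_right (lintegral_mono_ae ?_) _)
  filter_upwards [hle] with x hx
  exact tsub_le_iff_left.2 (hx.trans (tsum_le_tsum_add_tsum_sub _ _))

theorem ae_tsum_enorm_lt_top {f : κ → α → ℝ} (hf : ∀ k, AEMeasurable (f k) μ) {t : ℝ}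
    (ht : 0 < t) (h : ∑' k, ∫⁻ u in Ioo 0 t, rearrangement μ (f k) u ≠ ∞) :
    ∀ᵐ x ∂μ, ∑' k, ‖f k x‖ₑ < ∞ := by
  obtain ⟨h_sum, h_int⟩ := tsum_rearrangement_ne_top hf ht h
  filter_upwards [ae_lt_top' (AEMeasurable.tsum fun k => (hf k).enorm.sub_const _) h_int] with x hx
  exact (tsum_le_tsum_add_tsum_sub _ _).trans_lt (ENNReal.add_lt_top.2 ⟨h_sum.lt_top, hx⟩)

theorem aestronglyMeasurable_tsum_of_summable {f : κ → α → ℝ} (hf : ∀ k, AEMeasurable (f k) μ)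
    (h : ∀ᵐ x ∂μ, Summable fun k => f k x) : AEStronglyMeasurable (fun x => ∑' k, f k x) μ :=
  aestronglyMeasurable_of_tendsto_ae (atTop : Filter (Finset κ))
    (fun s => Finset.aestronglyMeasurable_fun_sum s fun k _ => (hf k).aestronglyMeasurable)
    (h.mono fun _ hx => hx.hasSum)

end Rearrangement

section Marcinkiewicz

variable {ψ : ℝ → ℝ} {γ : ℝ≥0∞}

theorem marcinkiewiczENorm_le_iff (hpos : ∀ t ∈ intervalIoo γ, 0 < ψ t) {f : LZero γ} {c : ℝ≥0∞} :
    marcinkiewiczENorm ψ γ f ≤ c ↔ ∀ t ∈ intervalIoo γ,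
      ∫⁻ s in Ioo 0 t, rearrangement (volume.restrict (intervalIoo γ)) f s
        ≤ c * ENNReal.ofReal (ψ t) := by
  rw [marcinkiewiczENorm, iSup₂_le_iff]
  refine forall₂_congr fun t ht => ?_
  rw [ENNReal.div_le_iff (by simpa using hpos t ht) ENNReal.ofReal_ne_top]

theorem mem_marcinkiewiczSpace (hpos : ∀ t ∈ intervalIoo γ, 0 < ψ t)
    {f : LZero γ} {c : ℝ} (hc : 0 ≤ c) (h : ∀ t ∈ intervalIoo γ,
      ∫⁻ s in Ioo 0 t, rearrangement (volume.restrict (intervalIoo γ)) f s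
        ≤ ENNReal.ofReal (c * ψ t)) : f ∈ marcinkiewiczSpace ψ γ := by
  refine lt_of_le_of_lt (b := ENNReal.ofReal c) ((marcinkiewiczENorm_le_iff hpos).2 fun t ht => ?_)
    ENNReal.ofReal_lt_top
  rw [← ENNReal.ofReal_mul hc]
  exact h t ht

theorem intervalIoo_nonempty (hγ : 0 < γ) : (intervalIoo γ).Nonempty := by
  obtain ⟨r, hr0, hr⟩ := ENNReal.lt_iff_exists_nnreal_btwn.1 hγ
  exact ⟨r, by simpa using hr0, by simpa using hr⟩

namespace marcinkiewiczSpace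

theorem norm_le_iff (hpos : ∀ t ∈ intervalIoo γ, 0 < ψ t)
    {f : marcinkiewiczSpace ψ γ} {c : ℝ} (hc : 0 ≤ c) :
    ‖f‖ ≤ c ↔ ∀ t ∈ intervalIoo γ,
      ∫⁻ s in Ioo 0 t, rearrangement (volume.restrict (intervalIoo γ)) f.1 s
        ≤ ENNReal.ofReal (c * ψ t) := by
  have : ‖f‖ ≤ c ↔ marcinkiewiczENorm ψ γ f.1 ≤ ENNReal.ofReal c :=
    (ENNReal.le_ofReal_iff_toReal_le (ne_of_lt f.2) hc).symm
  rw [this, marcinkiewiczENorm_le_iff hpos]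
  simp only [ENNReal.ofReal_mul hc]

theorem lintegral_rearrangement_le (hpos : ∀ t ∈ intervalIoo γ, 0 < ψ t)
    (f : marcinkiewiczSpace ψ γ) {t : ℝ} (ht : t ∈ intervalIoo γ) :
    ∫⁻ s in Ioo 0 t, rearrangement (volume.restrict (intervalIoo γ)) f.1 s
      ≤ ENNReal.ofReal (‖f‖ * ψ t) :=
  (norm_le_iff hpos (norm_nonneg f)).1 le_rfl t ht

theorem tsum_lintegral_rearrangement_le (hpos : ∀ t ∈ intervalIoo γ, 0 < ψ t)
    {u : ℕ → marcinkiewiczSpace ψ γ} (hu : Summable fun k => ‖u k‖) {t : ℝ}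
    (ht : t ∈ intervalIoo γ) :
    ∑' k, ∫⁻ s in Ioo 0 t, rearrangement (volume.restrict (intervalIoo γ)) (u k).1 s
      ≤ ENNReal.ofReal ((∑' k, ‖u k‖) * ψ t) := by
  rw [← tsum_mul_right, ENNReal.ofReal_tsum_of_nonneg
    (fun _ => mul_nonneg (norm_nonneg _) (hpos t ht).le) (hu.mul_right _)]
  exact ENNReal.tsum_le_tsum fun k => lintegral_rearrangement_le hpos (u k) ht

theorem exists_hasSum (hγ : 0 < γ) (hpos : ∀ t ∈ intervalIoo γ, 0 < ψ t) {κ : Type*} [Countable κ]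
    {f : κ → ℝ → ℝ} (hf : ∀ k, AEMeasurable (f k) (volume.restrict (intervalIoo γ))) {c : ℝ}
    (hc : 0 ≤ c) (h : ∀ t ∈ intervalIoo γ,
      ∑' k, ∫⁻ s in Ioo 0 t, rearrangement (volume.restrict (intervalIoo γ)) (f k) s
        ≤ ENNReal.ofReal (c * ψ t)) :
    ∃ F : marcinkiewiczSpace ψ γ, ‖F‖ ≤ c ∧
      ∀ᵐ x ∂volume.restrict (intervalIoo γ), HasSum (fun k => f k x) (F.1 x) := by
  obtain ⟨t₀, ht₀⟩ := intervalIoo_nonempty hγ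
  have h_summable : ∀ᵐ x ∂volume.restrict (intervalIoo γ), Summable fun k => f k x := by
    filter_upwards [ae_tsum_enorm_lt_top hf ht₀.1
      ((h t₀ ht₀).trans_lt ENNReal.ofReal_lt_top).ne] with x hx
    exact .of_norm (by simpa using ENNReal.summable_toReal hx.ne)
  have h_meas := aestronglyMeasurable_tsum_of_summable hf h_summable
  have h_le (t : ℝ) (ht : t ∈ intervalIoo γ) := by
    refine (lintegral_rearrangement_le_tsum hf h_meas.aemeasurable ht.1 ?_).trans (h t ht)
    exact .of_forall fun x => enorm_tsum_le_tsum_enorm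
  simp only [← rearrangement_congr (AEEqFun.coeFn_mk _ h_meas)] at h_le
  refine ⟨⟨AEEqFun.mk _ h_meas, mem_marcinkiewiczSpace hpos hc h_le⟩,
    (norm_le_iff hpos hc).2 h_le, ?_⟩
  filter_upwards [h_summable, AEEqFun.coeFn_mk _ h_meas] with x hx hx_mk
  exact hx_mk ▸ hx.hasSum

theorem norm_sub_sum_le (hpos : ∀ t ∈ intervalIoo γ, 0 < ψ t) {u : ℕ → marcinkiewiczSpace ψ γ}
    (hu : Summable fun k => ‖u k‖) {F : marcinkiewiczSpace ψ γ}
    (hF : ∀ᵐ x ∂volume.restrict (intervalIoo γ), HasSum (fun k => (u k).1 x) (F.1 x)) (n : ℕ) :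
    ‖F - ∑ k ∈ Finset.range n, u k‖ ≤ ∑' k, ‖u (k + n)‖ := by
  refine (norm_le_iff hpos (tsum_nonneg fun _ => norm_nonneg _)).2 fun t ht => ?_
  refine le_trans (lintegral_rearrangement_le_tsum (f := fun k => (u (k + n)).1)
    (fun k => (u (k + n)).1.aemeasurable) (AEEqFun.aemeasurable _) ht.1 ?_)
    (tsum_lintegral_rearrangement_le hpos ((summable_nat_add_iff n).2 hu) ht)
  filter_upwards [hF, AEEqFun.coeFn_sub F.1 (∑ k ∈ Finset.range n, u k : marcinkiewiczSpace ψ γ).1,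
    AEEqFun.coeFn_finsetSum (Finset.range n) fun k => (u k).1] with x hx hx_sub hx_sum
  rw [AddSubgroupClass.coe_sub, hx_sub, Pi.sub_apply, AddSubmonoidClass.coe_finsetSum, hx_sum,
    Finset.sum_apply, ← hx.tsum_eq, ← hx.summable.sum_add_tsum_nat_add n, add_sub_cancel_left]
  exact enorm_tsum_le_tsum_enorm

theorem completeSpace (hγ : 0 < γ) (hpos : ∀ t ∈ intervalIoo γ, 0 < ψ t) :
    CompleteSpace (marcinkiewiczSpace ψ γ) := by
  refine NormedAddCommGroup.completeSpace_of_summable_imp_tendsto fun u hu => ?_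
  obtain ⟨F, -, hF⟩ := exists_hasSum hγ hpos (fun k => (u k).1.aemeasurable)
    (tsum_nonneg fun _ => norm_nonneg _) fun t => tsum_lintegral_rearrangement_le hpos hu
  refine ⟨F, tendsto_iff_norm_sub_tendsto_zero.2 ?_⟩
  refine squeeze_zero (fun _ => norm_nonneg _) (fun n => ?_) (tendsto_sum_nat_add fun k => ‖u k‖)
  rw [norm_sub_rev]
  exact norm_sub_sum_le hpos hu hF n

end marcinkiewiczSpace

end Marcinkiewicz

/-! ### Concave weights and their decay at the origin -/

theorem sub_mul_add_sub_mul_le_of_concaveOn {s : Set ℝ} {f : ℝ → ℝ} (hf : ConcaveOn ℝ s f)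
    {x y z : ℝ} (hx : x ∈ s) (hz : z ∈ s) (hxy : x ≤ y) (hyz : y ≤ z) :
    (z - y) * f x + (y - x) * f z ≤ (z - x) * f y := by
  rcases (hxy.trans hyz).eq_or_lt with rfl | hxz
  · simp [le_antisymm hxy hyz]
  have hxz' : 0 < z - x := sub_pos.2 hxz
  have h := hf.2 hx hz (div_nonneg (sub_nonneg.2 hyz) hxz'.le)
    (div_nonneg (sub_nonneg.2 hxy) hxz'.le) (by field_simp; ring)
  have hy : ((z - y) / (z - x)) • x + ((y - x) / (z - x)) • z = y := by
    simp only [smul_eq_mul]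
    field_simp
    ring
  rw [hy, smul_eq_mul, smul_eq_mul, div_mul_eq_mul_div, div_mul_eq_mul_div, ← add_div,
    div_le_iff₀ hxz'] at h
  linarith

section IntervalIoo

variable {γ : ℝ≥0∞} {s t : ℝ}

theorem mem_intervalIoo_of_le (ht : t ∈ intervalIoo γ) (hs : 0 < s) (hst : s ≤ t) :
    s ∈ intervalIoo γ :=
  ⟨hs, (ENNReal.ofReal_le_ofReal hst).trans_lt ht.2⟩

theorem div_two_pow_mem_intervalIoo (ht : t ∈ intervalIoo γ) (j : ℕ) :
    t / 2 ^ j ∈ intervalIoo γ :=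
  mem_intervalIoo_of_le ht (div_pos ht.1 (by positivity))
    (div_le_self ht.1.le (one_le_pow₀ one_le_two))

theorem intervalIoo_subset_intervalIco : intervalIoo γ ⊆ intervalIco γ :=
  fun _ ht => ⟨ht.1.le, ht.2⟩

theorem zero_mem_intervalIco (ht : t ∈ intervalIoo γ) : (0 : ℝ) ∈ intervalIco γ :=
  ⟨le_rfl, by simpa using pos_of_gt ht.2⟩

end IntervalIoo

/-- A concave weight: a non-decreasing concave function on `[0, γ)` that vanishes at `0` and is
positive on `(0, γ)`. These are the fundamental functions for which Marcinkiewicz spaces are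
considered. -/
structure IsConcaveWeight (ψ : ℝ → ℝ) (γ : ℝ≥0∞) : Prop where
  pos : ∀ t ∈ intervalIoo γ, 0 < ψ t
  mono : MonotoneOn ψ (intervalIco γ)
  concave : ConcaveOn ℝ (intervalIco γ) ψ
  zero : ψ 0 = 0

theorem mul_le_mul_of_concaveOn_intervalIco {ψ : ℝ → ℝ} {γ : ℝ≥0∞}
    (hψ : ConcaveOn ℝ (intervalIco γ) ψ) (hψ_zero : ψ 0 = 0) {s t : ℝ} (ht : t ∈ intervalIoo γ)
    (hs : 0 ≤ s) (hst : s ≤ t) : s * ψ t ≤ t * ψ s := by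
  simpa [hψ_zero] using sub_mul_add_sub_mul_le_of_concaveOn hψ (zero_mem_intervalIco ht)
    (intervalIoo_subset_intervalIco ht) hs hst

namespace IsConcaveWeight

variable {ψ : ℝ → ℝ} {γ : ℝ≥0∞}

theorem of_ne_zero (hψ_nonneg : ∀ t ∈ intervalIco γ, 0 ≤ ψ t)
    (hψ_ne : ∃ t ∈ intervalIco γ, ψ t ≠ 0) (hψ_mono : MonotoneOn ψ (intervalIco γ))
    (hψ_concave : ConcaveOn ℝ (intervalIco γ) ψ) (hψ_zero : ψ 0 = 0) : IsConcaveWeight ψ γ := by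
  refine ⟨fun t ht => ?_, hψ_mono, hψ_concave, hψ_zero⟩
  obtain ⟨s, hs, hs_ne⟩ := hψ_ne
  have hψs : 0 < ψ s := (hψ_nonneg s hs).lt_of_ne' hs_ne
  have hs₀ : 0 < s := hs.1.lt_of_ne fun h => hs_ne (h ▸ hψ_zero)
  rcases le_total s t with hst | hts
  · exact hψs.trans_le (hψ_mono hs (intervalIoo_subset_intervalIco ht) hst)
  · exact pos_of_mul_pos_right ((mul_pos ht.1 hψs).trans_le
      (mul_le_mul_of_concaveOn_intervalIco hψ_concave hψ_zero ⟨hs₀, hs.2⟩ ht.1.le hts)) hs₀.le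

theorem le (W : IsConcaveWeight ψ γ) {s t : ℝ} (ht : t ∈ intervalIoo γ) (hs : 0 < s)
    (hst : s ≤ t) : ψ s ≤ ψ t :=
  W.mono (intervalIoo_subset_intervalIco (mem_intervalIoo_of_le ht hs hst))
    (intervalIoo_subset_intervalIco ht) hst

theorem mul_le_mul (W : IsConcaveWeight ψ γ) {s t : ℝ} (ht : t ∈ intervalIoo γ) (hs : 0 ≤ s)
    (hst : s ≤ t) : s * ψ t ≤ t * ψ s :=
  mul_le_mul_of_concaveOn_intervalIco W.concave W.zero ht hs hst

theorem div_le_div (W : IsConcaveWeight ψ γ) {s t : ℝ} (ht : t ∈ intervalIoo γ) (hs : 0 < s)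
    (hst : s ≤ t) : ψ t / t ≤ ψ s / s := by
  rw [div_le_div_iff₀ ht.1 hs]
  linarith [W.mul_le_mul ht hs.le hst]

theorem sub_mul_add_sub_mul_le (W : IsConcaveWeight ψ γ) {x y z : ℝ} (hx : 0 < x) (hxy : x ≤ y)
    (hyz : y ≤ z) (hz : z ∈ intervalIoo γ) : (z - y) * ψ x + (y - x) * ψ z ≤ (z - x) * ψ y :=
  sub_mul_add_sub_mul_le_of_concaveOn W.concave
    (intervalIoo_subset_intervalIco (mem_intervalIoo_of_le hz hx (hxy.trans hyz)))
    (intervalIoo_subset_intervalIco hz) hxy hyz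

theorem sub_le_mul_sub (W : IsConcaveWeight ψ γ) {t c : ℝ} (ht : 0 < t) (hc : 2 ≤ c)
    (hct : c * t ∈ intervalIoo γ) : ψ (c * t) - ψ t ≤ (c - 1) * (ψ (2 * t) - ψ t) := by
  have h := W.sub_mul_add_sub_mul_le (y := 2 * t) ht (by linarith) (by gcongr) hct
  refine le_of_mul_le_mul_left ?_ ht
  linarith

theorem mul_sub_le_mul_sub (W : IsConcaveWeight ψ γ) {t b : ℝ} (ht : 0 < t) (htb : t ≤ b)
    (hb : 2 * b ∈ intervalIoo γ) : t * (ψ (2 * b) - ψ b) ≤ b * (ψ (2 * t) - ψ t) := by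
  have hb₀ : 0 < b := ht.trans_le htb
  have h_two_mul := mul_le_mul_of_nonneg_left
    (W.sub_mul_add_sub_mul_le (y := 2 * t) ht (by linarith) (by linarith) hb) hb₀.le
  have h_mid := mul_le_mul_of_nonneg_left
    (W.sub_mul_add_sub_mul_le (y := b) ht htb (by linarith) hb) ht.le
  refine le_of_mul_le_mul_left (a := 2 * b - t) ?_ (by linarith)
  linarith

theorem exists_doubling_on_Icc (W : IsConcaveWeight ψ γ) {a b : ℝ} (ha : 0 < a)
    (hb : 2 * b ∈ intervalIoo γ) (hψb : ψ b < ψ (2 * b)) :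
    ∃ r > 1, ∀ t ∈ Icc a b, r * ψ t ≤ ψ (2 * t) := by
  have hb₀ : 0 < b := by linarith [hb.1]
  have hb_mem : b ∈ intervalIoo γ := mem_intervalIoo_of_le hb hb₀ (by linarith)
  have hψb₀ : 0 < ψ b := W.pos b hb_mem
  have : 0 < ψ (2 * b) - ψ b := sub_pos.2 hψb
  refine ⟨1 + a * (ψ (2 * b) - ψ b) / (b * ψ b),
    lt_add_of_pos_right _ (by positivity), fun t ht => ?_⟩
  have ht₀ : 0 < t := ha.trans_le ht.1
  have : 0 ≤ ψ (2 * t) - ψ t := sub_nonneg.2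
    (W.le (mem_intervalIoo_of_le hb (by linarith) (by linarith [ht.2])) ht₀ (by linarith))
  have h_le : a * (ψ (2 * b) - ψ b) / (b * ψ b) * ψ t ≤ ψ (2 * t) - ψ t := by
    rw [div_mul_eq_mul_div, div_le_iff₀ (by positivity)]
    calc a * (ψ (2 * b) - ψ b) * ψ t
        ≤ t * (ψ (2 * b) - ψ b) * ψ b := by
          gcongr
          exacts [(W.pos t (mem_intervalIoo_of_le hb_mem ht₀ ht.2)).le, ht.1,
            W.le hb_mem ht₀ ht.2]
      _ ≤ b * (ψ (2 * t) - ψ t) * ψ b := by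
          gcongr ?_ * ψ b
          exact W.mul_sub_le_mul_sub ht₀ ht.2 hb
      _ = (ψ (2 * t) - ψ t) * (b * ψ b) := by ring
  linarith

end IsConcaveWeight

theorem exists_real_of_one_lt_liminf {F : Filter ℝ} {u : ℝ → ℝ}
    (h : 1 < liminf (fun t => ((u t : ℝ) : EReal)) F) : ∃ r > (1 : ℝ), ∀ᶠ t in F, r < u t := by
  obtain ⟨r, hr₁, hr⟩ := EReal.lt_iff_exists_real_btwn.1 h
  exact ⟨r, by exact_mod_cast hr₁,
    (eventually_lt_of_lt_liminf hr).mono fun t ht => by exact_mod_cast ht⟩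

namespace IsConcaveWeight

variable {ψ : ℝ → ℝ} {γ : ℝ≥0∞}

theorem exists_doubling_near_zero (W : IsConcaveWeight ψ γ)
    (h : 1 < liminf (fun t => ((ψ (2 * t) / ψ t : ℝ) : EReal)) (𝓝[>] 0)) :
    ∃ r > 1, ∃ a > 0, ∀ t ∈ intervalIoo γ, t < a → r * ψ t ≤ ψ (2 * t) := by
  obtain ⟨r, hr, h⟩ := exists_real_of_one_lt_liminf h
  obtain ⟨a, ha, h⟩ := mem_nhdsGT_iff_exists_Ioo_subset.1 h
  exact ⟨r, hr, a, ha, fun t ht hta => ((lt_div_iff₀ (W.pos t ht)).1 (h ⟨ht.1, hta⟩)).le⟩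

theorem exists_doubling_near_top (W : IsConcaveWeight ψ ∞)
    (h : 1 < liminf (fun t => ((ψ (2 * t) / ψ t : ℝ) : EReal)) atTop) :
    ∃ r > 1, ∃ b > 0, ∀ t ≥ b, r * ψ t ≤ ψ (2 * t) := by
  obtain ⟨r, hr, h⟩ := exists_real_of_one_lt_liminf h
  obtain ⟨b, h⟩ := eventually_atTop.1 h
  refine ⟨r, hr, max b 1, by positivity, fun t ht => ?_⟩
  have ht₀ : 0 < t := one_pos.trans_le ((le_max_right _ _).trans ht)
  exact ((lt_div_iff₀ (W.pos t ⟨ht₀, ENNReal.ofReal_lt_top⟩)).1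
    (h t ((le_max_left _ _).trans ht))).le

theorem exists_doubling (W : IsConcaveWeight ψ ∞) (h : ConditionA ψ ∞) :
    ∃ r > 1, ∀ t > 0, r * ψ t ≤ ψ (2 * t) := by
  have h_mem {t : ℝ} (ht : 0 < t) : t ∈ intervalIoo ∞ := ⟨ht, ENNReal.ofReal_lt_top⟩
  obtain ⟨r₀, hr₀, a, ha, h_zero⟩ := W.exists_doubling_near_zero h.2.1
  obtain ⟨r₁, hr₁, b, hb, h_top⟩ := W.exists_doubling_near_top h.2.2
  obtain ⟨r₂, hr₂, h_mid⟩ := W.exists_doubling_on_Icc (b := b) ha (h_mem (by positivity)) <|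
    (lt_mul_of_one_lt_left (W.pos b (h_mem hb)) hr₁).trans_le (h_top b le_rfl)
  refine ⟨min r₀ (min r₁ r₂), lt_min hr₀ (lt_min hr₁ hr₂), fun t ht => ?_⟩
  suffices ∃ r ≥ min r₀ (min r₁ r₂), r * ψ t ≤ ψ (2 * t) by
    obtain ⟨r, hr, hrt⟩ := this
    exact (mul_le_mul_of_nonneg_right hr (W.pos t (h_mem ht)).le).trans hrt
  rcases lt_or_ge t a with hta | hat
  · exact ⟨r₀, min_le_left _ _, h_zero t (h_mem ht) hta⟩
  rcases le_total b t with hbt | htb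
  · exact ⟨r₁, (min_le_right _ _).trans (min_le_left _ _), h_top t hbt⟩
  · exact ⟨r₂, (min_le_right _ _).trans (min_le_right _ _), h_mid t ⟨hat, htb⟩⟩

theorem pow_mul_le_of_doubling (W : IsConcaveWeight ψ γ) {r : ℝ} (hr : 1 < r) {n₀ : ℕ} {t : ℝ}
    (ht : t ∈ intervalIoo γ) (h : ∀ j ≥ n₀, r * ψ (t / 2 ^ (j + 1)) ≤ ψ (t / 2 ^ j)) (j : ℕ) :
    r ^ j * ψ (t / 2 ^ j) ≤ r ^ n₀ * ψ t := by
  have h_le {j : ℕ} (hj : j ≤ n₀) : r ^ j * ψ (t / 2 ^ j) ≤ r ^ n₀ * ψ t :=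
    _root_.mul_le_mul (pow_le_pow_right₀ hr.le hj)
      (W.le ht (div_two_pow_mem_intervalIoo ht j).1
        (div_le_self ht.1.le (one_le_pow₀ one_le_two)))
      (W.pos _ (div_two_pow_mem_intervalIoo ht j)).le (by positivity)
  induction j with
  | zero => exact h_le (Nat.zero_le _)
  | succ j ih =>
    rcases Nat.lt_or_ge j n₀ with hj | hj
    · exact h_le hj
    · calc r ^ (j + 1) * ψ (t / 2 ^ (j + 1)) = r ^ j * (r * ψ (t / 2 ^ (j + 1))) := by ring
        _ ≤ r ^ j * ψ (t / 2 ^ j) := by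
            gcongr
            exact h j hj
        _ ≤ _ := ih

theorem exists_decay (W : IsConcaveWeight ψ γ) (h : ConditionA ψ γ ∨ ConditionB ψ γ) :
    ∃ C > 0, ∃ κ > 1, ∀ t ∈ intervalIoo γ, ∀ j : ℕ, κ ^ j * ψ (t / 2 ^ j) ≤ C * ψ t := by
  suffices ∃ r > 1, ∃ n₀ : ℕ, ∀ t ∈ intervalIoo γ, ∀ j ≥ n₀,
      r * ψ (t / 2 ^ (j + 1)) ≤ ψ (2 * (t / 2 ^ (j + 1))) by
    obtain ⟨r, hr, n₀, h⟩ := this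
    refine ⟨r ^ n₀, by positivity, r, hr, fun t ht => W.pow_mul_le_of_doubling hr ht fun j hj => ?_⟩
    rw [show t / 2 ^ j = 2 * (t / 2 ^ (j + 1)) by rw [pow_succ]; field_simp]
    exact h t ht j hj
  rcases h with hA | ⟨hγ, h⟩
  · obtain rfl := hA.1
    obtain ⟨r, hr, h⟩ := W.exists_doubling hA
    exact ⟨r, hr, 0, fun t ht j _ => h _ (div_two_pow_mem_intervalIoo ht _).1⟩
  · obtain ⟨r, hr, a, ha, h⟩ := W.exists_doubling_near_zero h
    obtain ⟨n₀, hn₀⟩ := pow_unbounded_of_one_lt (γ.toReal / a) one_lt_two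
    refine ⟨r, hr, n₀, fun t ht j hj => h _ (div_two_pow_mem_intervalIoo ht _) ?_⟩
    rw [div_lt_iff₀ ha] at hn₀
    rw [div_lt_iff₀' (by positivity)]
    calc t < γ.toReal := (ENNReal.ofReal_lt_iff_lt_toReal ht.1.le hγ.ne).1 ht.2
      _ ≤ 2 ^ n₀ * a := hn₀.le
      _ ≤ 2 ^ (j + 1) * a := by
          gcongr
          exacts [one_le_two, by omega]

end IsConcaveWeight

/-! ### Marcinkiewicz spaces as quotients -/

section LinearMap

variable {ψ : ℝ → ℝ} {γ : ℝ≥0∞}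

theorem marcinkiewiczSpace.exists_linearMap_hasSum (hγ : 0 < γ)
    (hpos : ∀ t ∈ intervalIoo γ, 0 < ψ t) {κ V : Type*} [Countable κ] [AddCommGroup V] [Module ℝ V]
    (T : κ → V →ₗ[ℝ] ℝ → ℝ) (hT : ∀ k v, AEMeasurable (T k v) (volume.restrict (intervalIoo γ)))
    {N : V → ℝ} (hN : ∀ v, 0 ≤ N v) (h : ∀ v, ∀ t ∈ intervalIoo γ,
      ∑' k, ∫⁻ s in Ioo 0 t, rearrangement (volume.restrict (intervalIoo γ)) (T k v) s
        ≤ ENNReal.ofReal (N v * ψ t)) :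
    ∃ Q : V →ₗ[ℝ] marcinkiewiczSpace ψ γ, (∀ v, ‖Q v‖ ≤ N v) ∧ ∀ v,
      ∀ᵐ x ∂volume.restrict (intervalIoo γ), HasSum (fun k => T k v x) ((Q v).1 x) := by
  choose Q hQ_norm hQ_sum using fun v =>
    marcinkiewiczSpace.exists_hasSum hγ hpos (fun k => hT k v) (hN v) (h v)
  refine ⟨⟨⟨Q, fun v w => Subtype.ext (AEEqFun.ext ?_)⟩,
    fun c v => Subtype.ext (AEEqFun.ext ?_)⟩, hQ_norm, hQ_sum⟩
  · filter_upwards [hQ_sum v, hQ_sum w, hQ_sum (v + w),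
      AEEqFun.coeFn_add (Q v).1 (Q w).1] with x hv hw hvw hx
    rw [Submodule.coe_add, hx]
    exact hvw.unique (by simpa using hv.add hw)
  · filter_upwards [hQ_sum v, hQ_sum (c • v), AEEqFun.coeFn_smul c (Q v).1] with x hv hcv hx
    refine (hcv.unique ?_).trans hx.symm
    simpa using hv.mul_left c

end LinearMap

section Levels

variable {ψ : ℝ → ℝ} {γ : ℝ≥0∞} {k : ℤ}

/-- The largest possible measure of the level set `{2 ^ k < |f|}` of a function `f` in the unit ball
of the Marcinkiewicz space. -/
noncomputable def levelMeasure (ψ : ℝ → ℝ) (γ : ℝ≥0∞) (k : ℤ) : ℝ≥0∞ :=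
  ⨆ t ∈ {t | t ∈ intervalIoo γ ∧ (2 : ℝ) ^ k * t ≤ ψ t}, ENNReal.ofReal t

/-- Lebesgue measure on `(0, γ)`, normalised so that the level sets `{2 ^ k < |f|}` of functions `f`
in the unit ball of the Marcinkiewicz space have measure at most one. -/
noncomputable def levelScaledMeasure (ψ : ℝ → ℝ) (γ : ℝ≥0∞) (k : ℤ) : Measure ℝ :=
  (levelMeasure ψ γ k)⁻¹ • volume.restrict (intervalIoo γ)

theorem volume_intervalIoo_le (γ : ℝ≥0∞) : volume (intervalIoo γ) ≤ γ := by
  have h : intervalIoo γ = {s : ℝ | ENNReal.ofReal s < γ} ∩ Ioi 0 := ext fun _ => and_comm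
  rw [h, volume_ofReal_lt]

theorem zpow_le_div_of_lt_levelMeasure (W : IsConcaveWeight ψ γ) {s : ℝ} (hs : 0 < s)
    (h : ENNReal.ofReal s < levelMeasure ψ γ k) : (2 : ℝ) ^ k ≤ ψ s / s := by
  simp only [levelMeasure, lt_iSup_iff] at h
  obtain ⟨t, ⟨ht, hψt⟩, hst⟩ := h
  exact ((le_div_iff₀ ht.1).2 hψt).trans
    (W.div_le_div ht hs ((ENNReal.ofReal_lt_ofReal_iff ht.1).1 hst).le)

theorem ofReal_mul_le_lintegral_rearrangement {α : Type*} [MeasurableSpace α] {μ : Measure α}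
    {f : α → ℝ} {r t : ℝ} (hr : 0 ≤ r) (h : ENNReal.ofReal t ≤ distribFun μ f r) :
    ENNReal.ofReal (r * t) ≤ ∫⁻ u in Ioo 0 t, rearrangement μ f u := by
  calc ENNReal.ofReal (r * t) = ∫⁻ _ in Ioo 0 t, ENNReal.ofReal r := by
        rw [setLIntegral_const, Real.volume_Ioo, sub_zero, ENNReal.ofReal_mul hr]
    _ ≤ _ := setLIntegral_mono' measurableSet_Ioo fun u hu => ((lt_rearrangement_iff hr).2
        (((ENNReal.ofReal_lt_ofReal_iff (hu.1.trans hu.2)).2 hu.2).trans_le h)).le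

theorem distribFun_le_levelMeasure (W : IsConcaveWeight ψ γ) {f : marcinkiewiczSpace ψ γ}
    (hf : ‖f‖ ≤ 1) (k : ℤ) :
    distribFun (volume.restrict (intervalIoo γ)) f.1 ((2 : ℝ) ^ k) ≤ levelMeasure ψ γ k := by
  refine ENNReal.le_of_forall_nnreal_lt fun t ht => ?_
  rcases eq_zero_or_pos t with rfl | ht₀
  · simp
  have ht_mem : (t : ℝ) ∈ intervalIoo γ := ⟨ht₀, by
    rw [ENNReal.ofReal_coe_nnreal]
    exact ht.trans_le ((measure_mono (subset_univ _)).trans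
      ((Measure.restrict_apply_univ _).trans_le (volume_intervalIoo_le γ)))⟩
  have h_le := (ofReal_mul_le_lintegral_rearrangement (r := 2 ^ k) (by positivity)
    ((ENNReal.ofReal_coe_nnreal).trans_le ht.le)).trans
    ((marcinkiewiczSpace.norm_le_iff W.pos zero_le_one).1 hf t ht_mem)
  rw [one_mul, ENNReal.ofReal_le_ofReal_iff (W.pos _ ht_mem).le] at h_le
  rw [← ENNReal.ofReal_coe_nnreal]
  exact le_iSup₂_of_le (t : ℝ) ⟨ht_mem, h_le⟩ le_rfl

theorem lintegral_le_mul_of_levelMeasure_le {b : ℝ≥0∞} (hb₀ : b ≠ 0) (hb : b ≠ ∞)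
    (h : levelMeasure ψ γ k ≤ b) (F : ℝ → ℝ≥0∞) :
    ∫⁻ x in intervalIoo γ, F x ≤ b * ∫⁻ x, F x ∂levelScaledMeasure ψ γ k := by
  rw [levelScaledMeasure, lintegral_smul_measure, smul_eq_mul, ← ENNReal.inv_mul_le_iff hb₀ hb]
  exact mul_le_mul_left (ENNReal.inv_le_inv.2 h) _

end Levels

section Layers

/-- The part of `f` with absolute values in `(2 ^ k, 2 ^ (k + 1)]`, divided by `2 ^ (k + 1)`. -/
noncomputable def dyadicLayer (f : ℝ → ℝ) (k : ℤ) : ℝ → ℝ :=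
  {x | |f x| ∈ Ioc ((2 : ℝ) ^ k) (2 ^ (k + 1))}.indicator fun x => f x / 2 ^ (k + 1)

theorem measurable_dyadicLayer {f : ℝ → ℝ} (hf : Measurable f) (k : ℤ) :
    Measurable (dyadicLayer f k) :=
  (hf.div_const _).indicator (measurableSet_Ioc.preimage hf.abs)

theorem abs_dyadicLayer_le (f : ℝ → ℝ) (k : ℤ) (x : ℝ) : |dyadicLayer f k x| ≤ 1 := by
  rw [dyadicLayer, indicator_apply]
  split_ifs with hx
  · rw [abs_div, abs_of_pos (by positivity : (0 : ℝ) < 2 ^ (k + 1))]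
    exact div_le_one_of_le₀ hx.2 (by positivity)
  · simp

theorem hasSum_dyadicLayer (f : ℝ → ℝ) (x : ℝ) :
    HasSum (fun k : ℤ => (2 : ℝ) ^ (k + 1) * dyadicLayer f k x) (f x) := by
  rcases eq_or_ne (f x) 0 with hx | hx
  · simp [dyadicLayer, indicator_apply, hx, hasSum_zero]
  obtain ⟨k, hk⟩ := exists_mem_Ioc_zpow (abs_pos.2 hx) (one_lt_two (α := ℝ))
  have h_eq : (2 : ℝ) ^ (k + 1) * dyadicLayer f k x = f x := by
    rw [dyadicLayer, indicator_of_mem (by exact hk), mul_div_cancel₀ _ (by positivity)]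
  refine h_eq ▸ hasSum_single k fun j hj => ?_
  rw [dyadicLayer, indicator_of_notMem, mul_zero]
  rintro ⟨hj_lt, hj_le⟩
  have hjk : j < k + 1 := (zpow_lt_zpow_iff_right₀ one_lt_two).1 (hj_lt.trans_le hk.2)
  have hkj : k < j + 1 := (zpow_lt_zpow_iff_right₀ one_lt_two).1 (hk.1.trans_le hj_le)
  omega

theorem enorm_dyadicLayer_rpow_le (f : ℝ → ℝ) (k : ℤ) {q : ℝ} (hq : 0 < q) (x : ℝ) :
    ‖dyadicLayer f k x‖ₑ ^ q ≤ {x | (2 : ℝ) ^ k < |f x|}.indicator 1 x := by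
  by_cases hx : (2 : ℝ) ^ k < |f x|
  · rw [indicator_of_mem (by exact hx), Real.enorm_eq_ofReal_abs]
    exact ENNReal.rpow_le_one (ENNReal.ofReal_le_one.2 (abs_dyadicLayer_le f k x)) hq.le
  · rw [dyadicLayer, indicator_of_notMem fun h => hx h.1, enorm_zero, ENNReal.zero_rpow_of_pos hq]
    exact zero_le

theorem lintegral_dyadicLayer_le {ψ : ℝ → ℝ} {γ : ℝ≥0∞} (W : IsConcaveWeight ψ γ)
    {f : marcinkiewiczSpace ψ γ} (hf : ‖f‖ ≤ 1) (k : ℤ) {q : ℝ} (hq : 0 < q) :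
    ∫⁻ x, ‖dyadicLayer f.1 k x‖ₑ ^ q ∂levelScaledMeasure ψ γ k ≤ 1 := by
  have h_meas : MeasurableSet {x | (2 : ℝ) ^ k < |f.1 x|} :=
    measurableSet_lt measurable_const f.1.measurable.abs
  calc ∫⁻ x, ‖dyadicLayer f.1 k x‖ₑ ^ q ∂levelScaledMeasure ψ γ k
      ≤ ∫⁻ x, {x | (2 : ℝ) ^ k < |f.1 x|}.indicator 1 x ∂levelScaledMeasure ψ γ k :=
        lintegral_mono (enorm_dyadicLayer_rpow_le f.1 k hq)
    _ = (levelMeasure ψ γ k)⁻¹ * distribFun (volume.restrict (intervalIoo γ)) f.1 (2 ^ k) :=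
        lintegral_indicator_one h_meas
    _ ≤ (levelMeasure ψ γ k)⁻¹ * levelMeasure ψ γ k :=
        mul_le_mul_right (distribFun_le_levelMeasure W hf k) _
    _ ≤ 1 := ENNReal.inv_mul_le_one _

end Layers

section Bounds

/-- The dyadic power `2 ^ k`, replaced by zero if it exceeds `c`. -/
noncomputable def zpowBelow (c : ℝ) (k : ℤ) : ℝ≥0∞ :=
  if (2 : ℝ) ^ k ≤ c then ENNReal.ofReal (2 ^ k) else 0

theorem tsum_zpowBelow_le {c : ℝ} (hc : 0 < c) : ∑' k, zpowBelow c k ≤ ENNReal.ofReal (2 * c) := by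
  set l := Int.log 2 c
  have h_iff (k : ℤ) : (2 : ℝ) ^ k ≤ c ↔ k ≤ l :=
    mod_cast Int.zpow_le_iff_le_log (R := ℝ) one_lt_two hc
  have h_term (n : ℕ) : zpowBelow c (l - n) = ENNReal.ofReal (2 ^ l * (1 / 2) ^ n) := by
    rw [zpowBelow, if_pos ((h_iff _).2 (by omega)), zpow_sub₀ two_ne_zero, zpow_natCast,
      one_div_pow, mul_one_div]
  have h_support : Function.support (zpowBelow c) ⊆ range fun n : ℕ => l - n := fun k hk => by
    have hkl : k ≤ l := (h_iff k).1 (not_not.1 fun h => hk (if_neg h))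
    exact ⟨(l - k).toNat, by simp [Int.toNat_of_nonneg (sub_nonneg.2 hkl)]⟩
  rw [← Function.Injective.tsum_eq (fun m n h => by simpa using h) h_support]
  simp only [h_term]
  rw [← ENNReal.ofReal_tsum_of_nonneg (fun _ => by positivity)
    (summable_geometric_two.mul_left _), tsum_mul_left, tsum_geometric_two, mul_comm]
  exact ENNReal.ofReal_le_ofReal (mul_le_mul_of_nonneg_left ((h_iff l).2 le_rfl) zero_le_two)

theorem sub_le_rpow_mul_rpow {a s q : ℝ} (ha : 0 ≤ a) (hs : 0 < s) (hq : 1 ≤ q) :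
    a - s ≤ s ^ (1 - q) * a ^ q := by
  rcases le_or_gt a s with has | hsa
  · exact (sub_nonpos.2 has).trans (by positivity)
  calc a - s ≤ a := by linarith
    _ = a ^ (1 - q) * a ^ q := by rw [← Real.rpow_add (hs.trans hsa), sub_add_cancel, Real.rpow_one]
    _ ≤ s ^ (1 - q) * a ^ q :=
        mul_le_mul_of_nonneg_right (Real.rpow_le_rpow_of_nonpos hs hsa.le (by linarith))
          (by positivity)

variable {α : Type*} [MeasurableSpace α] {μ : Measure α} {g : α → ℝ}

theorem lintegral_rearrangement_le_of_abs_le (hg : AEMeasurable g μ) {M : ℝ} (hM : 0 ≤ M)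
    (h : ∀ x, |g x| ≤ M) (t : ℝ) :
    ∫⁻ u in Ioo 0 t, rearrangement μ g u ≤ ENNReal.ofReal (M * t) := by
  refine (lintegral_rearrangement_le hg t hM).trans_eq ?_
  have h_sub (x : α) : ENNReal.ofReal (|g x| - M) = 0 :=
    ENNReal.ofReal_of_nonpos (sub_nonpos.2 (h x))
  simp only [h_sub, lintegral_zero, add_zero]
  rw [ENNReal.ofReal_mul hM, mul_comm]

theorem lintegral_rearrangement_le_rpow (hg : AEMeasurable g μ) {q s E t : ℝ} (hq : 1 ≤ q)
    (hs : 0 < s) (hE : 0 ≤ E) (ht : 0 ≤ t) (h : ∫⁻ x, ‖g x‖ₑ ^ q ∂μ ≤ ENNReal.ofReal E) :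
    ∫⁻ u in Ioo 0 t, rearrangement μ g u ≤ ENNReal.ofReal (t * s + s ^ (1 - q) * E) := by
  have h_sub (x : α) :
      ENNReal.ofReal (|g x| - s) ≤ ENNReal.ofReal (s ^ (1 - q)) * ‖g x‖ₑ ^ q := by
    rw [Real.enorm_eq_ofReal_abs, ENNReal.ofReal_rpow_of_nonneg (abs_nonneg _) (by linarith),
      ← ENNReal.ofReal_mul (by positivity)]
    exact ENNReal.ofReal_le_ofReal (sub_le_rpow_mul_rpow (abs_nonneg _) hs hq)
  calc ∫⁻ u in Ioo 0 t, rearrangement μ g u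
      ≤ ENNReal.ofReal t * ENNReal.ofReal s + ∫⁻ x, ENNReal.ofReal (|g x| - s) ∂μ :=
        lintegral_rearrangement_le hg t hs.le
    _ ≤ ENNReal.ofReal t * ENNReal.ofReal s
        + ENNReal.ofReal (s ^ (1 - q)) * ∫⁻ x, ‖g x‖ₑ ^ q ∂μ := by
        rw [← lintegral_const_mul' _ _ ENNReal.ofReal_ne_top]
        gcongr with x
        exact h_sub x
    _ ≤ ENNReal.ofReal t * ENNReal.ofReal s
        + ENNReal.ofReal (s ^ (1 - q)) * ENNReal.ofReal E := by gcongr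
    _ = _ := by
        rw [← ENNReal.ofReal_mul ht, ← ENNReal.ofReal_mul (by positivity),
          ← ENNReal.ofReal_add (by positivity) (by positivity)]

end Bounds

section Quotient

variable {ψ : ℝ → ℝ} {γ : ℝ≥0∞} {q c : ℝ} {hq : 1 ≤ q}

theorem lintegral_rearrangement_le_of_levelMeasure_le (hc : 0 < c) (hcq : c ^ q = 1 / 2)
    (g : familySpace (levelScaledMeasure ψ γ) hq) {k : ℤ} {t : ℝ} (ht : 0 < t) {j : ℕ}
    (hj : levelMeasure ψ γ k ≤ ENNReal.ofReal (t / 2 ^ j)) :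
    ∫⁻ u in Ioo 0 t, rearrangement (volume.restrict (intervalIoo γ)) (g.1 k) u
      ≤ ENNReal.ofReal (2 * familyNorm (levelScaledMeasure ψ γ) hq g * t * c ^ j) := by
  have hg := (measurable_of_familySpace g k).aemeasurable (μ := volume.restrict (intervalIoo γ))
  have h_abs := abs_le_familyNorm g k
  have h_energy := lintegral_le_familyNorm g k
  have hM₀ : 0 ≤ familyNorm (levelScaledMeasure ψ γ) hq g := apply_nonneg _ g
  generalize familyNorm (levelScaledMeasure ψ γ) hq g = M at h_abs h_energy hM₀ ⊢
  obtain rfl | hM := hM₀.eq_or_lt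
  · simpa using lintegral_rearrangement_le_of_abs_le hg le_rfl h_abs t
  -- This height balances the two terms of `lintegral_rearrangement_le_rpow`.
  set s := M * c ^ j with hs
  have hs₀ : 0 < s := by positivity
  have hsq : s ^ q = M ^ q / 2 ^ j := by
    rw [hs, Real.mul_rpow hM.le (by positivity), ← Real.rpow_pow_comm hc.le, hcq, one_div_pow,
      mul_one_div]
  have h_le : ∫⁻ x in intervalIoo γ, ‖g.1 k x‖ₑ ^ q ≤ ENNReal.ofReal (t * s ^ q) := by
    rw [hsq, mul_div_assoc', mul_div_right_comm, ENNReal.ofReal_mul (by positivity)]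
    exact (lintegral_le_mul_of_levelMeasure_le (ENNReal.ofReal_pos.2 (by positivity)).ne'
      ENNReal.ofReal_ne_top hj _).trans (mul_le_mul_right h_energy _)
  refine (lintegral_rearrangement_le_rpow hg hq hs₀ (by positivity) ht.le h_le).trans_eq ?_
  have h_balance : s ^ (1 - q) * (t * s ^ q) = t * s := by
    rw [mul_left_comm, ← Real.rpow_add hs₀, sub_add_cancel, Real.rpow_one]
  congr 1
  linear_combination h_balance + t * hs

theorem lintegral_rearrangement_eq_zero_or_exists_le (W : IsConcaveWeight ψ γ) (hc : 0 < c)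
    (hcq : c ^ q = 1 / 2) (g : familySpace (levelScaledMeasure ψ γ) hq) (k : ℤ) {t : ℝ}
    (ht : t ∈ intervalIoo γ) :
    ∫⁻ u in Ioo 0 t, rearrangement (volume.restrict (intervalIoo γ)) (g.1 k) u = 0 ∨
      ∃ j : ℕ, (2 : ℝ) ^ k ≤ ψ (t / 2 ^ (j + 1)) / (t / 2 ^ (j + 1)) ∧
        ∫⁻ u in Ioo 0 t, rearrangement (volume.restrict (intervalIoo γ)) (g.1 k) u
          ≤ ENNReal.ofReal (2 * familyNorm (levelScaledMeasure ψ γ) hq g * t * c ^ j) := by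
  have hM : 0 ≤ familyNorm (levelScaledMeasure ψ γ) hq g := apply_nonneg _ g
  have h_div (j : ℕ) := div_two_pow_mem_intervalIoo ht j
  by_cases h : ∃ j : ℕ, ENNReal.ofReal (t / 2 ^ j) < levelMeasure ψ γ k
  · right
    have h_find := zpow_le_div_of_lt_levelMeasure W (h_div _).1 (Nat.find_spec h)
    rcases hj : Nat.find h with _ | j
    · refine ⟨0, ?_, ?_⟩
      · rw [hj] at h_find
        exact h_find.trans (W.div_le_div (h_div 0) (h_div 1).1 (by
          gcongr
          exacts [ht.1.le, one_le_two, zero_le_one]))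
      · refine (lintegral_rearrangement_le_of_abs_le (measurable_of_familySpace g k).aemeasurable
          hM (abs_le_familyNorm g k) t).trans (ENNReal.ofReal_le_ofReal ?_)
        linarith [mul_nonneg hM ht.1.le]
    · exact ⟨j, hj ▸ h_find, lintegral_rearrangement_le_of_levelMeasure_le hc hcq g ht.1
        (not_lt.1 (Nat.find_min h (by omega)))⟩
  · left
    push Not at h
    have hc₁ : c < 1 := by
      by_contra! hc₁
      linarith [Real.one_le_rpow hc₁ (zero_le_one.trans hq)]
    have h_lim := ENNReal.tendsto_ofReal
      ((tendsto_pow_atTop_nhds_zero_of_lt_one hc.le hc₁).const_mul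
        (2 * familyNorm (levelScaledMeasure ψ γ) hq g * t))
    rw [mul_zero, ENNReal.ofReal_zero] at h_lim
    exact le_antisymm (ge_of_tendsto' h_lim fun j =>
      lintegral_rearrangement_le_of_levelMeasure_le hc hcq g ht.1 (h j)) zero_le

theorem lintegral_rearrangement_const_mul {α : Type*} [MeasurableSpace α] {μ : Measure α} {r : ℝ}
    (hr : 0 ≤ r) (f : α → ℝ) (t : ℝ) :
    ∫⁻ u in Ioo 0 t, rearrangement μ (fun x => r * f x) u
      = ENNReal.ofReal r * ∫⁻ u in Ioo 0 t, rearrangement μ f u := by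
  rw [← lintegral_const_mul' _ _ ENNReal.ofReal_ne_top]
  refine lintegral_congr fun u => ?_
  exact (rearrangement_smul r f u).trans (by rw [abs_of_nonneg hr])

theorem lintegral_rearrangement_zpow_mul_le (W : IsConcaveWeight ψ γ) (hc : 0 < c)
    (hcq : c ^ q = 1 / 2) (g : familySpace (levelScaledMeasure ψ γ) hq) (k : ℤ) {t : ℝ}
    (ht : t ∈ intervalIoo γ) :
    ∫⁻ u in Ioo 0 t, rearrangement (volume.restrict (intervalIoo γ))
        (fun x => 2 ^ (k + 1) * g.1 k x) u
      ≤ ENNReal.ofReal (4 * familyNorm (levelScaledMeasure ψ γ) hq g * t) *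
        ∑' j : ℕ, ENNReal.ofReal (c ^ j) *
          zpowBelow (ψ (t / 2 ^ (j + 1)) / (t / 2 ^ (j + 1))) k := by
  have : 0 ≤ familyNorm (levelScaledMeasure ψ γ) hq g := apply_nonneg _ g
  have ht₀ := ht.1
  rw [lintegral_rearrangement_const_mul (by positivity)]
  rcases lintegral_rearrangement_eq_zero_or_exists_le W hc hcq g k ht with h | ⟨j, hj, h⟩
  · simp [h]
  refine (mul_le_mul_right h _).trans (le_trans ?_ (mul_le_mul_right (ENNReal.le_tsum j) _))
  rw [zpowBelow, if_pos hj, ← ENNReal.ofReal_mul (by positivity), ← ENNReal.ofReal_mul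
    (by positivity), ← ENNReal.ofReal_mul (by positivity), zpow_add_one₀ two_ne_zero]
  exact ENNReal.ofReal_le_ofReal (le_of_eq (by ring))

theorem pow_mul_div_le_of_decay (W : IsConcaveWeight ψ γ) {C κ : ℝ} (hκ : 1 ≤ κ) {t : ℝ}
    (ht : t ∈ intervalIoo γ) (h_decay : ∀ j : ℕ, κ ^ j * ψ (t / 2 ^ j) ≤ C * ψ t) (hc : 0 ≤ c)
    (j : ℕ) :
    c ^ j * (ψ (t / 2 ^ (j + 1)) / (t / 2 ^ (j + 1))) ≤ 2 * C * (ψ t / t) * (2 * c / κ) ^ j := by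
  have ht₀ := ht.1
  have : 0 < κ := one_pos.trans_le hκ
  have h_le : ψ (t / 2 ^ (j + 1)) ≤ C * ψ t / κ ^ j := by
    rw [le_div_iff₀' (by positivity)]
    exact (mul_le_mul_of_nonneg_right (pow_le_pow_right₀ hκ j.le_succ)
      (W.pos _ (div_two_pow_mem_intervalIoo ht _)).le).trans (h_decay (j + 1))
  calc c ^ j * (ψ (t / 2 ^ (j + 1)) / (t / 2 ^ (j + 1)))
      ≤ c ^ j * (C * ψ t / κ ^ j / (t / 2 ^ (j + 1))) := by gcongr
    _ = 2 * C * (ψ t / t) * (2 * c / κ) ^ j := by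
        rw [div_pow, mul_pow, pow_succ]
        field_simp

theorem tsum_lintegral_rearrangement_zpow_mul_le (W : IsConcaveWeight ψ γ) {C κ : ℝ} (hC : 0 ≤ C)
    (hκ : 1 ≤ κ) {t : ℝ} (ht : t ∈ intervalIoo γ)
    (h_decay : ∀ j : ℕ, κ ^ j * ψ (t / 2 ^ j) ≤ C * ψ t) (hc : 0 < c) (hcq : c ^ q = 1 / 2)
    (hcκ : 2 * c < κ) (g : familySpace (levelScaledMeasure ψ γ) hq) :
    ∑' k : ℤ, ∫⁻ u in Ioo 0 t, rearrangement (volume.restrict (intervalIoo γ))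
        (fun x => 2 ^ (k + 1) * g.1 k x) u
      ≤ ENNReal.ofReal (16 * C / (1 - 2 * c / κ) * familyNorm (levelScaledMeasure ψ γ) hq g
        * ψ t) := by
  have hκ₀ : 0 < κ := one_pos.trans_le hκ
  have h_ratio : 2 * c / κ < 1 := (div_lt_one hκ₀).2 hcκ
  have ht₀ := ht.1
  have hψt := W.pos t ht
  set v : ℕ → ℝ := fun j => ψ (t / 2 ^ (j + 1)) / (t / 2 ^ (j + 1))
  have hv (j : ℕ) : 0 < v j :=
    div_pos (W.pos _ (div_two_pow_mem_intervalIoo ht _)) (div_two_pow_mem_intervalIoo ht _).1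
  have h_term (j : ℕ) : ∑' k, ENNReal.ofReal (c ^ j) * zpowBelow (v j) k
      ≤ ENNReal.ofReal (4 * C * (ψ t / t) * (2 * c / κ) ^ j) := by
    rw [ENNReal.tsum_mul_left]
    refine (mul_le_mul_right (tsum_zpowBelow_le (hv j)) _).trans ?_
    rw [← ENNReal.ofReal_mul (by positivity)]
    have h_decay_j : c ^ j * v j ≤ 2 * C * (ψ t / t) * (2 * c / κ) ^ j :=
      pow_mul_div_le_of_decay W hκ ht h_decay hc.le j
    exact ENNReal.ofReal_le_ofReal (by linarith)
  have h_double : ∑' k, ∑' j, ENNReal.ofReal (c ^ j) * zpowBelow (v j) k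
      ≤ ENNReal.ofReal (4 * C * (ψ t / t) * (1 - 2 * c / κ)⁻¹) := by
    rw [ENNReal.tsum_comm, ← tsum_geometric_of_lt_one (by positivity) h_ratio, ← tsum_mul_left,
      ENNReal.ofReal_tsum_of_nonneg (fun _ => by positivity)
        ((summable_geometric_of_lt_one (by positivity) h_ratio).mul_left _)]
    exact ENNReal.tsum_le_tsum h_term
  refine (ENNReal.tsum_le_tsum fun k =>
    lintegral_rearrangement_zpow_mul_le W hc hcq g k ht).trans ?_
  rw [ENNReal.tsum_mul_left]
  refine (mul_le_mul_right h_double _).trans_eq ?_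
  have : 0 ≤ familyNorm (levelScaledMeasure ψ γ) hq g := apply_nonneg _ g
  rw [← ENNReal.ofReal_mul (by positivity)]
  congr 1
  field_simp
  ring

theorem exists_family_quotient (W : IsConcaveWeight ψ γ) (hγ : 0 < γ) {C κ : ℝ} (hC : 0 ≤ C)
    (hκ : 1 ≤ κ) (h_decay : ∀ t ∈ intervalIoo γ, ∀ j : ℕ, κ ^ j * ψ (t / 2 ^ j) ≤ C * ψ t)
    (hc : 0 < c) (hcq : c ^ q = 1 / 2) (hcκ : 2 * c < κ) :
    ∃ Q : familySpace (levelScaledMeasure ψ γ) hq →ₗ[ℝ] marcinkiewiczSpace ψ γ,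
      (∀ g, ‖Q g‖ ≤ 16 * C / (1 - 2 * c / κ) * familyNorm (levelScaledMeasure ψ γ) hq g) ∧
      ∀ f, ‖f‖ ≤ 1 → ∃ g, familyNorm (levelScaledMeasure ψ γ) hq g ≤ 1 ∧ Q g = f := by
  have h_nonneg : 0 ≤ 16 * C / (1 - 2 * c / κ) :=
    div_nonneg (by positivity)
      (sub_nonneg.2 (div_le_one_of_le₀ hcκ.le (zero_le_one.trans hκ)))
  obtain ⟨Q, hQ_norm, hQ_sum⟩ := marcinkiewiczSpace.exists_linearMap_hasSum hγ W.pos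
    (fun k : ℤ => (2 ^ (k + 1) : ℝ) • LinearMap.proj k ∘ₗ
      (familySpace (levelScaledMeasure ψ γ) hq).subtype)
    (fun k g => ((measurable_of_familySpace g k).const_mul _).aemeasurable)
    (fun g => mul_nonneg h_nonneg (apply_nonneg (familyNorm (levelScaledMeasure ψ γ) hq) g))
    fun g t ht => tsum_lintegral_rearrangement_zpow_mul_le W hC hκ ht (h_decay t ht) hc hcq hcκ g
  refine ⟨Q, hQ_norm, fun f hf => ?_⟩
  have h_abs := abs_dyadicLayer_le f.1
  have h_energy (k : ℤ) : ∫⁻ x, ‖dyadicLayer f.1 k x‖ₑ ^ q ∂levelScaledMeasure ψ γ k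
      ≤ ENNReal.ofReal (1 ^ q) := by
    simpa using lintegral_dyadicLayer_le W hf k (one_pos.trans_le hq)
  refine ⟨⟨dyadicLayer f.1, mem_familySpace zero_le_one (measurable_dyadicLayer f.1.measurable)
    h_abs h_energy⟩, (familyNorm_le_iff_lintegral zero_le_one).2 ⟨h_abs, h_energy⟩,
    Subtype.ext (AEEqFun.ext ?_)⟩
  filter_upwards [hQ_sum ⟨dyadicLayer f.1, mem_familySpace zero_le_one
    (measurable_dyadicLayer f.1.measurable) h_abs h_energy⟩] with x hx
  exact hx.unique (hasSum_dyadicLayer f.1 x)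

theorem exists_exponent {κ : ℝ} (hκ : 1 < κ) :
    ∃ q c : ℝ, 1 < q ∧ q ≤ 2 ∧ 0 < c ∧ c ^ q = 1 / 2 ∧ 2 * c < κ := by
  have h_cont : ContinuousAt (fun q : ℝ => 2 * (1 / 2 : ℝ) ^ q⁻¹) 1 := by
    fun_prop (disch := norm_num)
  have h_lt : ∀ᶠ q in 𝓝[>] (1 : ℝ), 2 * (1 / 2 : ℝ) ^ q⁻¹ < κ :=
    nhdsWithin_le_nhds (h_cont.eventually_lt_const (by simpa using hκ))
  have h_mem : ∀ᶠ q in 𝓝[>] (1 : ℝ), q ∈ Ioo 1 2 := Ioo_mem_nhdsGT one_lt_two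
  obtain ⟨q, ⟨hq₁, hq₂⟩, hq⟩ := (h_mem.and h_lt).exists
  exact ⟨q, (1 / 2) ^ q⁻¹, hq₁, hq₂.le, by positivity,
    Real.rpow_inv_rpow (by norm_num) (by linarith), hq⟩

theorem isGrothendieckSpace_of_condition (W : IsConcaveWeight ψ γ) (hγ : 0 < γ)
    (h : ConditionA ψ γ ∨ ConditionB ψ γ) : IsGrothendieckSpace (marcinkiewiczSpace ψ γ) := by
  obtain ⟨C, hC, κ, hκ, h_decay⟩ := W.exists_decay h
  obtain ⟨q, c, hq₁, hq₂, hc, hcq, hcκ⟩ := exists_exponent hκ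
  obtain ⟨Q, hQ, hQ_lift⟩ :=
    exists_family_quotient (hq := hq₁.le) W hγ hC.le hκ.le h_decay hc hcq hcκ
  have := marcinkiewiczSpace.completeSpace hγ W.pos
  have h_nonneg : 0 ≤ 16 * C / (1 - 2 * c / κ) :=
    div_nonneg (by positivity) (sub_nonneg.2 (div_le_one_of_le₀ hcκ.le (by positivity)))
  exact ⟨this, fun _ _ => tendsto_toWeakSpace_of_family_quotient hq₁ hq₂ Q h_nonneg hQ hQ_lift⟩

end Quotient

/-! ### Lacunary families -/

section Lacunary

variable {ι : Type*} {x : ι → ℝ}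

/-- A lacunary family of reals: of any two members, one is at least twice the other. The index set
carries no order, so that increasing and decreasing sequences are both covered. -/
def IsLacunary (x : ι → ℝ) : Prop :=
  Pairwise fun i j => 2 * x i ≤ x j ∨ 2 * x j ≤ x i

namespace IsLacunary

theorem of_two_mul_le_succ {x : ℕ → ℝ} (hx : ∀ n, 0 ≤ x n) (h : ∀ n, 2 * x n ≤ x (n + 1)) :
    IsLacunary x := by
  have h_mono : Monotone x := monotone_nat_of_le_succ fun n => by linarith [hx n, h n]
  intro i j hij
  rcases hij.lt_or_gt with hij | hij
  exacts [.inl ((h i).trans (h_mono hij)), .inr ((h j).trans (h_mono hij))]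

theorem of_two_mul_succ_le {x : ℕ → ℝ} (hx : ∀ n, 0 ≤ x n) (h : ∀ n, 2 * x (n + 1) ≤ x n) :
    IsLacunary x := by
  have h_anti : Antitone x := antitone_nat_of_succ_le fun n => by linarith [hx (n + 1), h n]
  intro i j hij
  rcases hij.lt_or_gt with hij | hij
  · exact .inr (by linarith [h i, h_anti (Nat.succ_le_of_lt hij)])
  · exact .inl (by linarith [h j, h_anti (Nat.succ_le_of_lt hij)])

theorem const_mul (h : IsLacunary x) {c : ℝ} (hc : 0 ≤ c) : IsLacunary fun i => c * x i := by
  intro i j hij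
  dsimp only
  rw [mul_left_comm, mul_left_comm 2]
  exact (h hij).imp (mul_le_mul_of_nonneg_left · hc) (mul_le_mul_of_nonneg_left · hc)

theorem sum_le (h : IsLacunary x) (hx : ∀ i, 0 ≤ x i) (s : Finset ι) {B : ℝ} (hB : 0 ≤ B)
    (hs : ∀ i ∈ s, x i ≤ B) : ∑ i ∈ s, x i ≤ 2 * B := by
  classical
  induction s using Finset.induction_on_max_value x generalizing B with
  | empty => simpa using hB
  | insert a s has h_max ih =>
    have h_half (i : ι) (hi : i ∈ s) : x i ≤ x a / 2 := by
      rcases h (ne_of_mem_of_not_mem hi has) with hia | hia <;> linarith [hx a, hx i, h_max i hi]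
    rw [Finset.sum_insert has]
    linarith [ih (div_nonneg (hx a) zero_le_two) h_half, hs a (Finset.mem_insert_self a s)]

end IsLacunary

end Lacunary

section LacunaryWeight

variable {ψ : ℝ → ℝ} {γ : ℝ≥0∞}

theorem IsConcaveWeight.min_mul_div_le (W : IsConcaveWeight ψ γ) {a t : ℝ}
    (ha : a ∈ intervalIoo γ) (ht : t ∈ intervalIoo γ) : min t a * (ψ a / a) ≤ ψ t := by
  rcases le_total t a with hta | hat
  · rw [min_eq_left hta, mul_div_assoc', div_le_iff₀ ha.1, mul_comm (ψ t)]
    exact W.mul_le_mul ha ht.1.le hta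
  · rw [min_eq_right hat, mul_div_cancel₀ _ ha.1.ne']
    exact W.le ht ha.1 hat

theorem IsConcaveWeight.tsum_min_mul_div_le (W : IsConcaveWeight ψ γ) {ι : Type*} {t : ι → ℝ}
    (ht : ∀ i, t i ∈ intervalIoo γ) (hψ : IsLacunary fun i => ψ (t i))
    (hψ_div : IsLacunary fun i => ψ (t i) / t i) {s : ℝ} (hs : s ∈ intervalIoo γ) :
    ∑' i, ENNReal.ofReal (min s (t i) * (ψ (t i) / t i)) ≤ ENNReal.ofReal (4 * ψ s) := by
  have h_nonneg (i : ι) : 0 ≤ ψ (t i) := (W.pos _ (ht i)).le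
  have h_div_nonneg (i : ι) : 0 ≤ ψ (t i) / t i := div_nonneg (h_nonneg i) (ht i).1.le
  have h_min (i : ι) : min s (t i) * (ψ (t i) / t i) ≤ ψ s := W.min_mul_div_le (ht i) hs
  have h_left (i : ι) (hi : t i ≤ s) : min s (t i) * (ψ (t i) / t i) = ψ (t i) := by
    rw [min_eq_right hi, mul_div_cancel₀ _ (ht i).1.ne']
  have h_right (i : ι) (hi : ¬ t i ≤ s) :
      min s (t i) * (ψ (t i) / t i) = s * (ψ (t i) / t i) := by
    rw [min_eq_left (not_le.1 hi).le]
  rw [ENNReal.tsum_eq_iSup_sum]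
  refine iSup_le fun S => ?_
  rw [← ENNReal.ofReal_sum_of_nonneg fun i _ =>
    mul_nonneg (le_min hs.1.le (ht i).1.le) (h_div_nonneg i)]
  refine ENNReal.ofReal_le_ofReal ?_
  rw [← Finset.sum_filter_add_sum_filter_not S fun i => t i ≤ s,
    Finset.sum_congr rfl fun i hi => h_left i (Finset.mem_filter.1 hi).2,
    Finset.sum_congr rfl fun i hi => h_right i (Finset.mem_filter.1 hi).2]
  have h_sum_left := hψ.sum_le h_nonneg (S.filter fun i => t i ≤ s) (W.pos s hs).le fun i hi =>
    (h_left i (Finset.mem_filter.1 hi).2).symm.trans_le (h_min i)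
  have h_sum_right := (hψ_div.const_mul hs.1.le).sum_le
    (fun i => mul_nonneg hs.1.le (h_div_nonneg i)) (S.filter fun i => ¬ t i ≤ s) (W.pos s hs).le
    fun i hi => (h_right i (Finset.mem_filter.1 hi).2).symm.trans_le (h_min i)
  linarith

end LacunaryWeight

/-! ### Indicator functions and integrals over sets -/

section Indicator

variable {α κ : Type*} [MeasurableSpace α] {μ : Measure α}

theorem lintegral_rearrangement_indicator_le {S : Set α} (hS : MeasurableSet S) {a c t : ℝ}
    (hc : 0 ≤ c) (hμ : μ S ≤ ENNReal.ofReal a) :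
    ∫⁻ u in Ioo 0 t, rearrangement μ (S.indicator fun _ => c) u
      ≤ ENNReal.ofReal (min t a * c) := by
  have h_meas : AEMeasurable (S.indicator fun _ => c) μ :=
    (measurable_const.indicator hS).aemeasurable
  rcases le_total t a with hta | hat
  · rw [min_eq_left hta, mul_comm]
    refine lintegral_rearrangement_le_of_abs_le h_meas hc (fun x => ?_) t
    rw [abs_of_nonneg (indicator_nonneg (fun _ _ => hc) x)]
    exact indicator_le_self' (fun _ _ => hc) x
  · rw [min_eq_right hat, mul_comm, ENNReal.ofReal_mul hc]
    refine (lintegral_rearrangement_le h_meas t le_rfl).trans ?_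
    have h_abs (x : α) : ENNReal.ofReal (|S.indicator (fun _ => c) x| - 0)
        = S.indicator (fun _ => ENNReal.ofReal c) x := by
      by_cases hx : x ∈ S <;> simp [hx, abs_of_nonneg hc]
    simp only [h_abs, ENNReal.ofReal_zero, mul_zero, zero_add,
      lintegral_indicator_const hS]
    gcongr

theorem setIntegral_eq_of_hasSum_indicator {F : α → ℝ} {A : κ → Set α} {c : κ → ℝ}
    (hF : ∀ᵐ x ∂μ, HasSum (fun k => (A k).indicator (fun _ => c k) x) (F x)) {S : Set α}
    (hS : MeasurableSet S) {k : κ} (hA : MeasurableSet (A k))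
    (h_disj : ∀ l ≠ k, Disjoint S (A l)) : ∫ x in S, F x ∂μ = μ.real (S ∩ A k) * c k := by
  have h_congr : ∫ x in S, F x ∂μ = ∫ x in S, (A k).indicator (fun _ => c k) x ∂μ :=
    setIntegral_congr_ae hS <| hF.mono fun x hx hxS => hx.unique <| hasSum_single k fun l hl =>
      indicator_of_notMem (disjoint_left.1 (h_disj l hl) hxS) _
  rw [h_congr, setIntegral_indicator hA, setIntegral_const, smul_eq_mul]

theorem inv_mul_measureReal_inter_mul_div [DecidableEq κ] {A : κ → Set α}
    (hA : Pairwise (Function.onFun Disjoint A)) {a b : κ → ℝ} (ha : ∀ k, 0 < a k)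
    (hb : ∀ k, b k ≠ 0) {i j : κ} (hμ : μ (A j) = ENNReal.ofReal (a j)) :
    (b i)⁻¹ * (μ.real (A i ∩ A j) * (b j / a j)) = if i = j then 1 else 0 := by
  split_ifs with hij
  · subst hij
    have := hb i
    have := (ha i).ne'
    rw [inter_self, measureReal_def, hμ, ENNReal.toReal_ofReal (ha i).le]
    field_simp
  · rw [(hA hij).inter_eq, measureReal_empty, zero_mul, mul_zero]

end Indicator

namespace marcinkiewiczSpace

variable {ψ : ℝ → ℝ} {γ : ℝ≥0∞}

theorem exists_hasSum_indicator (hγ : 0 < γ) (hpos : ∀ t ∈ intervalIoo γ, 0 < ψ t) {κ : Type*}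
    [Countable κ] {A : κ → Set ℝ} (hA : ∀ k, MeasurableSet (A k)) {a c : κ → ℝ}
    (hc : ∀ k, 0 ≤ c k)
    (hA_vol : ∀ k, volume.restrict (intervalIoo γ) (A k) ≤ ENNReal.ofReal (a k)) {C : ℝ}
    (hC : 0 ≤ C) (h : ∀ t ∈ intervalIoo γ,
      ∑' k, ENNReal.ofReal (min t (a k) * c k) ≤ ENNReal.ofReal (C * ψ t)) :
    ∃ F : marcinkiewiczSpace ψ γ, ‖F‖ ≤ C ∧ ∀ᵐ x ∂volume.restrict (intervalIoo γ),
      HasSum (fun k => (A k).indicator (fun _ => c k) x) (F.1 x) :=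
  exists_hasSum hγ hpos (fun k => (measurable_const.indicator (hA k)).aemeasurable) hC
    fun t ht => (ENNReal.tsum_le_tsum fun k =>
      lintegral_rearrangement_indicator_le (hA k) (hc k) (hA_vol k)).trans (h t ht)

variable {S : Set ℝ} {a : ℝ}

theorem setLIntegral_enorm_le (hpos : ∀ t ∈ intervalIoo γ, 0 < ψ t) (f : marcinkiewiczSpace ψ γ)
    (ha : a ∈ intervalIoo γ) (hS : volume.restrict (intervalIoo γ) S ≤ ENNReal.ofReal a) :
    ∫⁻ x in S, ‖f.1 x‖ₑ ∂volume.restrict (intervalIoo γ) ≤ ENNReal.ofReal (‖f‖ * ψ a) :=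
  (setLIntegral_enorm_le_lintegral_rearrangement f.1.aemeasurable ha.1 hS).trans
    (lintegral_rearrangement_le hpos f ha)

theorem integrableOn (hpos : ∀ t ∈ intervalIoo γ, 0 < ψ t) (f : marcinkiewiczSpace ψ γ)
    (ha : a ∈ intervalIoo γ) (hS : volume.restrict (intervalIoo γ) S ≤ ENNReal.ofReal a) :
    IntegrableOn f.1 S (volume.restrict (intervalIoo γ)) :=
  ⟨f.1.aestronglyMeasurable.restrict,
    (setLIntegral_enorm_le hpos f ha hS).trans_lt ENNReal.ofReal_lt_top⟩

theorem sum_abs_setIntegral_le (hpos : ∀ t ∈ intervalIoo γ, 0 < ψ t) (f : marcinkiewiczSpace ψ γ)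
    {ι : Type*} {A : ι → Set ℝ} (hA : ∀ i, MeasurableSet (A i))
    (hA_disj : Pairwise (Function.onFun Disjoint A)) (s : Finset ι) (ha : a ∈ intervalIoo γ)
    (hA_vol : volume.restrict (intervalIoo γ) (⋃ i ∈ s, A i) ≤ ENNReal.ofReal a) :
    ∑ i ∈ s, |∫ x in A i, f.1 x ∂volume.restrict (intervalIoo γ)| ≤ ψ a * ‖f‖ := by
  rw [mul_comm, ← ENNReal.ofReal_le_ofReal_iff (mul_nonneg (norm_nonneg f) (hpos a ha).le),
    ENNReal.ofReal_sum_of_nonneg fun _ _ => abs_nonneg _]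
  refine le_trans ?_ (setLIntegral_enorm_le hpos f ha hA_vol)
  rw [lintegral_biUnion_finset (fun i _ j _ hij => hA_disj hij) fun i _ => hA i]
  refine Finset.sum_le_sum fun i _ => ?_
  rw [← Real.enorm_eq_ofReal_abs]
  exact enorm_integral_le_lintegral_enorm _

theorem sum_abs_inv_mul_setIntegral_le (hpos : ∀ t ∈ intervalIoo γ, 0 < ψ t)
    (f : marcinkiewiczSpace ψ γ) {ι : Type*} {A : ι → Set ℝ} (hA : ∀ i, MeasurableSet (A i))
    (hA_disj : Pairwise (Function.onFun Disjoint A)) (s : Finset ι) (ha : a ∈ intervalIoo γ)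
    (hA_vol : volume.restrict (intervalIoo γ) (⋃ i ∈ s, A i) ≤ ENNReal.ofReal a) {b : ι → ℝ}
    (hb : ∀ i, 0 < b i) {C : ℝ} (hC : 0 ≤ C) (hab : ∀ i, ψ a ≤ C * b i) :
    ∑ i ∈ s, |(b i)⁻¹ * ∫ x in A i, f.1 x ∂volume.restrict (intervalIoo γ)| ≤ C * ‖f‖ := by
  have hψa := hpos a ha
  have h_inv (i : ι) : (b i)⁻¹ ≤ C * (ψ a)⁻¹ := by
    rw [← div_eq_mul_inv, le_div_iff₀ hψa, inv_mul_le_iff₀ (hb i), mul_comm]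
    exact hab i
  calc ∑ i ∈ s, |(b i)⁻¹ * ∫ x in A i, f.1 x ∂volume.restrict (intervalIoo γ)|
      ≤ ∑ i ∈ s, C * (ψ a)⁻¹ * |∫ x in A i, f.1 x ∂volume.restrict (intervalIoo γ)| := by
        refine Finset.sum_le_sum fun i _ => ?_
        rw [abs_mul, abs_of_pos (inv_pos.2 (hb i))]
        exact mul_le_mul_of_nonneg_right (h_inv i) (abs_nonneg _)
    _ = C * (ψ a)⁻¹ * ∑ i ∈ s, |∫ x in A i, f.1 x ∂volume.restrict (intervalIoo γ)| := by
        rw [Finset.mul_sum]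
    _ ≤ C * (ψ a)⁻¹ * (ψ a * ‖f‖) := by
        gcongr
        exact sum_abs_setIntegral_le hpos f hA hA_disj s ha hA_vol
    _ = C * ‖f‖ := by field_simp

theorem exists_setIntegral_functional (hpos : ∀ t ∈ intervalIoo γ, 0 < ψ t)
    (ha : a ∈ intervalIoo γ) (hS : volume.restrict (intervalIoo γ) S ≤ ENNReal.ofReal a) :
    ∃ T : StrongDual ℝ (marcinkiewiczSpace ψ γ), ‖T‖ ≤ ψ a ∧
      ∀ f, T f = ∫ x in S, f.1 x ∂volume.restrict (intervalIoo γ) := by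
  have h_int (f : marcinkiewiczSpace ψ γ) := integrableOn hpos f ha hS
  have h_bound (f : marcinkiewiczSpace ψ γ) :
      ‖∫ x in S, f.1 x ∂volume.restrict (intervalIoo γ)‖ ≤ ψ a * ‖f‖ := by
    rw [mul_comm, ← ENNReal.ofReal_le_ofReal_iff (mul_nonneg (norm_nonneg f) (hpos a ha).le),
      ofReal_norm]
    exact (enorm_integral_le_lintegral_enorm _).trans (setLIntegral_enorm_le hpos f ha hS)
  refine ⟨LinearMap.mkContinuous
    { toFun := fun f => ∫ x in S, f.1 x ∂volume.restrict (intervalIoo γ)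
      map_add' := fun f g => ?_
      map_smul' := fun c f => ?_ } (ψ a) h_bound,
    LinearMap.mkContinuous_norm_le _ (hpos a ha).le _, fun f => rfl⟩
  · rw [← integral_add (h_int f) (h_int g)]
    exact integral_congr_ae (ae_restrict_of_ae (AEEqFun.coeFn_add f.1 g.1))
  · rw [RingHom.id_apply, smul_eq_mul, ← integral_const_mul]
    exact integral_congr_ae (ae_restrict_of_ae (AEEqFun.coeFn_smul c f.1))

end marcinkiewiczSpace

/-! ### Weights that fail to double -/

section Blocks

variable {ψ : ℝ → ℝ} {γ : ℝ≥0∞}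

theorem volume_restrict_Ico_le (a b : ℝ) :
    volume.restrict (intervalIoo γ) (Ico a b) ≤ ENNReal.ofReal (b - a) :=
  (Measure.restrict_apply_le _ _).trans_eq Real.volume_Ico

theorem volume_restrict_Ico {a b : ℝ} (ha : 0 < a) (hb : b ∈ intervalIoo γ) :
    volume.restrict (intervalIoo γ) (Ico a b) = ENNReal.ofReal (b - a) := by
  rw [Measure.restrict_apply measurableSet_Ico, inter_eq_left.2, Real.volume_Ico]
  exact fun x hx => mem_intervalIoo_of_le hb (ha.trans_le hx.1) hx.2.le

/-- The `j`-th of the consecutive intervals of length `t` that follow `[0, t)`. The interval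
`[0, t)` itself is left out so that the pieces obtained from different values of `t` can be
disjoint. -/
def blockPiece (t : ℝ) (j : ℕ) : Set ℝ :=
  Ico ((j + 1 : ℕ) * t) ((j + 2 : ℕ) * t)

theorem measurableSet_blockPiece (t : ℝ) (j : ℕ) : MeasurableSet (blockPiece t j) :=
  measurableSet_Ico

theorem pairwise_disjoint_blockPiece {t : ℝ} (ht : 0 ≤ t) :
    Pairwise (Function.onFun Disjoint (blockPiece t)) :=
  Monotone.pairwise_disjoint_on_Ico_succ (f := fun j : ℕ => ((j + 1 : ℕ) * t : ℝ))
    fun i j hij => by dsimp only; gcongr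

theorem blockPiece_subset_Ico {t c : ℝ} (ht : 0 ≤ t) {j : ℕ} (hj : (j + 2 : ℕ) ≤ c) :
    blockPiece t j ⊆ Ico t (c * t) :=
  Ico_subset_Ico (le_mul_of_one_le_left ht (by exact_mod_cast j.succ_pos)) (by gcongr)

theorem volume_restrict_blockPiece_le (t : ℝ) (j : ℕ) :
    volume.restrict (intervalIoo γ) (blockPiece t j) ≤ ENNReal.ofReal t :=
  (volume_restrict_Ico_le _ _).trans_eq (by push_cast; ring_nf)

theorem volume_restrict_iUnion_blockPiece_le {t c : ℝ} (ht : 0 ≤ t) {m : ℕ}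
    (hm : (m + 1 : ℕ) ≤ c) :
    volume.restrict (intervalIoo γ) (⋃ j ∈ Finset.range m, blockPiece t j)
      ≤ ENNReal.ofReal (c * t) := by
  have h_subset : ⋃ j ∈ Finset.range m, blockPiece t j ⊆ Ico t (c * t) :=
    iUnion₂_subset fun j hj => blockPiece_subset_Ico ht <|
      (Nat.cast_le.2 (Nat.succ_le_succ (Finset.mem_range.1 hj))).trans hm
  exact (measure_mono h_subset).trans <| (volume_restrict_Ico_le _ _).trans <|
    ENNReal.ofReal_le_ofReal (sub_le_self _ ht)

theorem volume_restrict_blockPiece {t : ℝ} {j : ℕ} (h : (j + 2 : ℕ) * t ∈ intervalIoo γ) :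
    volume.restrict (intervalIoo γ) (blockPiece t j) = ENNReal.ofReal t := by
  have ht : 0 < t := (mul_pos_iff_of_pos_left (by positivity)).1 h.1
  exact (volume_restrict_Ico (by positivity) h).trans (by push_cast; ring_nf)

end Blocks

section Necessity

variable {ψ : ℝ → ℝ} {γ : ℝ≥0∞}

theorem not_isGrothendieckSpace_of_disjoint (W : IsConcaveWeight ψ γ) {A : ℕ → Set ℝ} {a : ℕ → ℝ}
    (hA : ∀ j, MeasurableSet (A j)) (hA_disj : Pairwise (Function.onFun Disjoint A))
    (ha : ∀ j, a j ∈ intervalIoo γ)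
    (hA_vol : ∀ j, volume.restrict (intervalIoo γ) (A j) = ENNReal.ofReal (a j)) {s : ℕ → ℝ}
    (hs : ∀ n, s n ∈ intervalIoo γ)
    (hA_union : ∀ n, volume.restrict (intervalIoo γ) (⋃ j ∈ Finset.range n, A j)
      ≤ ENNReal.ofReal (s n))
    {C : ℝ} (hψ : ∀ n j, ψ (s n) ≤ C * ψ (a j)) :
    ¬ IsGrothendieckSpace (marcinkiewiczSpace ψ γ) := by
  have hψa (j : ℕ) : 0 < ψ (a j) := W.pos _ (ha j)
  choose T _ hT using fun j =>
    marcinkiewiczSpace.exists_setIntegral_functional W.pos (ha j) (hA_vol j).le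
  choose f hf hf_sum using fun j => marcinkiewiczSpace.exists_hasSum_indicator (κ := Unit)
    (pos_of_gt (ha 0).2) W.pos (fun _ => hA j) (fun _ => (div_pos (hψa j) (ha j).1).le)
    (fun _ => (hA_vol j).le) zero_le_one fun t ht => by
      simpa using ENNReal.ofReal_le_ofReal (W.min_mul_div_le (ha j) ht)
  refine not_isGrothendieckSpace_of_biorthogonal (C := max C 1) (fun j => (ψ (a j))⁻¹ • T j) f
    (fun j => (hf j).trans (le_max_right _ _)) (fun g n => ?_) fun i j => ?_
  · simp only [smul_apply, smul_eq_mul, hT]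
    refine marcinkiewiczSpace.sum_abs_inv_mul_setIntegral_le W.pos g hA hA_disj _ (hs n)
      (hA_union n) hψa (zero_le_one.trans (le_max_right _ _)) fun j => (hψ n j).trans ?_
    exact mul_le_mul_of_nonneg_right (le_max_left _ _) (hψa j).le
  · rw [smul_apply, smul_eq_mul, hT,
      setIntegral_eq_of_hasSum_indicator (hf_sum j) (hA i) (k := ()) (hA j)
        fun l hl => (hl rfl).elim]
    exact inv_mul_measureReal_inter_mul_div hA_disj (fun k => (ha k).1) (fun k => (hψa k).ne')
      (hA_vol j)

theorem not_isGrothendieckSpace_of_flat_blocks (W : IsConcaveWeight ψ γ) {c t : ℕ → ℝ}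
    (hc : ∀ n : ℕ, (n + 2 : ℕ) ≤ c n) (ht : ∀ n, c n * t n ∈ intervalIoo γ)
    (h_flat : ∀ n, ψ (c n * t n) ≤ 2 * ψ (t n))
    (h_disj : Pairwise (Function.onFun Disjoint fun n => Ico (t n) (c n * t n)))
    (hψ : IsLacunary fun n => ψ (t n)) (hψ_div : IsLacunary fun n => ψ (t n) / t n) :
    ¬ IsGrothendieckSpace (marcinkiewiczSpace ψ γ) := by
  have hc_le {j n : ℕ} (hj : j ≤ n) : (j + 2 : ℕ) ≤ c n :=
    (Nat.cast_le.2 (by gcongr)).trans (hc n)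
  have hc₁ (n : ℕ) : 1 ≤ c n := (Nat.one_le_cast.2 (Nat.succ_pos _)).trans (hc n)
  have ht₀ (n : ℕ) : 0 < t n := (mul_pos_iff_of_pos_left (one_pos.trans_le (hc₁ n))).1 (ht n).1
  have ht_mem (n : ℕ) : t n ∈ intervalIoo γ :=
    mem_intervalIoo_of_le (ht n) (ht₀ n) (le_mul_of_one_le_left (ht₀ n).le (hc₁ n))
  have hψt (n : ℕ) : 0 < ψ (t n) := W.pos _ (ht_mem n)
  choose u hu_norm hu using fun n j => marcinkiewiczSpace.exists_setIntegral_functional W.pos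
    (ht_mem n) (volume_restrict_blockPiece_le (t n) j)
  choose f hf hf_sum using fun J => marcinkiewiczSpace.exists_hasSum_indicator (κ := Ici J)
    (pos_of_gt (ht 0).2) W.pos (fun k => measurableSet_blockPiece (t k) J)
    (fun k => (div_pos (hψt k) (ht₀ k)).le) (fun k => volume_restrict_blockPiece_le (t k) J)
    zero_le_four fun s hs => W.tsum_min_mul_div_le (fun k : Ici J => ht_mem k)
      (fun _ _ h => hψ (Subtype.val_injective.ne h))
      (fun _ _ h => hψ_div (Subtype.val_injective.ne h)) hs
  refine not_isGrothendieckSpace_of_eventually_biorthogonal (fun n j => (ψ (t n))⁻¹ • u n j) f hf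
    (fun n j => ?_) (fun r => ?_) fun i J => ?_
  · rw [norm_smul, norm_inv, Real.norm_of_nonneg (hψt n).le, inv_mul_le_iff₀ (hψt n)]
    linarith [hu_norm n j, hψt n]
  · filter_upwards [eventually_ge_atTop r] with n hn g
    simp only [smul_apply, smul_eq_mul, hu]
    refine marcinkiewiczSpace.sum_abs_inv_mul_setIntegral_le W.pos g (measurableSet_blockPiece _)
      (pairwise_disjoint_blockPiece (ht₀ n).le) _ (ht n)
      (volume_restrict_iUnion_blockPiece_le (ht₀ n).le ?_) (fun _ => hψt n) zero_le_four
      fun _ => by linarith [h_flat n, hψt n]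
    exact (Nat.cast_le.2 (by gcongr; exact one_le_two)).trans (hc n)
  · filter_upwards [eventually_ge_atTop i, eventually_ge_atTop J] with n hi hJ
    rw [smul_apply, smul_eq_mul, hu,
      setIntegral_eq_of_hasSum_indicator (hf_sum J) (measurableSet_blockPiece _ _)
        (k := ⟨n, hJ⟩) (measurableSet_blockPiece _ _) fun k hk =>
          (h_disj fun h => hk (Subtype.ext h.symm)).mono
            (blockPiece_subset_Ico (ht₀ n).le (hc_le hi))
            (blockPiece_subset_Ico (ht₀ k).le (hc_le k.2))]
    exact inv_mul_measureReal_inter_mul_div (pairwise_disjoint_blockPiece (ht₀ n).le)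
      (fun _ => ht₀ n) (fun _ => (hψt n).ne') (volume_restrict_blockPiece <|
        mem_intervalIoo_of_le (ht n) (by have := ht₀ n; positivity) <|
          mul_le_mul_of_nonneg_right (hc_le hJ) (ht₀ n).le)

theorem not_isGrothendieckSpace_of_pos_le (W : IsConcaveWeight ψ γ) (hγ : 0 < γ) {δ : ℝ}
    (hδ : 0 < δ) (h : ∀ t ∈ intervalIoo γ, δ ≤ ψ t) :
    ¬ IsGrothendieckSpace (marcinkiewiczSpace ψ γ) := by
  obtain ⟨b, hb⟩ := intervalIoo_nonempty hγ
  have hb₀ := hb.1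
  have h_mem := div_two_pow_mem_intervalIoo hb
  have h_anti : Antitone fun j : ℕ => b / 2 ^ j := fun i j hij => by
    dsimp only
    gcongr
    exact one_le_two
  refine not_isGrothendieckSpace_of_disjoint W (A := fun j => Ico (b / 2 ^ (j + 1)) (b / 2 ^ j))
    (a := fun j => b / 2 ^ (j + 1)) (s := fun _ => b) (C := ψ b / δ) (fun _ => measurableSet_Ico)
    h_anti.pairwise_disjoint_on_Ico_succ (fun j => h_mem (j + 1)) (fun j => ?_) (fun _ => hb)
    (fun _ => ?_) fun _ j => ?_
  · rw [volume_restrict_Ico (by positivity) (h_mem j), pow_succ]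
    congr 1
    field_simp
    ring
  · have h_subset (j : ℕ) : Ico (b / 2 ^ (j + 1)) (b / 2 ^ j) ⊆ Ico 0 b :=
      Ico_subset_Ico (h_mem (j + 1)).1.le (div_le_self hb₀.le (one_le_pow₀ one_le_two))
    exact (measure_mono (iUnion₂_subset fun j _ => h_subset j)).trans
      ((volume_restrict_Ico_le _ _).trans_eq (by rw [sub_zero]))
  · rw [div_mul_eq_mul_div, le_div_iff₀ hδ]
    exact mul_le_mul_of_nonneg_left (h _ (h_mem (j + 1))) (W.pos b hb).le

theorem not_isGrothendieckSpace_of_le (W : IsConcaveWeight ψ ∞) {B : ℝ} (hB : ∀ t > 0, ψ t ≤ B) :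
    ¬ IsGrothendieckSpace (marcinkiewiczSpace ψ ∞) := by
  have h_mem {t : ℝ} (ht : 0 < t) : t ∈ intervalIoo ∞ := ⟨ht, ENNReal.ofReal_lt_top⟩
  have hψ₁ : 0 < ψ 1 := W.pos 1 (h_mem one_pos)
  refine not_isGrothendieckSpace_of_disjoint W (A := blockPiece 1) (a := fun _ => 1)
    (s := fun n => (n + 2 : ℕ) * 1) (C := B / ψ 1) (measurableSet_blockPiece 1)
    (pairwise_disjoint_blockPiece zero_le_one) (fun _ => h_mem one_pos)
    (fun j => volume_restrict_blockPiece (h_mem (by positivity)))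
    (fun n => h_mem (by positivity))
    (fun n => volume_restrict_iUnion_blockPiece_le zero_le_one (Nat.cast_le.2 n.succ.le_succ))
    fun n _ => ?_
  rw [div_mul_cancel₀ _ hψ₁.ne']
  exact hB _ (by positivity)

end Necessity

section Flat

variable {ψ : ℝ → ℝ} {γ : ℝ≥0∞}

theorem exists_seq_of_forall_mem_exists {α : Type*} {s : Set α} (hs : s.Nonempty)
    {R : ℕ → α → α → Prop} (h : ∀ n, ∀ x ∈ s, ∃ y ∈ s, R n x y) :
    ∃ u : ℕ → α, (∀ n, u n ∈ s) ∧ ∀ n, R n (u n) (u (n + 1)) := by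
  obtain ⟨x₀, hx₀⟩ := hs
  choose g hg_mem hg using h
  let v : ℕ → s := Nat.rec ⟨x₀, hx₀⟩ fun n x => ⟨g n x x.2, hg_mem n x x.2⟩
  exact ⟨fun n => (v n).1, fun n => (v n).2, fun n => hg n _ (v n).2⟩

theorem IsConcaveWeight.frequently_le_two_mul (W : IsConcaveWeight ψ γ) {F : Filter ℝ}
    (hF : ¬ 1 < liminf (fun t => ((ψ (2 * t) / ψ t : ℝ) : EReal)) F) {c : ℝ} (hc : 2 ≤ c)
    (hγ : ∀ᶠ t in F, 0 < t ∧ c * t ∈ intervalIoo γ) : ∃ᶠ t in F, ψ (c * t) ≤ 2 * ψ t := by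
  have hc₀ : 0 < c := two_pos.trans_le hc
  have h_lt : liminf (fun t => ((ψ (2 * t) / ψ t : ℝ) : EReal)) F < ((1 + 1 / c : ℝ) : EReal) := by
    refine (not_lt.1 hF).trans_lt ?_
    rw [← EReal.coe_one, EReal.coe_lt_coe_iff]
    exact lt_add_of_pos_right _ (by positivity)
  refine ((frequently_lt_of_liminf_lt (by isBoundedDefault) h_lt).and_eventually hγ).mono ?_
  rintro t ⟨ht, ht₀, htc⟩
  have hψt : 0 < ψ t := W.pos t <|
    mem_intervalIoo_of_le htc ht₀ (le_mul_of_one_le_left ht₀.le (one_le_two.trans hc))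
  rw [EReal.coe_lt_coe_iff, div_lt_iff₀ hψt] at ht
  have h_double : c * (ψ (2 * t) - ψ t) ≤ ψ t := by
    rw [← le_div_iff₀' hc₀]
    linarith [one_div_mul_eq_div c (ψ t)]
  have h_mono : ψ t ≤ ψ (2 * t) :=
    W.le (mem_intervalIoo_of_le htc (by positivity) (by gcongr)) ht₀ (by linarith)
  linarith [W.sub_le_mul_sub ht₀ hc htc]

theorem IsConcaveWeight.two_mul_div_le (W : IsConcaveWeight ψ γ) {c s t : ℝ} (hc : 4 ≤ c)
    (hs : 0 < s) (ht : t ∈ intervalIoo γ) (hst : c * s ≤ t) (h_flat : ψ (c * s) ≤ 2 * ψ s) :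
    2 * (ψ t / t) ≤ ψ s / s := by
  have hcs : 0 < c * s := by positivity
  have hψs : 0 < ψ s := W.pos s <|
    mem_intervalIoo_of_le ht hs ((le_mul_of_one_le_left hs.le (by linarith)).trans hst)
  calc 2 * (ψ t / t) ≤ 2 * (ψ (c * s) / (c * s)) := by gcongr 2 * ?_; exact W.div_le_div ht hcs hst
    _ ≤ 2 * (2 * ψ s / (4 * s)) := by gcongr
    _ = ψ s / s := by field_simp; norm_num

theorem IsConcaveWeight.exists_flat_below (W : IsConcaveWeight ψ γ)
    (hF : ¬ 1 < liminf (fun t => ((ψ (2 * t) / ψ t : ℝ) : EReal)) (𝓝[>] 0))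
    (h_inf : ∀ δ > 0, ∃ t ∈ intervalIoo γ, ψ t < δ) {c s : ℝ} (hc : 2 ≤ c)
    (hs : s ∈ intervalIoo γ) :
    ∃ t ∈ intervalIoo γ, ψ (c * t) ≤ 2 * ψ t ∧ c * t ≤ s ∧ 2 * ψ t ≤ ψ s := by
  have hc₀ : 0 < c := two_pos.trans_le hc
  obtain ⟨r, hr, hrs⟩ := h_inf (ψ s / 2) (half_pos (W.pos s hs))
  have h_small {b : ℝ} (hb : 0 < b) : ∀ᶠ t in 𝓝[>] (0 : ℝ), 0 < t ∧ c * t ≤ b := by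
    filter_upwards [Ioo_mem_nhdsGT (div_pos hb hc₀)] with t ht
    exact ⟨ht.1, ((lt_div_iff₀' hc₀).1 ht.2).le⟩
  have h_mem {b t : ℝ} (hb : b ∈ intervalIoo γ) (ht : 0 < t ∧ c * t ≤ b) :
      c * t ∈ intervalIoo γ := mem_intervalIoo_of_le hb (mul_pos hc₀ ht.1) ht.2
  obtain ⟨t, ht, hts, htr⟩ := ((W.frequently_le_two_mul hF hc
    ((h_small hs.1).mono fun t ht => ⟨ht.1, h_mem hs ht⟩)).and_eventually
      ((h_small hs.1).and (h_small hr.1))).exists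
  have ht_le : t ≤ c * t := le_mul_of_one_le_left hts.1.le (one_le_two.trans hc)
  refine ⟨t, mem_intervalIoo_of_le (h_mem hs hts) hts.1 ht_le, ht, hts.2, ?_⟩
  linarith [W.le hr hts.1 (ht_le.trans htr.2)]

theorem IsConcaveWeight.exists_flat_above (W : IsConcaveWeight ψ ∞)
    (hF : ¬ 1 < liminf (fun t => ((ψ (2 * t) / ψ t : ℝ) : EReal)) atTop)
    (h_sup : ∀ B, ∃ t > 0, B < ψ t) {c : ℝ} (hc : 2 ≤ c) (s : ℝ) :
    ∃ t > 0, ψ (c * t) ≤ 2 * ψ t ∧ c * s ≤ t ∧ 2 * ψ s ≤ ψ t := by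
  obtain ⟨r, hr, hrs⟩ := h_sup (2 * ψ s)
  have h_large : ∀ᶠ t in atTop, 0 < t ∧ c * t ∈ intervalIoo ∞ := by
    filter_upwards [eventually_gt_atTop 0] with t ht
    exact ⟨ht, mul_pos (two_pos.trans_le hc) ht, ENNReal.ofReal_lt_top⟩
  obtain ⟨t, ht, hts, htr⟩ := ((W.frequently_le_two_mul hF hc h_large).and_eventually
    ((eventually_ge_atTop (c * s)).and (eventually_ge_atTop r))).exists
  have ht₀ : 0 < t := hr.trans_le htr
  exact ⟨t, ht₀, ht, hts, hrs.le.trans (W.le ⟨ht₀, ENNReal.ofReal_lt_top⟩ hr htr)⟩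

theorem not_isGrothendieckSpace_of_not_one_lt_liminf_zero (W : IsConcaveWeight ψ γ) (hγ : 0 < γ)
    (hF : ¬ 1 < liminf (fun t => ((ψ (2 * t) / ψ t : ℝ) : EReal)) (𝓝[>] 0)) :
    ¬ IsGrothendieckSpace (marcinkiewiczSpace ψ γ) := by
  by_cases! hδ : ∃ δ > 0, ∀ t ∈ intervalIoo γ, δ ≤ ψ t
  · obtain ⟨δ, hδ, h⟩ := hδ
    exact not_isGrothendieckSpace_of_pos_le W hγ hδ h
  have hc (n : ℕ) : (4 : ℝ) ≤ n + 4 := le_add_of_nonneg_left n.cast_nonneg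
  obtain ⟨u, hu, huR⟩ := exists_seq_of_forall_mem_exists (intervalIoo_nonempty hγ)
    fun n s hs => W.exists_flat_below hF hδ (c := n + 4) (by linarith [hc n]) hs
  have hψu (n : ℕ) : 0 < ψ (u n) := W.pos _ (hu n)
  have hu_anti : Antitone u := antitone_nat_of_succ_le fun n =>
    (le_mul_of_one_le_left (hu (n + 1)).1.le (by linarith [hc n])).trans (huR n).2.1
  refine not_isGrothendieckSpace_of_flat_blocks W (c := fun n => n + 4) (t := fun n => u (n + 1))
    (fun n => by push_cast; linarith)
    (fun n => mem_intervalIoo_of_le (hu n) (by have := (hu (n + 1)).1; positivity) (huR n).2.1)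
    (fun n => (huR n).1)
    (pairwise_disjoint_mono hu_anti.pairwise_disjoint_on_Ico_succ fun n =>
      Ico_subset_Ico le_rfl (huR n).2.1)
    (.of_two_mul_succ_le (fun n => (hψu (n + 1)).le) fun n => (huR (n + 1)).2.2)
    (.of_two_mul_le_succ (fun n => (div_pos (hψu (n + 1)) (hu (n + 1)).1).le) fun n => ?_)
  exact W.two_mul_div_le (hc (n + 1)) (hu (n + 2)).1 (hu (n + 1)) (huR (n + 1)).2.1
    (huR (n + 1)).1

theorem not_isGrothendieckSpace_of_not_one_lt_liminf_atTop (W : IsConcaveWeight ψ ∞)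
    (hF : ¬ 1 < liminf (fun t => ((ψ (2 * t) / ψ t : ℝ) : EReal)) atTop) :
    ¬ IsGrothendieckSpace (marcinkiewiczSpace ψ ∞) := by
  by_cases! hB : ∃ B, ∀ t > 0, ψ t ≤ B
  · obtain ⟨B, hB⟩ := hB
    exact not_isGrothendieckSpace_of_le W hB
  have hc (n : ℕ) : (4 : ℝ) ≤ n + 4 := le_add_of_nonneg_left n.cast_nonneg
  have h_mem {t : ℝ} (ht : 0 < t) : t ∈ intervalIoo ∞ := ⟨ht, ENNReal.ofReal_lt_top⟩
  obtain ⟨u, hu, huR⟩ := exists_seq_of_forall_mem_exists nonempty_Ioi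
    fun n s _ => W.exists_flat_above hF hB (c := n + 4) (by linarith [hc n]) s
  have hu_le (n : ℕ) : ((n : ℝ) + 4) * u (n + 1) ≤ u (n + 1 + 1) :=
    (mul_le_mul_of_nonneg_right (by push_cast; linarith) (hu (n + 1)).le).trans
      (huR (n + 1)).2.1
  have hψu (n : ℕ) : 0 < ψ (u n) := W.pos _ (h_mem (hu n))
  have hu_mono : Monotone fun n => u (n + 1) := monotone_nat_of_le_succ fun n =>
    (le_mul_of_one_le_left (hu (n + 1)).le (by linarith [hc n])).trans (hu_le n)
  refine not_isGrothendieckSpace_of_flat_blocks W (c := fun n => n + 4) (t := fun n => u (n + 1))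
    (fun n => by push_cast; linarith)
    (fun n => h_mem (mul_pos (by positivity) (hu (n + 1)))) (fun n => (huR n).1)
    (pairwise_disjoint_mono hu_mono.pairwise_disjoint_on_Ico_succ fun n =>
      Ico_subset_Ico le_rfl (hu_le n))
    (.of_two_mul_le_succ (fun n => (hψu (n + 1)).le) fun n => (huR (n + 1)).2.2)
    (.of_two_mul_succ_le (fun n => (div_pos (hψu (n + 1)) (hu (n + 1))).le) fun n => ?_)
  exact W.two_mul_div_le (hc n) (hu (n + 1)) (h_mem (hu (n + 2))) (hu_le n) (huR n).1

end Flat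

theorem theorem4 (γ : ℝ≥0∞) (hγ : 0 < γ) (ψ : ℝ → ℝ)
    (hψ_nonneg : ∀ t ∈ intervalIco γ, 0 ≤ ψ t)
    (hψ_ne : ∃ t ∈ intervalIco γ, ψ t ≠ 0)
    (hψ_mono : MonotoneOn ψ (intervalIco γ))
    (hψ_concave : ConcaveOn ℝ (intervalIco γ) ψ)
    (hψ_cont : ContinuousOn ψ (intervalIoo γ))
    (hψ_zero : ψ 0 = 0) :
    IsGrothendieckSpace (marcinkiewiczSpace ψ γ) ↔ ConditionA ψ γ ∨ ConditionB ψ γ := by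
  have W := IsConcaveWeight.of_ne_zero hψ_nonneg hψ_ne hψ_mono hψ_concave hψ_zero
  refine ⟨fun hG => ?_, isGrothendieckSpace_of_condition W hγ⟩
  have h_zero : 1 < liminf (fun t => ((ψ (2 * t) / ψ t : ℝ) : EReal)) (𝓝[>] 0) :=
    not_not.1 fun h => not_isGrothendieckSpace_of_not_one_lt_liminf_zero W hγ h hG
  rcases eq_or_ne γ ∞ with rfl | hγ_top
  · exact .inl ⟨rfl, h_zero,
      not_not.1 fun h => not_isGrothendieckSpace_of_not_one_lt_liminf_atTop W h hG⟩
  · exact .inr ⟨hγ_top.lt_top, h_zero⟩
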